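/- **Setting.** Let $N,P,r_1,r_2,r_3,T,m$ be natural numbers with $N,P\ge 1$, and let $\mathcal A\in\mathbb R^{N\times N\times P}$ be a tensor with frontal slices $\mathbf A_1,\dots,\mathbf A_P$ and matricizations satisfying $\operatorname{rank}(\mathcal A_{(i)})\le r_i$ for $i=1,2,3$; the mode-1 matricization is $\mathcal A_{(1)}=(\mathbf A_1,\dots,\mathbf A_P)$. Put $\mathcal A(z)=\mathbf I_N-\mathbf A_1z-\cdots-\mathbf A_Pz^P$, $$\mu_{\min}(\mathcal A)=\min_{|z|=1}\lambda_{\min}(\mathcal A^*(z)\mathcal A(z)),\qquad \mu_{\max}(\mathcal A)=\max_{|z|=1}\lambda_{\max}(\mathcal A^*(z)\mathcal A(z)),$$ and assume that $\det\mathcal A(z)\ne0$ for all $|z|<1$ and that $\mu_{\min}(\mathcal A)>0$ (so that $\kappa_U$ below is finite). * *Model errors.* $\boldsymbol\varepsilon_n=\boldsymbol\Sigma_\varepsilon^{1/2}\boldsymbol\xi_n$ $(n\in\mathbb Z)$, where $\boldsymbol\Sigma_\varepsilon$ is positive definite and $\{\boldsymbol\xi_n\}$ are i.i.d. random vectors in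 $\mathbb R^N$ with mean zero, identity covariance matrix, and mutually independent entries that are $\kappa^2$-sub-Gaussian, i.e. $\mathbb E e^{t\xi_{in}}\le e^{\kappa^2t^2/2}$ for all $t\in\mathbb R$. * *Integrated volatilities.* $\{\mathbf y_n\}_{n\in\mathbb Z}$ is strictly stationary and $\mathbf y_n=\sum_{j=1}^P\mathbf A_j\mathbf y_{n-j}+\boldsymbol\varepsilon_n$ almost surely. * *Realized volatilities.* $\widetilde{\mathbf y}_n=\mathbf y_n+\boldsymbol\eta_n$ for $1\le n\le T$, where the estimation errors $\{\boldsymbol\eta_n\}_{1\le n\le T}$ are independent of $\{\boldsymbol\varepsilon_n\}$ and $\max_{1\le n\le T}\max_{1\le i\le N}\mathbb E|\eta_{i,n}|^2\le K m^{-1/2}$, $K>0$. Let $\widetilde{\mathbf x}_n=(\widetilde{\mathbf y}_{n-1}^\top,\dots,\widetilde{\mathbf y}_{n-P}^\top)^\top$, and let $\widehat{\mathcal A}_{\rm MLR}=\widehat{\mathcal G}\times_1\widehat{\mathbf U}_1\times_2\widehat{\mathbf U}_2\times_3\widehat{\mathbf U}_3$ be given by any minimizer of $$\frac1T\sum_{n=P+1}^T\big\|\widetilde{\mathbf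 y}_n-(\mathcal G\times_1\mathbf U_1\times_2\mathbf U_2\times_3\mathbf U_3)_{(1)}\widetilde{\mathbf x}_n\big\|_2^2$$ over $\mathcal G\in\mathbb R^{r_1\times r_2\times r_3}$, $\mathbf U_1\in\mathbb R^{N\times r_1}$, $\mathbf U_2\in\mathbb R^{N\times r_2}$, $\mathbf U_3\in\mathbb R^{P\times r_3}$. Write $\kappa_L=\lambda_{\min}(\boldsymbol\Sigma_\varepsilon)/\mu_{\max}(\mathcal A)$, $\kappa_U=\lambda_{\max}(\boldsymbol\Sigma_\varepsilon)/\mu_{\min}(\mathcal A)$ and $d_{\mathcal M}=r_1r_2r_3+Nr_1+Nr_2+Pr_3$. **Theorem.** There are an absolute constant $C>0$, constants $c,c_1>0$ depending only on $P$, and a constant $c_2>0$ depending only on $P$ and $K$, such that the following holds in the above setting. If, for some $\delta>0$, $$T\ge c_1\max(\kappa^2,\kappa^4)\Big(\frac{\kappa_U}{\kappa_L}\Big)^2d_{\mathcal M},\qquad m^{1/4}T^{2\delta}\ge c_2N^2P\exp(d_{\mathcal M}),\qquad m^{1/4}\ge c_2T^{1+2\delta},$$ then, with probability at least $$1-\exp(-c\,d_{\mathcal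 M})-2\exp\!\big(-c\,T(\kappa_L/\kappa_U)^2\min\{\kappa^{-2},\kappa^{-4}\}\big),$$ the minimizer exists and every minimizer satisfies $$\|\widehat{\mathcal A}_{\rm MLR}-\mathcal A\|_{\rm F}\le\frac{C}{\kappa_L}\left[\big(\kappa^2\sqrt{\lambda_{\max}(\boldsymbol\Sigma_\varepsilon)\kappa_U}+\kappa\sqrt{\kappa_U}\big)\sqrt{\frac{d_{\mathcal M}}{T}}+\frac{T^{1+2\delta}}{m^{1/4}}\right]$$ and $$\frac1T\sum_{n=P+1}^T\big\|(\widehat{\mathcal A}_{\rm MLR})_{(1)}\widetilde{\mathbf x}_n-\mathcal A_{(1)}\widetilde{\mathbf x}_n\big\|_2^2\le\frac{C}{\kappa_L}\left[\big(\kappa^2\sqrt{\lambda_{\max}(\boldsymbol\Sigma_\varepsilon)\kappa_U}+\kappa\sqrt{\kappa_U}\big)\sqrt{\frac{d_{\mathcal M}}{T}}+\frac{T^{1+2\delta}}{m^{1/4}}\right]^2.$$ -/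

import Mathlib

open MeasureTheory ProbabilityTheory
open scoped NNReal Matrix

noncomputable section

namespace MLRHAR

/-! ### Third-order tensors -/

/-- Real tensors of size `p₁ × p₂ × p₃`. -/
abbrev Tensor (p₁ p₂ p₃ : ℕ) : Type := Fin p₁ → Fin p₂ → Fin p₃ → ℝ

/-- Frobenius norm of a tensor. -/
def frob {p₁ p₂ p₃ : ℕ} (X : Tensor p₁ p₂ p₃) : ℝ :=
  Real.sqrt (∑ i, ∑ j, ∑ k, X i j k ^ 2)

/-- Mode-1 matricization; the column `(k, j)` is the `j`-th column of the `k`-th frontal slice, so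
that in lexicographic order of columns `X₍₁₎ = (X_{::1}, …, X_{::p₃})`. -/
def unfold₁ {p₁ p₂ p₃ : ℕ} (X : Tensor p₁ p₂ p₃) : Matrix (Fin p₁) (Fin p₃ × Fin p₂) ℝ :=
  Matrix.of fun i q => X i q.2 q.1

/-- Mode-2 matricization. -/
def unfold₂ {p₁ p₂ p₃ : ℕ} (X : Tensor p₁ p₂ p₃) : Matrix (Fin p₂) (Fin p₃ × Fin p₁) ℝ :=
  Matrix.of fun j q => X q.2 j q.1

/-- Mode-3 matricization. -/
def unfold₃ {p₁ p₂ p₃ : ℕ} (X : Tensor p₁ p₂ p₃) : Matrix (Fin p₃) (Fin p₂ × Fin p₁) ℝ :=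
  Matrix.of fun k q => X q.2 q.1 k

/-- The Tucker product `G ×₁ U₁ ×₂ U₂ ×₃ U₃`. -/
def tucker {p₁ p₂ p₃ r₁ r₂ r₃ : ℕ} (G : Tensor r₁ r₂ r₃)
    (U₁ : Matrix (Fin p₁) (Fin r₁) ℝ) (U₂ : Matrix (Fin p₂) (Fin r₂) ℝ)
    (U₃ : Matrix (Fin p₃) (Fin r₃) ℝ) : Tensor p₁ p₂ p₃ :=
  fun i j k => ∑ a, ∑ b, ∑ c, G a b c * U₁ i a * U₂ j b * U₃ k c

/-- The `k`-th coefficient matrix (frontal slice) of a coefficient tensor; `slice A k` is the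
coefficient of lag `k + 1`. -/
def slice {N P : ℕ} (A : Tensor N N P) (k : Fin P) : Matrix (Fin N) (Fin N) ℝ :=
  Matrix.of fun i j => A i j k

/-! ### Eigenvalues and dependence measures -/

/-- Largest real eigenvalue (used for Hermitian matrices only). -/
def lamMax {𝕜 : Type} [RCLike 𝕜] {n : ℕ} (M : Matrix (Fin n) (Fin n) 𝕜) : ℝ :=
  sSup (spectrum ℝ M)

/-- Smallest real eigenvalue (used for Hermitian matrices only). -/
def lamMin {𝕜 : Type} [RCLike 𝕜] {n : ℕ} (M : Matrix (Fin n) (Fin n) 𝕜) : ℝ :=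
  sInf (spectrum ℝ M)

/-- The matrix polynomial `I - A₁ z - ⋯ - A_P z ^ P`. -/
def matPoly {N P : ℕ} (A : Tensor N N P) (z : ℂ) : Matrix (Fin N) (Fin N) ℂ :=
  1 - ∑ k : Fin P, z ^ (k.val + 1) • (slice A k).map (fun x : ℝ => (x : ℂ))

/-- `μ_min(A)`: the minimum over `|z| = 1` of `λ_min(A(z)ᴴ A(z))`. -/
def muMin {N P : ℕ} (A : Tensor N N P) : ℝ :=
  ⨅ z : Circle, lamMin ((matPoly A z)ᴴ * matPoly A z)

/-- `μ_max(A)`: the maximum over `|z| = 1` of `λ_max(A(z)ᴴ A(z))`. -/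
def muMax {N P : ℕ} (A : Tensor N N P) : ℝ :=
  ⨆ z : Circle, lamMax ((matPoly A z)ᴴ * matPoly A z)

/-- `κ_L = λ_min(Σ) / μ_max(A)`. -/
def kappaL {N P : ℕ} (A : Tensor N N P) (S : Matrix (Fin N) (Fin N) ℝ) : ℝ :=
  lamMin S / muMax A

/-- `κ_U = λ_max(Σ) / μ_min(A)`. -/
def kappaU {N P : ℕ} (A : Tensor N N P) (S : Matrix (Fin N) (Fin N) ℝ) : ℝ :=
  lamMax S / muMin A

/-- `d_M = r₁ r₂ r₃ + N r₁ + N r₂ + P r₃`. -/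
def dM (N P r₁ r₂ r₃ : ℕ) : ℕ := r₁ * r₂ * r₃ + N * r₁ + N * r₂ + P * r₃

/-! ### The model -/

section sqrtm

open scoped MatrixOrder

/-- The positive semidefinite square root of a positive semidefinite matrix. -/
def sqrtm {N : ℕ} (S : Matrix (Fin N) (Fin N) ℝ) : Matrix (Fin N) (Fin N) ℝ := CFC.sqrt S

end sqrtm

/-- The model errors `ε_n = Σ^{1/2} ξ_n`. -/
def modelError {Ω : Type*} {N : ℕ} (S : Matrix (Fin N) (Fin N) ℝ) (ξ : ℤ → Ω → Fin N → ℝ)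
    (n : ℤ) (ω : Ω) : Fin N → ℝ :=
  sqrtm S *ᵥ ξ n ω

/-- The standardized innovations are i.i.d. with mean zero and identity covariance matrix, and have
mutually independent `κ²`-sub-Gaussian entries. -/
structure IsSubGaussianNoise {Ω : Type*} [MeasurableSpace Ω] (μ : Measure Ω) {N : ℕ} (κ : ℝ≥0)
    (ξ : ℤ → Ω → Fin N → ℝ) : Prop where
  measurable : ∀ n, Measurable (ξ n)
  indep : iIndepFun ξ μ
  identDistrib : ∀ n n', IdentDistrib (ξ n) (ξ n') μ μ
  mean_zero : ∀ n i, ∫ ω, ξ n ω i ∂μ = 0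
  cov_one : ∀ n i j, ∫ ω, ξ n ω i * ξ n ω j ∂μ = (1 : Matrix (Fin N) (Fin N) ℝ) i j
  indep_entries : ∀ n, iIndepFun (fun i ω => ξ n ω i) μ
  subGaussian : ∀ n i, HasSubgaussianMGF (fun ω => ξ n ω i) (κ ^ 2) μ

/-- `y` is a strictly stationary solution of `y_n = A₁ y_{n-1} + ⋯ + A_P y_{n-P} + ε_n`. -/
structure IsStationaryVAR {Ω : Type*} [MeasurableSpace Ω] (μ : Measure Ω) {N P : ℕ}
    (A : Tensor N N P) (ε y : ℤ → Ω → Fin N → ℝ) : Prop where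
  measurable : ∀ n, Measurable (y n)
  stationary : ∀ h : ℤ, IdentDistrib (fun ω (n : ℤ) => y (n + h) ω) (fun ω (n : ℤ) => y n ω) μ μ
  equation : ∀ n, ∀ᵐ ω ∂μ,
    y n ω = ∑ k : Fin P, slice A k *ᵥ y (n - 1 - (k.val : ℤ)) ω + ε n ω

/-- The estimation errors `η_1, …, η_T` satisfy `max_{n,i} E |η_{i,n}|² ≤ K m^{-1/2}`. -/
structure HasMomentBound {Ω : Type*} [MeasurableSpace Ω] (μ : Measure Ω) {N : ℕ} (K : ℝ)
    (T m : ℕ) (η : ℤ → Ω → Fin N → ℝ) : Prop where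
  measurable : ∀ n ∈ Set.Icc (1 : ℤ) T, Measurable (η n)
  memLp : ∀ n ∈ Set.Icc (1 : ℤ) T, ∀ i, MemLp (fun ω => η n ω i) 2 μ
  bound : ∀ n ∈ Set.Icc (1 : ℤ) T, ∀ i, ∫ ω, η n ω i ^ 2 ∂μ ≤ K * (m : ℝ) ^ (-(1 / 2) : ℝ)

/-! ### Least squares -/

/-- The stacked predictor `x_n = (u_{n-1}ᵀ, …, u_{n-P}ᵀ)ᵀ` of a sequence `u`. -/
def predictor {N : ℕ} (P : ℕ) (u : ℤ → Fin N → ℝ) (n : ℤ) : Fin P × Fin N → ℝ :=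
  fun q => u (n - 1 - (q.1.val : ℤ)) q.2

/-- The least-squares loss `T⁻¹ ∑_{n=P+1}^T ‖u_n - B₍₁₎ x_n‖₂²`. -/
def loss {N P : ℕ} (T : ℕ) (u : ℤ → Fin N → ℝ) (B : Tensor N N P) : ℝ :=
  (1 / (T : ℝ)) * ∑ n ∈ Finset.Icc ((P : ℤ) + 1) T,
    ∑ i, (u n i - (unfold₁ B *ᵥ predictor P u n) i) ^ 2

/-- `B` is a Tucker-constrained least-squares estimate: it is the Tucker product of a minimizer
`(Ĝ, Û₁, Û₂, Û₃)` of the least-squares loss. -/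
def IsMLREstimate {N P : ℕ} (T r₁ r₂ r₃ : ℕ) (u : ℤ → Fin N → ℝ) (B : Tensor N N P) : Prop :=
  ∃ (G : Tensor r₁ r₂ r₃) (U₁ : Matrix (Fin N) (Fin r₁) ℝ) (U₂ : Matrix (Fin N) (Fin r₂) ℝ)
    (U₃ : Matrix (Fin P) (Fin r₃) ℝ), B = tucker G U₁ U₂ U₃ ∧
    ∀ (G' : Tensor r₁ r₂ r₃) (U₁' : Matrix (Fin N) (Fin r₁) ℝ) (U₂' : Matrix (Fin N) (Fin r₂) ℝ)
      (U₃' : Matrix (Fin P) (Fin r₃) ℝ),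
      loss T u (tucker G U₁ U₂ U₃) ≤ loss T u (tucker G' U₁' U₂' U₃')

/-- In-sample prediction error `T⁻¹ ∑_{n=P+1}^T ‖B₍₁₎ x_n - A₍₁₎ x_n‖₂²`. -/
def predError {N P : ℕ} (T : ℕ) (u : ℤ → Fin N → ℝ) (A B : Tensor N N P) : ℝ :=
  (1 / (T : ℝ)) * ∑ n ∈ Finset.Icc ((P : ℤ) + 1) T,
    ∑ i, ((unfold₁ B *ᵥ predictor P u n) i - (unfold₁ A *ᵥ predictor P u n) i) ^ 2

/-- The rate `(κ² √(λ_max(Σ) κ_U) + κ √κ_U) √(d_M / T) + T^{1+2δ} / m^{1/4}`. -/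
def rate {N P : ℕ} (A : Tensor N N P) (S : Matrix (Fin N) (Fin N) ℝ) (κ δ : ℝ)
    (d T m : ℕ) : ℝ :=
  (κ ^ 2 * Real.sqrt (lamMax S * kappaU A S) + κ * Real.sqrt (kappaU A S))
      * Real.sqrt ((d : ℝ) / T)
    + (T : ℝ) ^ (1 + 2 * δ) / (m : ℝ) ^ (1 / 4 : ℝ)

end MLRHAR

end

open Filter Topology

namespace MLRHAR


/-! ### Rayleigh bounds -/

section rayleigh

open scoped MatrixOrder ComplexOrder

variable {𝕜 : Type} [RCLike 𝕜] {n : ℕ} {M : Matrix (Fin n) (Fin n) 𝕜}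

lemma finite_spectrum_real (hM : M.IsHermitian) : (spectrum ℝ M).Finite := by
  rw [hM.spectrum_real_eq_range_eigenvalues]; exact Set.finite_range _

lemma nonempty_spectrum_real (hn : 0 < n) (hM : M.IsHermitian) : (spectrum ℝ M).Nonempty := by
  rw [hM.spectrum_real_eq_range_eigenvalues]
  have : Nonempty (Fin n) := ⟨⟨0, hn⟩⟩
  exact Set.range_nonempty _

lemma lamMin_mul_le (hM : M.IsHermitian) (x : Fin n → 𝕜) :
    lamMin M * RCLike.re (star x ⬝ᵥ x) ≤ RCLike.re (star x ⬝ᵥ M *ᵥ x) := by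
  have h : algebraMap ℝ (Matrix (Fin n) (Fin n) 𝕜) (lamMin M) ≤ M :=
    (algebraMap_le_iff_le_spectrum (a := M) hM).2
      fun x hx => csInf_le (finite_spectrum_real hM).bddBelow hx
  have := (Matrix.le_iff.1 h).re_dotProduct_nonneg x
  simp only [Matrix.sub_mulVec, dotProduct_sub, map_sub, Algebra.algebraMap_eq_smul_one,
    Matrix.smul_mulVec, Matrix.one_mulVec, dotProduct_smul, RCLike.smul_re] at this
  linarith

lemma le_lamMax_mul (hM : M.IsHermitian) (x : Fin n → 𝕜) :
    RCLike.re (star x ⬝ᵥ M *ᵥ x) ≤ lamMax M * RCLike.re (star x ⬝ᵥ x) := by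
  have h : M ≤ algebraMap ℝ (Matrix (Fin n) (Fin n) 𝕜) (lamMax M) :=
    (le_algebraMap_iff_spectrum_le (a := M) hM).2
      fun x hx => le_csSup (finite_spectrum_real hM).bddAbove hx
  have := (Matrix.le_iff.1 h).re_dotProduct_nonneg x
  simp only [Matrix.sub_mulVec, dotProduct_sub, map_sub, Algebra.algebraMap_eq_smul_one,
    Matrix.smul_mulVec, Matrix.one_mulVec, dotProduct_smul, RCLike.smul_re] at this
  linarith

lemma lamMin_le_lamMax (hn : 0 < n) (hM : M.IsHermitian) : lamMin M ≤ lamMax M :=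
  csInf_le_csSup (nonempty_spectrum_real hn hM) (finite_spectrum_real hM).bddBelow
    (finite_spectrum_real hM).bddAbove

lemma lamMin_pos (hn : 0 < n) (hM : M.PosDef) : 0 < lamMin M := by
  have h := (nonempty_spectrum_real hn hM.1).csInf_mem (finite_spectrum_real hM.1)
  rw [hM.1.spectrum_real_eq_range_eigenvalues] at h
  obtain ⟨i, hi⟩ := h
  rw [lamMin, hM.1.spectrum_real_eq_range_eigenvalues, ← hi]
  exact hM.eigenvalues_pos i

lemma lamMin_nonneg (hM : M.PosSemidef) : 0 ≤ lamMin M := by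
  refine Real.sInf_nonneg fun x hx => ?_
  rw [hM.1.spectrum_real_eq_range_eigenvalues] at hx
  obtain ⟨i, rfl⟩ := hx
  exact hM.eigenvalues_nonneg i

lemma lamMax_le_of_forall (hn : 0 < n) (hM : M.IsHermitian) {c : ℝ}
    (h : ∀ x : Fin n → 𝕜, RCLike.re (star x ⬝ᵥ M *ᵥ x) ≤ c * RCLike.re (star x ⬝ᵥ x)) :
    lamMax M ≤ c := by
  refine csSup_le (nonempty_spectrum_real hn hM) ?_
  refine (le_algebraMap_iff_spectrum_le (a := M) hM).1 ?_
  rw [Matrix.le_iff, Matrix.posSemidef_iff_dotProduct_mulVec]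
  have hH : (algebraMap ℝ (Matrix (Fin n) (Fin n) 𝕜) c - M).IsHermitian := by
    refine Matrix.IsHermitian.sub ?_ hM
    rw [Algebra.algebraMap_eq_smul_one]
    simp [Matrix.IsHermitian, Matrix.conjTranspose_smul]
  refine ⟨hH, fun x => ?_⟩
  rw [RCLike.nonneg_iff]
  refine ⟨?_, hH.im_star_dotProduct_mulVec_self x⟩
  have := h x
  simp only [Matrix.sub_mulVec, dotProduct_sub, map_sub, Algebra.algebraMap_eq_smul_one,
    Matrix.smul_mulVec, Matrix.one_mulVec, dotProduct_smul, RCLike.smul_re]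
  linarith

lemma posSemidef_sqrtm (S : Matrix (Fin n) (Fin n) ℝ) : (sqrtm S).PosSemidef :=
  Matrix.nonneg_iff_posSemidef.1 (CFC.sqrt_nonneg S)

lemma sqrtm_mul_self {S : Matrix (Fin n) (Fin n) ℝ} (hS : S.PosSemidef) :
    sqrtm S * sqrtm S = S := CFC.sqrt_mul_sqrt_self S hS.nonneg

end rayleigh

lemma sqrtm_transpose {n : ℕ} (S : Matrix (Fin n) (Fin n) ℝ) : (sqrtm S)ᵀ = sqrtm S := by
  have := (posSemidef_sqrtm S).1
  rwa [Matrix.IsHermitian, Matrix.conjTranspose_eq_transpose_of_trivial] at this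

lemma dotProduct_sqrtm_mulVec {n : ℕ} (S : Matrix (Fin n) (Fin n) ℝ) (u x : Fin n → ℝ) :
    u ⬝ᵥ sqrtm S *ᵥ x = (sqrtm S *ᵥ u) ⬝ᵥ x := by
  rw [Matrix.dotProduct_mulVec, ← Matrix.mulVec_transpose, sqrtm_transpose]

lemma sqrtm_mulVec_dotProduct_self {n : ℕ} {S : Matrix (Fin n) (Fin n) ℝ} (hS : S.PosSemidef)
    (u : Fin n → ℝ) : (sqrtm S *ᵥ u) ⬝ᵥ (sqrtm S *ᵥ u) = u ⬝ᵥ S *ᵥ u := by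
  rw [← dotProduct_sqrtm_mulVec, Matrix.mulVec_mulVec, sqrtm_mul_self hS]

lemma sqrtm_dotProduct_le {n : ℕ} {S : Matrix (Fin n) (Fin n) ℝ} (hS : S.PosSemidef)
    (u : Fin n → ℝ) : (sqrtm S *ᵥ u) ⬝ᵥ (sqrtm S *ᵥ u) ≤ lamMax S * (u ⬝ᵥ u) := by
  rw [sqrtm_mulVec_dotProduct_self hS]
  simpa using le_lamMax_mul hS.1 u

lemma le_sqrtm_dotProduct {n : ℕ} {S : Matrix (Fin n) (Fin n) ℝ} (hS : S.PosSemidef)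
    (u : Fin n → ℝ) : lamMin S * (u ⬝ᵥ u) ≤ (sqrtm S *ᵥ u) ⬝ᵥ (sqrtm S *ᵥ u) := by
  rw [sqrtm_mulVec_dotProduct_self hS]
  simpa using lamMin_mul_le hS.1 u

/-! ### Bounds for the symbol on the unit circle -/

section symbol

open scoped ComplexOrder

variable {N P : ℕ} (A : Tensor N N P)

lemma re_star_dotProduct_self {n : ℕ} (x : Fin n → ℂ) :
    RCLike.re (star x ⬝ᵥ x) = ∑ i, ‖x i‖ ^ 2 := by
  simp only [dotProduct, Pi.star_apply, map_sum]
  refine Finset.sum_congr rfl fun i _ => ?_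
  rw [RCLike.star_def, RCLike.conj_mul, ← RCLike.ofReal_pow, RCLike.ofReal_re]

lemma re_star_dotProduct_gram {n : ℕ} (B : Matrix (Fin n) (Fin n) ℂ) (x : Fin n → ℂ) :
    RCLike.re (star x ⬝ᵥ (Bᴴ * B) *ᵥ x) = ∑ i, ‖(B *ᵥ x) i‖ ^ 2 := by
  rw [← re_star_dotProduct_self, Matrix.star_mulVec, ← Matrix.dotProduct_mulVec,
    Matrix.mulVec_mulVec]

lemma lamMin_gram_mul_le {n : ℕ} (B : Matrix (Fin n) (Fin n) ℂ) (x : Fin n → ℂ) :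
    lamMin (Bᴴ * B) * ∑ i, ‖x i‖ ^ 2 ≤ ∑ i, ‖(B *ᵥ x) i‖ ^ 2 := by
  rw [← re_star_dotProduct_gram, ← re_star_dotProduct_self]
  exact lamMin_mul_le (Matrix.isHermitian_conjTranspose_mul_self B) x

lemma le_lamMax_gram_mul {n : ℕ} (B : Matrix (Fin n) (Fin n) ℂ) (x : Fin n → ℂ) :
    ∑ i, ‖(B *ᵥ x) i‖ ^ 2 ≤ lamMax (Bᴴ * B) * ∑ i, ‖x i‖ ^ 2 := by
  rw [← re_star_dotProduct_gram, ← re_star_dotProduct_self]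
  exact le_lamMax_mul (Matrix.isHermitian_conjTranspose_mul_self B) x

lemma muMin_le (z : Circle) : muMin A ≤ lamMin ((matPoly A z)ᴴ * matPoly A z) :=
  ciInf_le ⟨0, by
    rintro _ ⟨z, rfl⟩; exact lamMin_nonneg (Matrix.posSemidef_conjTranspose_mul_self _)⟩ z

lemma norm_matPoly_apply_le (z : Circle) (i j : Fin N) :
    ‖matPoly A z i j‖ ≤ 1 + ∑ k, |A i j k| := by
  rw [matPoly, Matrix.sub_apply]
  refine (norm_sub_le _ _).trans (add_le_add ?_ ?_)
  · rw [Matrix.one_apply]; split_ifs <;> simp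
  · rw [Matrix.sum_apply]
    refine (norm_sum_le _ _).trans (Finset.sum_le_sum fun k _ => ?_)
    have hz : ‖(z : ℂ)‖ = 1 := Circle.norm_coe z
    simp [slice, hz]

lemma le_muMax (hN : 0 < N) (z : Circle) : lamMax ((matPoly A z)ᴴ * matPoly A z) ≤ muMax A := by
  refine le_ciSup (f := fun z : Circle => lamMax ((matPoly A z)ᴴ * matPoly A z)) ?_ z
  refine ⟨∑ i, ∑ j, (1 + ∑ k, |A i j k|) ^ 2, ?_⟩
  rintro _ ⟨z, rfl⟩
  refine lamMax_le_of_forall hN (Matrix.isHermitian_conjTranspose_mul_self _) fun x => ?_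
  rw [re_star_dotProduct_gram, re_star_dotProduct_self, Finset.sum_mul]
  refine Finset.sum_le_sum fun i _ => ?_
  calc ‖(matPoly A z *ᵥ x) i‖ ^ 2 ≤ (∑ j, (1 + ∑ k, |A i j k|) * ‖x j‖) ^ 2 := by
        gcongr
        refine (norm_sum_le Finset.univ fun j => matPoly A z i j * x j).trans
          (Finset.sum_le_sum fun j _ => ?_)
        rw [norm_mul]; gcongr; exact norm_matPoly_apply_le A z i j
    _ ≤ _ := Finset.sum_mul_sq_le_sq_mul_sq _ _ _

/-- If `‖B x‖² ≥ c ‖x‖²` for all `x`, the same holds for `Bᵀ`. -/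
lemma mul_le_transpose_mulVec {n : ℕ} {B : Matrix (Fin n) (Fin n) ℂ} {c : ℝ} (hc : 0 < c)
    (h : ∀ x : Fin n → ℂ, c * ∑ i, ‖x i‖ ^ 2 ≤ ∑ i, ‖(B *ᵥ x) i‖ ^ 2) (x : Fin n → ℂ) :
    c * ∑ i, ‖x i‖ ^ 2 ≤ ∑ i, ‖(Bᵀ *ᵥ x) i‖ ^ 2 := by
  have hinj : Function.Injective B.mulVec := by
    rw [← Matrix.coe_mulVecLin]
    refine (injective_iff_map_eq_zero B.mulVecLin).2 fun x hx => ?_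
    have h1 := h x
    rw [Matrix.mulVecLin_apply] at hx
    rw [hx] at h1
    have h2 : ∑ i, ‖x i‖ ^ 2 = 0 := by
      refine le_antisymm ?_ (by positivity)
      simp only [Pi.zero_apply, norm_zero] at h1
      norm_num at h1
      by_contra! h3
      have := mul_pos hc h3
      linarith
    rw [Finset.sum_eq_zero_iff_of_nonneg (fun _ _ => by positivity)] at h2
    ext i
    simpa using h2 i (Finset.mem_univ i)
  have hunit : IsUnit B := Matrix.mulVec_injective_iff_isUnit.1 hinj
  obtain ⟨w, hw⟩ : ∃ w, B *ᵥ w = star x := by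
    have := (Matrix.mulVec_surjective_iff_isUnit (A := B)).2 hunit
    exact this _
  have key : (∑ i, ‖x i‖ ^ 2) = RCLike.re ((Bᵀ *ᵥ x) ⬝ᵥ w) := by
    rw [Matrix.mulVec_transpose, ← Matrix.dotProduct_mulVec, hw, ← re_star_dotProduct_self,
      dotProduct_comm]
  set X := ∑ i, ‖x i‖ ^ 2
  set Y := ∑ i, ‖(Bᵀ *ᵥ x) i‖ ^ 2
  have hX0 : 0 ≤ X := by positivity
  have hw2 : c * ∑ i, ‖w i‖ ^ 2 ≤ X := by
    have := h w
    rw [hw] at this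
    simpa using this
  have cs : X ^ 2 ≤ Y * ∑ i, ‖w i‖ ^ 2 := by
    have : X ≤ ∑ i, ‖(Bᵀ *ᵥ x) i‖ * ‖w i‖ := by
      rw [key]
      refine (RCLike.re_le_norm _).trans ((norm_sum_le _ _).trans (le_of_eq ?_))
      simp
    exact (pow_le_pow_left₀ hX0 this 2).trans (Finset.sum_mul_sq_le_sq_mul_sq _ _ _)
  rcases hX0.eq_or_lt with h0 | h0
  · rw [← h0, mul_zero]; positivity
  · have hY : 0 ≤ Y := by positivity
    have : c * X * X ≤ Y * X := by nlinarith
    exact le_of_mul_le_mul_right this h0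

/-- If `‖B x‖² ≤ c ‖x‖²` for all `x`, the same holds for `Bᵀ`. -/
lemma transpose_mulVec_le_mul {n : ℕ} {B : Matrix (Fin n) (Fin n) ℂ} {c : ℝ}
    (h : ∀ x : Fin n → ℂ, ∑ i, ‖(B *ᵥ x) i‖ ^ 2 ≤ c * ∑ i, ‖x i‖ ^ 2) (x : Fin n → ℂ) :
    ∑ i, ‖(Bᵀ *ᵥ x) i‖ ^ 2 ≤ c * ∑ i, ‖x i‖ ^ 2 := by
  set w : Fin n → ℂ := star (Bᵀ *ᵥ x) with hw
  have key : (∑ i, ‖(Bᵀ *ᵥ x) i‖ ^ 2) = RCLike.re (x ⬝ᵥ (B *ᵥ w)) := by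
    rw [Matrix.dotProduct_mulVec, ← Matrix.mulVec_transpose, ← re_star_dotProduct_self,
      dotProduct_comm]
  have hw2 : ∑ i, ‖(Bᵀ *ᵥ x) i‖ ^ 2 = ∑ i, ‖w i‖ ^ 2 := by simp [hw]
  set Y := ∑ i, ‖(Bᵀ *ᵥ x) i‖ ^ 2
  set X := ∑ i, ‖x i‖ ^ 2
  have hX0 : 0 ≤ X := by positivity
  have hY0 : 0 ≤ Y := by positivity
  have cs : Y ^ 2 ≤ X * (c * Y) := by
    have h1 : Y ≤ ∑ i, ‖x i‖ * ‖(B *ᵥ w) i‖ := by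
      rw [key]
      refine (RCLike.re_le_norm _).trans ((norm_sum_le _ _).trans (le_of_eq ?_))
      simp
    refine ((pow_le_pow_left₀ hY0 h1 2).trans (Finset.sum_mul_sq_le_sq_mul_sq _ _ _)).trans ?_
    gcongr
    rw [hw2]; exact h w
  rcases hY0.eq_or_lt with h0 | h0
  · rw [← h0]
    have := h x
    exact le_trans (by positivity) this
  · nlinarith

lemma muMin_mul_le_transpose (hA : 0 < muMin A) (z : Circle) (x : Fin N → ℂ) :
    muMin A * ∑ i, ‖x i‖ ^ 2 ≤ ∑ i, ‖((matPoly A z)ᵀ *ᵥ x) i‖ ^ 2 :=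
  mul_le_transpose_mulVec hA (fun x => (mul_le_mul_of_nonneg_right (muMin_le A z)
    (by positivity)).trans (lamMin_gram_mul_le _ x)) x

lemma transpose_le_muMax_mul (hN : 0 < N) (z : Circle) (x : Fin N → ℂ) :
    ∑ i, ‖((matPoly A z)ᵀ *ᵥ x) i‖ ^ 2 ≤ muMax A * ∑ i, ‖x i‖ ^ 2 :=
  transpose_mulVec_le_mul (fun x => (le_lamMax_gram_mul _ x).trans
    (mul_le_mul_of_nonneg_right (le_muMax A hN z) (by positivity))) x

lemma det_matPoly_ne_zero (hA : 0 < muMin A) (z : Circle) : (matPoly A z).det ≠ 0 := by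
  intro h
  obtain ⟨v, hv, hv0⟩ := Matrix.exists_mulVec_eq_zero_iff.2 h
  have h1 := (mul_le_mul_of_nonneg_right (muMin_le A z)
    (by positivity : 0 ≤ ∑ i, ‖v i‖ ^ 2)).trans (lamMin_gram_mul_le _ v)
  rw [hv0] at h1
  apply hv
  have h2 : ∑ i, ‖v i‖ ^ 2 = 0 := by
    refine le_antisymm ?_ (by positivity)
    by_contra! h3
    have := mul_pos hA h3
    simp at h1
    linarith
  rw [Finset.sum_eq_zero_iff_of_nonneg (fun _ _ => by positivity)] at h2
  ext i
  simpa using h2 i (Finset.mem_univ i)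

end symbol


/-! ### Convolution with the coefficient matrices -/

section convolution

variable {N P : ℕ} (A : Tensor N N P)

/-- The sequence `u_k - ∑_j A_jᵀ u_{k-j}`, where `u` vanishes at negative times. -/
def adjointFilter (u : ℕ → Fin N → ℝ) (k : ℕ) : Fin N → ℝ :=
  u k - ∑ j : Fin P, if j.val + 1 ≤ k then (slice A j)ᵀ *ᵥ u (k - 1 - j.val) else 0

/-- The residual `y_n - ∑_j A_j y_{n-j}`. -/
def residual (y : ℤ → Fin N → ℝ) (n : ℤ) : Fin N → ℝ :=
  y n - ∑ j : Fin P, slice A j *ᵥ y (n - 1 - (j.val : ℤ))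

lemma sum_range_shift {M : Type*} [AddCommMonoid M] {n : ℕ} (f : ℕ → M)
    (hf : ∀ k, n ≤ k → f k = 0) {P j : ℕ} (hj : j < P) :
    ∑ k ∈ Finset.range (n + P), (if j + 1 ≤ k then f (k - 1 - j) else 0)
      = ∑ k ∈ Finset.range n, f k := by
  rw [show n + P = (j + 1) + (n + (P - (j + 1))) by omega, Finset.sum_range_add,
    Finset.sum_eq_zero, zero_add, Finset.sum_range_add]
  · rw [Finset.sum_eq_zero (s := Finset.range (P - (j + 1))), add_zero]
    · refine Finset.sum_congr rfl fun k _ => ?_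
      rw [if_pos (by omega)]; congr 1; omega
    · intro k _
      rw [if_pos (by omega)]; exact hf _ (by omega)
  · intro k hk
    rw [if_neg (by have := Finset.mem_range.1 hk; omega)]

lemma sum_range_extend {M : Type*} [AddCommMonoid M] {n : ℕ} (f : ℕ → M)
    (hf : ∀ k, n ≤ k → f k = 0) (P : ℕ) :
    ∑ k ∈ Finset.range (n + P), f k = ∑ k ∈ Finset.range n, f k := by
  rw [Finset.sum_range_add, Finset.sum_eq_zero (s := Finset.range P), add_zero]
  exact fun k _ => hf _ (by omega)

/-- Summation by parts: the adjoint filter applied to `u`, tested against `y`, equals `u` tested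
against the residuals of `y`. -/
lemma sum_dotProduct_residual (u : ℕ → Fin N → ℝ) {J : ℕ} (hu : ∀ k, J ≤ k → u k = 0)
    (y : ℤ → Fin N → ℝ) (t : ℤ) :
    ∑ k ∈ Finset.range J, u k ⬝ᵥ residual A y (t - k)
      = ∑ k ∈ Finset.range (J + P), adjointFilter A u k ⬝ᵥ y (t - k) := by
  simp only [residual, adjointFilter, dotProduct_sub, sub_dotProduct, Finset.sum_sub_distrib,
    dotProduct_sum, sum_dotProduct]
  congr 1
  · rw [sum_range_extend]; intro k hk; simp [hu k hk]
  · rw [Finset.sum_comm, Finset.sum_comm (s := Finset.range (J + P))]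
    refine Finset.sum_congr rfl fun j _ => ?_
    rw [← sum_range_shift (P := P) (j := j) _ (fun k hk => by simp [hu k hk]) j.2]
    refine Finset.sum_congr rfl fun k _ => ?_
    split_ifs with h
    · rw [Matrix.mulVec_transpose, ← Matrix.dotProduct_mulVec]
      congr 3
      push_cast [Nat.cast_sub (show j.val ≤ k - 1 by omega), Nat.cast_sub (show 1 ≤ k by omega)]
      ring
    · simp

lemma sum_sq_eq_circleAverage (c : ℕ → ℝ) (m : ℕ) :
    ∑ k ∈ Finset.range m, c k ^ 2
      = Real.circleAverage (fun z => ‖∑ k ∈ Finset.range m, z ^ k * (c k : ℂ)‖ ^ 2) 0 1 := by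
  set p : Polynomial ℂ := ∑ k ∈ Finset.range m, Polynomial.monomial k (c k : ℂ) with hp
  have hcoeff : ∀ k, p.coeff k = if k < m then (c k : ℂ) else 0 := by
    intro k
    simp [hp, Polynomial.finsetSum_coeff, Polynomial.coeff_monomial]
  have h := p.sum_sq_norm_coeff_eq_circleAverage
  have hev : ∀ z, p.eval z = ∑ k ∈ Finset.range m, z ^ k * (c k : ℂ) := by
    intro z
    simp [hp, Polynomial.eval_finsetSum, Polynomial.eval_monomial, mul_comm]
  simp only [hev] at h
  rw [← h]
  rw [Finset.sum_subset (s₁ := p.support) (s₂ := Finset.range m)]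
  · refine Finset.sum_congr rfl fun k hk => ?_
    rw [hcoeff, if_pos (Finset.mem_range.1 hk)]; simp
  · intro k hk
    rw [Polynomial.mem_support_iff, hcoeff] at hk
    by_contra h
    exact hk (if_neg (by simpa using h))
  · intro k _ hk
    rw [Polynomial.notMem_support_iff.1 hk]; simp

lemma transpose_matPoly_mulVec_sum (u : ℕ → Fin N → ℝ) {n : ℕ} (hu : ∀ k, n ≤ k → u k = 0)
    (z : ℂ) (i : Fin N) :
    ((matPoly A z)ᵀ *ᵥ (fun l => ∑ k ∈ Finset.range n, z ^ k * (u k l : ℂ))) i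
      = ∑ k ∈ Finset.range (n + P), z ^ k * (adjointFilter A u k i : ℂ) := by
  have hu' : ∀ l k, n ≤ k → u k l = 0 := fun l k hk => by rw [hu k hk]; rfl
  rw [matPoly, Matrix.transpose_sub, Matrix.sub_mulVec, Matrix.transpose_one, Matrix.one_mulVec,
    Matrix.transpose_sum, Matrix.sum_mulVec]
  simp only [adjointFilter, Pi.sub_apply, Complex.ofReal_sub, mul_sub, Finset.sum_sub_distrib]
  congr 1
  · rw [sum_range_extend]; intro k hk; simp [hu' i k hk]
  · simp only [Finset.sum_apply, Complex.ofReal_sum, Finset.mul_sum]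
    rw [Finset.sum_comm]
    refine Finset.sum_congr rfl fun j _ => ?_
    have := sum_range_shift (n := n) (P := P) (j := j)
      (fun k => z ^ (k + j.val + 1) * ((((slice A j)ᵀ *ᵥ u k) i : ℝ) : ℂ))
      (fun k hk => by simp [hu k hk]) j.2
    trans ∑ k ∈ Finset.range n, z ^ (k + j.val + 1) * ((((slice A j)ᵀ *ᵥ u k) i : ℝ) : ℂ)
    · simp only [Matrix.mulVec, dotProduct, Matrix.transpose_apply, Matrix.smul_apply,
        Matrix.map_apply, smul_eq_mul, Complex.ofReal_sum, Complex.ofReal_mul, Finset.mul_sum]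
      rw [Finset.sum_comm]
      refine Finset.sum_congr rfl fun k _ => Finset.sum_congr rfl fun l _ => ?_
      ring
    · rw [← this]
      refine Finset.sum_congr rfl fun k _ => ?_
      split_ifs with h
      · congr 2; omega
      · simp

lemma circleIntegrable_normSq_sum (c : ℕ → ℝ) (m : ℕ) :
    CircleIntegrable (fun z => ‖∑ k ∈ Finset.range m, z ^ k * (c k : ℂ)‖ ^ 2) 0 1 :=
  ContinuousOn.circleIntegrable' (by fun_prop)

lemma sum_dotProduct_self_eq_circleAverage (u : ℕ → Fin N → ℝ) (m : ℕ) :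
    ∑ k ∈ Finset.range m, u k ⬝ᵥ u k = Real.circleAverage
      (fun z => ∑ i, ‖∑ k ∈ Finset.range m, z ^ k * (u k i : ℂ)‖ ^ 2) 0 1 := by
  rw [Real.circleAverage_fun_sum (fun i _ => circleIntegrable_normSq_sum _ _)]
  simp only [← sum_sq_eq_circleAverage, dotProduct, ← sq]
  rw [Finset.sum_comm]

lemma circleIntegrable_sum_normSq_sum (u : ℕ → Fin N → ℝ) (m : ℕ) : CircleIntegrable
    (fun z => ∑ i, ‖∑ k ∈ Finset.range m, z ^ k * (u k i : ℂ)‖ ^ 2) 0 1 :=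
  ContinuousOn.circleIntegrable' (by fun_prop)

lemma muMin_mul_sum_le (hA : 0 < muMin A) (u : ℕ → Fin N → ℝ) {n : ℕ}
    (hu : ∀ k, n ≤ k → u k = 0) :
    muMin A * ∑ k ∈ Finset.range n, u k ⬝ᵥ u k
      ≤ ∑ k ∈ Finset.range (n + P), adjointFilter A u k ⬝ᵥ adjointFilter A u k := by
  rw [sum_dotProduct_self_eq_circleAverage, sum_dotProduct_self_eq_circleAverage,
    ← smul_eq_mul, ← Real.circleAverage_fun_smul]
  refine Real.circleAverage_mono ?_ (circleIntegrable_sum_normSq_sum _ _) fun z hz => ?_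
  · exact ContinuousOn.circleIntegrable' (by fun_prop)
  · have hz1 : ‖z‖ = 1 := by simpa using hz
    have := muMin_mul_le_transpose A hA ⟨z, mem_sphere_zero_iff_norm.2 hz1⟩
      (fun l => ∑ k ∈ Finset.range n, z ^ k * (u k l : ℂ))
    simpa only [transpose_matPoly_mulVec_sum A u hu, smul_eq_mul] using this

lemma sum_le_muMax_mul (hN : 0 < N) (u : ℕ → Fin N → ℝ) {n : ℕ}
    (hu : ∀ k, n ≤ k → u k = 0) :
    ∑ k ∈ Finset.range (n + P), adjointFilter A u k ⬝ᵥ adjointFilter A u k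
      ≤ muMax A * ∑ k ∈ Finset.range n, u k ⬝ᵥ u k := by
  rw [sum_dotProduct_self_eq_circleAverage, sum_dotProduct_self_eq_circleAverage,
    ← smul_eq_mul, ← Real.circleAverage_fun_smul]
  refine Real.circleAverage_mono (circleIntegrable_sum_normSq_sum _ _) ?_ fun z hz => ?_
  · exact ContinuousOn.circleIntegrable' (by fun_prop)
  · have hz1 : ‖z‖ = 1 := by simpa using hz
    have := transpose_le_muMax_mul A hN ⟨z, mem_sphere_zero_iff_norm.2 hz1⟩
      (fun l => ∑ k ∈ Finset.range n, z ^ k * (u k l : ℂ))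
    simpa only [transpose_matPoly_mulVec_sum A u hu, smul_eq_mul] using this

end convolution

/-! ### Stable linear recursions -/

section recursion

lemma tendsto_pow_of_spectralRadius_lt_one {R : Type*} [NormedRing R] [NormedAlgebra ℂ R]
    [CompleteSpace R] (a : R) (h : spectralRadius ℂ a < 1) :
    Tendsto (fun n => a ^ n) atTop (𝓝 0) := by
  obtain ⟨r, hr, hr1⟩ := exists_between h
  have h1 := (spectrum.pow_nnnorm_pow_one_div_tendsto_nhds_spectralRadius a).eventually_lt_const hr
  rw [tendsto_zero_iff_norm_tendsto_zero]
  lift r to ℝ≥0 using (hr1.trans ENNReal.one_lt_top).ne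
  have hr1' : (r : ℝ) < 1 := by exact_mod_cast hr1
  refine squeeze_zero' (Eventually.of_forall fun n => norm_nonneg _) ?_
    (tendsto_pow_atTop_nhds_zero_of_lt_one r.2 hr1')
  filter_upwards [h1, eventually_gt_atTop 0] with n hn hn0
  have hn' : (n : ℝ) ≠ 0 := by positivity
  have h2 : (‖a ^ n‖₊ : ENNReal) ≤ (r : ENNReal) ^ n := by
    have := ENNReal.rpow_le_rpow hn.le (Nat.cast_nonneg n)
    rw [← ENNReal.rpow_mul, one_div, inv_mul_cancel₀ hn', ENNReal.rpow_one,
      ENNReal.rpow_natCast] at this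
    exact this
  have h3 : ‖a ^ n‖₊ ≤ r ^ n := by exact_mod_cast h2
  exact_mod_cast h3

variable {N P : ℕ}

/-- The companion operator of the recursion `u_k = ∑_j B_j u_{k-j}`. -/
def companion (B : Fin P → Matrix (Fin N) (Fin N) ℂ) :
    (Fin P → Fin N → ℂ) →ₗ[ℂ] (Fin P → Fin N → ℂ) where
  toFun s j := if j.val = 0 then ∑ i, B i *ᵥ s i else s ⟨j.val - 1, by omega⟩
  map_add' s t := by
    ext j x; by_cases h : j.val = 0 <;> simp [h, Matrix.mulVec_add, Finset.sum_add_distrib]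
  map_smul' c s := by
    ext j x; by_cases h : j.val = 0 <;> simp [h, Matrix.mulVec_smul, Finset.mul_sum]

lemma eq_zero_of_companion_eigen (hP : 0 < P) (B : Fin P → Matrix (Fin N) (Fin N) ℂ)
    (hB : ∀ z : ℂ, ‖z‖ ≤ 1 → (1 - ∑ k : Fin P, z ^ (k.val + 1) • B k).det ≠ 0)
    {l : ℂ} (hl : 1 ≤ ‖l‖) {v : Fin P → Fin N → ℂ} (hv : companion B v = l • v) : v = 0 := by
  have hl0 : l ≠ 0 := by rintro rfl; simp at hl; linarith
  have hj : ∀ j : Fin P, v j = (l⁻¹) ^ j.val • v ⟨0, hP⟩ := by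
    rintro ⟨j, hj⟩
    induction j with
    | zero => simp
    | succ j ih =>
      have h := congrFun hv ⟨j + 1, hj⟩
      simp only [companion, LinearMap.coe_mk, AddHom.coe_mk, Pi.smul_apply, Nat.add_eq_zero_iff,
        one_ne_zero, and_false, if_false, Nat.add_sub_cancel] at h
      rw [ih (by omega)] at h
      rw [pow_succ', mul_smul, h, smul_smul, inv_mul_cancel₀ hl0, one_smul]
  have h0 := congrFun hv ⟨0, hP⟩
  simp only [companion, LinearMap.coe_mk, AddHom.coe_mk, Pi.smul_apply, if_true] at h0
  have h1 : (1 - ∑ k : Fin P, (l⁻¹) ^ (k.val + 1) • B k) *ᵥ v ⟨0, hP⟩ = 0 := by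
    rw [Matrix.sub_mulVec, Matrix.one_mulVec, Matrix.sum_mulVec, sub_eq_zero]
    have : v ⟨0, hP⟩ = l⁻¹ • ∑ i, B i *ᵥ v i := by
      rw [h0, smul_smul, inv_mul_cancel₀ hl0, one_smul]
    conv_lhs => rw [this, Finset.smul_sum]
    refine Finset.sum_congr rfl fun k _ => ?_
    rw [hj k, Matrix.mulVec_smul, smul_smul, Matrix.smul_mulVec, pow_succ']
  have h2 : v ⟨0, hP⟩ = 0 := by
    by_contra h
    exact hB l⁻¹ (by rw [norm_inv]; exact inv_le_one_of_one_le₀ hl)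
      (Matrix.exists_mulVec_eq_zero_iff.1 ⟨_, h, h1⟩)
  ext1 j
  rw [hj j, h2, smul_zero, Pi.zero_apply]

/-- Solutions of a stable homogeneous linear recursion tend to zero. -/
lemma tendsto_zero_of_recursion (hP : 0 < P) (hN : 0 < N)
    (B : Fin P → Matrix (Fin N) (Fin N) ℝ)
    (hB : ∀ z : ℂ, ‖z‖ ≤ 1 →
      (1 - ∑ k : Fin P, z ^ (k.val + 1) • (B k).map (fun x : ℝ => (x : ℂ))).det ≠ 0)
    (u : ℕ → Fin N → ℝ) (k₀ : ℕ)
    (hu : ∀ k, k₀ ≤ k → u (k + P) = ∑ j : Fin P, B j *ᵥ u (k + P - 1 - j.val)) :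
    Tendsto u atTop (𝓝 0) := by
  set Bc : Fin P → Matrix (Fin N) (Fin N) ℂ := fun k => (B k).map (fun x : ℝ => (x : ℂ)) with hBc
  have : Nonempty (Fin P) := ⟨⟨0, hP⟩⟩
  have : Nonempty (Fin N) := ⟨⟨0, hN⟩⟩
  have : Nontrivial (Fin P → Fin N → ℂ) := inferInstance
  set C : (Fin P → Fin N → ℂ) →L[ℂ] (Fin P → Fin N → ℂ) :=
    Module.End.toContinuousLinearMap _ (companion Bc) with hC
  have hCapp : ∀ s, C s = companion Bc s := fun s => rfl
  have hrad : spectralRadius ℂ C < 1 := by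
    refine spectrum.spectralRadius_lt_of_forall_lt C (r := 1) fun l hl => ?_
    rw [hC, AlgEquiv.spectrum_eq, ← Module.End.hasEigenvalue_iff_mem_spectrum] at hl
    obtain ⟨v, hv⟩ := hl.exists_hasEigenvector
    by_contra! hl1
    exact hv.2 (eq_zero_of_companion_eigen hP Bc hB (by exact_mod_cast hl1)
      hv.apply_eq_smul)
  set s : ℕ → Fin P → Fin N → ℂ := fun k j i => (u (k + P - 1 - j.val) i : ℂ) with hs
  have hstep : ∀ k, k₀ ≤ k → s (k + 1) = C (s k) := by
    intro k hk
    ext j i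
    rw [hCapp]
    simp only [companion, LinearMap.coe_mk, AddHom.coe_mk, hs]
    split_ifs with h
    · rw [h, show k + 1 + P - 1 - 0 = k + P by omega, hu k hk]
      simp [hBc, Matrix.mulVec, dotProduct]
    · rw [show k + 1 + P - 1 - j.val = k + P - 1 - (j.val - 1) by omega]
  have hiter : ∀ m, s (k₀ + m) = (C ^ m) (s k₀) := by
    intro m
    induction m with
    | zero => simp
    | succ m ih => rw [← add_assoc, hstep _ (by omega), ih, pow_succ']; rfl
  have hlim : Tendsto (fun m => s (k₀ + m)) atTop (𝓝 0) := by
    have h1 := (tendsto_pow_of_spectralRadius_lt_one C hrad)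
    have h2 := ((ContinuousLinearMap.apply ℂ _ (s k₀)).continuous.tendsto 0).comp h1
    simp only [map_zero] at h2
    refine h2.congr fun m => ?_
    rw [hiter]; rfl
  have hlim2 : Tendsto s atTop (𝓝 0) := by
    rw [← tendsto_add_atTop_iff_nat k₀]
    simpa only [add_comm] using hlim
  rw [← tendsto_add_atTop_iff_nat (P - 1)]
  rw [tendsto_pi_nhds] at hlim2 ⊢
  intro i
  have h3 := (tendsto_pi_nhds.1 (hlim2 ⟨0, hP⟩)) i
  have h4 := (Complex.continuous_re.tendsto 0).comp h3
  simp only [Complex.zero_re] at h4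
  refine h4.congr fun k => ?_
  simp only [hs, Function.comp, Complex.ofReal_re]
  congr 1
  rw [show k + P - 1 - 0 = k + (P - 1) by omega]

end recursion

/-! ### The dual recursion -/

section dual

variable {N P : ℕ} (A : Tensor N N P)

/-- The solution `U` of `U_k - ∑_j A_jᵀ U_{k-j} = W_k`. -/
def dualSol (W : ℕ → Fin N → ℝ) (k : ℕ) : Fin N → ℝ :=
  W k + ∑ j : Fin P, if _h : j.val + 1 ≤ k then (slice A j)ᵀ *ᵥ dualSol W (k - 1 - j.val) else 0
termination_by k
decreasing_by omega

lemma adjointFilter_dualSol (W : ℕ → Fin N → ℝ) (k : ℕ) :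
    adjointFilter A (dualSol A W) k = W k := by
  rw [adjointFilter, dualSol]
  simp

/-- Truncation of a sequence to indices below `J`. -/
def trunc (J : ℕ) (u : ℕ → Fin N → ℝ) (k : ℕ) : Fin N → ℝ := if k < J then u k else 0

lemma trunc_of_lt {J k : ℕ} (u : ℕ → Fin N → ℝ) (h : k < J) : trunc J u k = u k := if_pos h

lemma trunc_of_le {J k : ℕ} (u : ℕ → Fin N → ℝ) (h : J ≤ k) : trunc J u k = 0 :=
  if_neg (by omega)

lemma adjointFilter_trunc_dualSol (W : ℕ → Fin N → ℝ) {J k : ℕ} (h : k < J) :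
    adjointFilter A (trunc J (dualSol A W)) k = W k := by
  rw [← adjointFilter_dualSol A W, adjointFilter, adjointFilter, trunc_of_lt _ h]
  congr 1
  refine Finset.sum_congr rfl fun j _ => ?_
  split_ifs with h'
  · rw [trunc_of_lt _ (by omega)]
  · rfl

lemma tendsto_dualSol (hP : 0 < P) (hN : 0 < N)
    (hst : ∀ z : ℂ, ‖z‖ < 1 → (matPoly A z).det ≠ 0) (hA : 0 < muMin A)
    (W : ℕ → Fin N → ℝ) {k₀ : ℕ} (hW : ∀ k, k₀ ≤ k → W k = 0) :
    Tendsto (dualSol A W) atTop (𝓝 0) := by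
  refine tendsto_zero_of_recursion hP hN (fun k => (slice A k)ᵀ) ?_ _ k₀ ?_
  · intro z hz
    have h1 : (1 - ∑ k : Fin P, z ^ (k.val + 1) • ((slice A k)ᵀ).map (fun x : ℝ => (x : ℂ)))
        = (matPoly A z)ᵀ := by
      simp [matPoly, Matrix.transpose_sum, Matrix.transpose_map]
    rw [h1, Matrix.det_transpose]
    rcases hz.lt_or_eq with h | h
    · exact hst z h
    · exact det_matPoly_ne_zero A hA ⟨z, mem_sphere_zero_iff_norm.2 h⟩
  · intro k hk
    rw [dualSol, hW _ (by omega), zero_add]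
    refine Finset.sum_congr rfl fun j _ => ?_
    rw [dif_pos (by omega)]

lemma tendsto_adjointFilter_trunc (hP : 0 < P) (hN : 0 < N)
    (hst : ∀ z : ℂ, ‖z‖ < 1 → (matPoly A z).det ≠ 0) (hA : 0 < muMin A)
    (W : ℕ → Fin N → ℝ) {k₀ : ℕ} (hW : ∀ k, k₀ ≤ k → W k = 0) (i : ℕ) :
    Tendsto (fun J => adjointFilter A (trunc J (dualSol A W)) (J + i)) atTop (𝓝 0) := by
  have hU := tendsto_dualSol A hP hN hst hA W hW
  simp only [adjointFilter, trunc_of_le _ (Nat.le_add_right _ i), zero_sub]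
  rw [← neg_zero]
  refine Tendsto.neg ?_
  rw [← Finset.sum_const_zero (s := (Finset.univ : Finset (Fin P)))]
  refine tendsto_finsetSum _ fun j _ => ?_
  have h1 : Tendsto (fun J => (slice A j)ᵀ *ᵥ dualSol A W (J + i - 1 - j.val)) atTop (𝓝 0) := by
    have hc : Continuous fun x : Fin N → ℝ => (slice A j)ᵀ *ᵥ x := by fun_prop
    have := (hc.tendsto 0).comp (hU.comp (tendsto_atTop_mono (fun J => (by omega :
      J - (j.val + 1) ≤ J + i - 1 - j.val)) (tendsto_sub_atTop_nat (j.val + 1))))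
    simp only [Matrix.mulVec_zero] at this
    exact this
  rw [tendsto_pi_nhds] at h1 ⊢
  intro l
  refine squeeze_zero_norm (fun J => ?_) (tendsto_zero_iff_norm_tendsto_zero.1 (h1 l))
  split_ifs with h
  · rw [trunc]; split_ifs <;> simp
  · simp

lemma sum_dotProduct_residual_dualSol (W : ℕ → Fin N → ℝ) (J : ℕ)
    (y : ℤ → Fin N → ℝ) (t : ℤ) :
    ∑ k ∈ Finset.range J, dualSol A W k ⬝ᵥ residual A y (t - k)
      = ∑ k ∈ Finset.range J, W k ⬝ᵥ y (t - k) + ∑ i ∈ Finset.range P,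
        adjointFilter A (trunc J (dualSol A W)) (J + i) ⬝ᵥ y (t - (J + i : ℕ)) := by
  have h := sum_dotProduct_residual A (trunc J (dualSol A W)) (fun k hk => trunc_of_le _ hk) y t
  rw [Finset.sum_range_add] at h
  rw [Finset.sum_congr rfl fun k hk => by rw [trunc_of_lt _ (Finset.mem_range.1 hk)]] at h
  rw [h]
  congr 1
  refine Finset.sum_congr rfl fun k hk => ?_
  rw [adjointFilter_trunc_dualSol A W (Finset.mem_range.1 hk)]

lemma muMin_mul_sum_dualSol_le (hA : 0 < muMin A) (W : ℕ → Fin N → ℝ) (J : ℕ) :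
    muMin A * ∑ k ∈ Finset.range J, dualSol A W k ⬝ᵥ dualSol A W k
      ≤ ∑ k ∈ Finset.range J, W k ⬝ᵥ W k + ∑ i ∈ Finset.range P,
        adjointFilter A (trunc J (dualSol A W)) (J + i)
          ⬝ᵥ adjointFilter A (trunc J (dualSol A W)) (J + i) := by
  have h := muMin_mul_sum_le A hA (trunc J (dualSol A W)) (fun k hk => trunc_of_le _ hk)
  rw [Finset.sum_range_add] at h
  rw [Finset.sum_congr (s₂ := Finset.range J) rfl
    fun k hk => by rw [trunc_of_lt _ (Finset.mem_range.1 hk)]] at h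
  refine h.trans_eq ?_
  congr 1
  refine Finset.sum_congr rfl fun k hk => ?_
  rw [adjointFilter_trunc_dualSol A W (Finset.mem_range.1 hk)]

lemma tendsto_boundary_sq (hP : 0 < P) (hN : 0 < N)
    (hst : ∀ z : ℂ, ‖z‖ < 1 → (matPoly A z).det ≠ 0) (hA : 0 < muMin A)
    (W : ℕ → Fin N → ℝ) {k₀ : ℕ} (hW : ∀ k, k₀ ≤ k → W k = 0) :
    Tendsto (fun J => ∑ i ∈ Finset.range P, adjointFilter A (trunc J (dualSol A W)) (J + i)
          ⬝ᵥ adjointFilter A (trunc J (dualSol A W)) (J + i)) atTop (𝓝 0) := by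
  rw [← Finset.sum_const_zero (s := Finset.range P)]
  refine tendsto_finsetSum _ fun i _ => ?_
  have h := tendsto_adjointFilter_trunc A hP hN hst hA W hW i
  have hc : Continuous fun x : Fin N → ℝ => x ⬝ᵥ x := by fun_prop
  have h2 := (hc.tendsto 0).comp h
  simp only [dotProduct_zero] at h2
  exact h2

lemma dotProduct_self_nonneg' {ι : Type*} [Fintype ι] (x : ι → ℝ) : 0 ≤ x ⬝ᵥ x :=
  Finset.sum_nonneg fun _ _ => mul_self_nonneg _

lemma muMin_le_one (hP : 0 < P) (hN : 0 < N)
    (hst : ∀ z : ℂ, ‖z‖ < 1 → (matPoly A z).det ≠ 0) (hA : 0 < muMin A) : muMin A ≤ 1 := by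
  set W : ℕ → Fin N → ℝ := fun k => if k = 0 then Pi.single ⟨0, hN⟩ 1 else 0 with hWd
  have hW : ∀ k, 1 ≤ k → W k = 0 := fun k hk => if_neg (by omega)
  have hlim := (tendsto_boundary_sq A hP hN hst hA W hW).const_add 1
  rw [add_zero] at hlim
  refine ge_of_tendsto hlim ?_
  filter_upwards [eventually_ge_atTop 1] with J hJ
  have hW1 : W 0 ⬝ᵥ W 0 = 1 := by simp [hWd]
  have h1 : ∑ k ∈ Finset.range J, W k ⬝ᵥ W k = 1 := by
    rw [Finset.sum_eq_single 0, hW1]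
    · intro k _ hk; simp [hW k (by omega)]
    · intro h; simp at h; omega
  have h2 := muMin_mul_sum_dualSol_le A hA W J
  rw [h1] at h2
  refine le_trans ?_ h2
  have h0 : dualSol A W 0 = W 0 := by rw [dualSol]; simp
  have h3 : 1 ≤ ∑ k ∈ Finset.range J, dualSol A W k ⬝ᵥ dualSol A W k := by
    rw [← hW1, ← h0]
    exact Finset.single_le_sum (f := fun k => dualSol A W k ⬝ᵥ dualSol A W k)
      (fun k _ => dotProduct_self_nonneg' _) (Finset.mem_range.2 hJ)
  nlinarith

lemma one_add_sum_le_muMax (hN : 0 < N) (e : Fin N → ℝ) :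
    e ⬝ᵥ e + ∑ k, ((slice A k)ᵀ *ᵥ e) ⬝ᵥ ((slice A k)ᵀ *ᵥ e) ≤ muMax A * (e ⬝ᵥ e) := by
  set u : ℕ → Fin N → ℝ := fun k => if k = 0 then e else 0 with hu
  have h := sum_le_muMax_mul A hN u (n := 1) (fun k hk => if_neg (by omega))
  rw [add_comm 1 P, Finset.sum_range_succ'] at h
  have h0 : adjointFilter A u 0 = e := by simp [adjointFilter, hu]
  have hk : ∀ k : Fin P, adjointFilter A u (k.val + 1) = -((slice A k)ᵀ *ᵥ e) := by
    intro k
    rw [adjointFilter, Finset.sum_eq_single k]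
    · simp [hu]
    · intro j _ hj
      split_ifs with hjk
      · have : k.val + 1 - 1 - j.val ≠ 0 := by
          have := Fin.val_ne_of_ne hj; omega
        rw [hu]; simp only [this, if_false, Matrix.mulVec_zero]
      · rfl
    · simp
  rw [Finset.sum_range (n := P)] at h
  simp only [h0, hk, neg_dotProduct, dotProduct_neg, neg_neg] at h
  simp only [Finset.range_one, Finset.sum_singleton, hu, if_true] at h
  linarith

lemma one_le_muMax (hN : 0 < N) : 1 ≤ muMax A := by
  have h := one_add_sum_le_muMax A hN (Pi.single ⟨0, hN⟩ 1)
  have h2 : 0 ≤ ∑ k, ((slice A k)ᵀ *ᵥ (Pi.single ⟨0, hN⟩ 1 : Fin N → ℝ)) ⬝ᵥ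
    ((slice A k)ᵀ *ᵥ (Pi.single ⟨0, hN⟩ 1 : Fin N → ℝ)) :=
    Finset.sum_nonneg fun _ _ => dotProduct_self_nonneg' _
  simp only [dotProduct_single, Pi.single_eq_same, mul_one] at h
  linarith

lemma dotProduct_sq_le {ι : Type*} [Fintype ι] (x y : ι → ℝ) :
    (x ⬝ᵥ y) ^ 2 ≤ (x ⬝ᵥ x) * (y ⬝ᵥ y) := by
  have := Finset.sum_mul_sq_le_sq_mul_sq Finset.univ x y
  simpa only [dotProduct, sq (x _), sq (y _)] using this

lemma unfold₁_mulVec_le_muMax (hN : 0 < N) (x : Fin P × Fin N → ℝ) :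
    (unfold₁ A *ᵥ x) ⬝ᵥ (unfold₁ A *ᵥ x) ≤ muMax A * (x ⬝ᵥ x) := by
  set e := unfold₁ A *ᵥ x with he
  have h1 : e ⬝ᵥ e = (e ᵥ* unfold₁ A) ⬝ᵥ x := by rw [← Matrix.dotProduct_mulVec]
  have h2 : (e ᵥ* unfold₁ A) ⬝ᵥ (e ᵥ* unfold₁ A) ≤ muMax A * (e ⬝ᵥ e) := by
    have h := one_add_sum_le_muMax A hN e
    have h3 : (e ᵥ* unfold₁ A) ⬝ᵥ (e ᵥ* unfold₁ A)
        = ∑ k, ((slice A k)ᵀ *ᵥ e) ⬝ᵥ ((slice A k)ᵀ *ᵥ e) := by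
      rw [dotProduct, Fintype.sum_prod_type]
      simp only [Matrix.mulVec_transpose]
      rfl
    have := dotProduct_self_nonneg' e
    linarith
  have h3 := dotProduct_sq_le (e ᵥ* unfold₁ A) x
  rw [← h1] at h3
  have hx := dotProduct_self_nonneg' x
  rcases (dotProduct_self_nonneg' e).eq_or_lt with h | h
  · rw [← h]; exact mul_nonneg (zero_le_one.trans (one_le_muMax A hN)) hx
  · have : (e ⬝ᵥ e) ^ 2 ≤ muMax A * (e ⬝ᵥ e) * (x ⬝ᵥ x) :=
      h3.trans (mul_le_mul_of_nonneg_right h2 hx)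
    nlinarith

end dual


/-! ### Nets of unit balls -/

section nets

variable {E : Type*} [NormedAddCommGroup E] [NormedSpace ℝ E] [FiniteDimensional ℝ E]

variable (E) in
/-- The unit ball of a `D`-dimensional normed space has a `1/2`-net of at most `5 ^ D` points. -/
lemma exists_half_net : ∃ S : Finset E, S.card ≤ 5 ^ Module.finrank ℝ E ∧ (∀ s ∈ S, ‖s‖ ≤ 1) ∧
    ∀ x : E, ‖x‖ ≤ 1 → ∃ s ∈ S, ‖x - s‖ ≤ 1 / 2 := by
  classical
  let p : ℕ → Prop := fun n => ∃ S : Finset E, S.card = n ∧ (∀ s ∈ S, ‖s‖ ≤ 1) ∧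
    ∀ s ∈ S, ∀ t ∈ S, s ≠ t → 1 / 2 ≤ ‖s - t‖
  have hcard : ∀ S : Finset E, (∀ s ∈ S, ‖s‖ ≤ 1) →
      (∀ s ∈ S, ∀ t ∈ S, s ≠ t → 1 / 2 ≤ ‖s - t‖) → S.card ≤ 5 ^ Module.finrank ℝ E := by
    intro S h1 h2
    have hinj : Function.Injective fun x : E => (2 : ℝ) • x :=
      smul_right_injective E (two_ne_zero)
    rw [← Finset.card_image_of_injective S hinj]
    refine Besicovitch.card_le_of_separated _ ?_ ?_
    · simp only [Finset.mem_image, forall_exists_index, and_imp]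
      rintro _ s hs rfl
      rw [norm_smul]; have := h1 s hs; norm_num; linarith
    · simp only [Finset.mem_image, forall_exists_index, and_imp]
      rintro _ s hs rfl _ t ht rfl hst
      have := h2 s hs t ht (by rintro rfl; exact hst rfl)
      rw [← smul_sub, norm_smul]; norm_num; linarith
  have hb : BddAbove {n | p n} := ⟨5 ^ Module.finrank ℝ E, by
    rintro _ ⟨S, rfl, h1, h2⟩; exact hcard S h1 h2⟩
  obtain ⟨S, hS, h1, h2⟩ := Nat.sSup_mem (s := {n | p n}) ⟨0, ∅, by simp⟩ hb
  refine ⟨S, hcard S h1 h2, h1, fun x hx => ?_⟩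
  by_contra! hcon
  have hxS : x ∉ S := fun h => by have := hcon x h; simp at this; linarith
  have : p (S.card + 1) := by
    refine ⟨insert x S, Finset.card_insert_of_notMem hxS, ?_, ?_⟩
    · intro s hs
      rcases Finset.mem_insert.1 hs with rfl | hs
      exacts [hx, h1 s hs]
    · intro s hs t ht hst
      rcases Finset.mem_insert.1 hs with rfl | hs' <;>
        rcases Finset.mem_insert.1 ht with rfl | ht'
      · exact absurd rfl hst
      · exact (hcon t ht').le
      · rw [norm_sub_rev]; exact (hcon s hs').le
      · exact h2 s hs' t ht' hst
  have := le_csSup hb this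
  omega

variable (E) in
/-- The unit ball of a `D`-dimensional normed space has a `2⁻ᵏ`-net of at most `5 ^ (D k)`
points. -/
lemma exists_pow_net (k : ℕ) : ∃ S : Finset E, S.card ≤ 5 ^ (Module.finrank ℝ E * k) ∧
    ∀ x : E, ‖x‖ ≤ 1 → ∃ s ∈ S, ‖x - s‖ ≤ (1 / 2) ^ k := by
  classical
  induction k with
  | zero => exact ⟨{0}, by simp, fun x hx => ⟨0, by simp, by simpa using hx⟩⟩
  | succ k ih =>
    obtain ⟨S, hS, h⟩ := ih
    obtain ⟨R, hR, -, h'⟩ := exists_half_net E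
    refine ⟨Finset.image₂ (fun s t => s + ((1 / 2 : ℝ) ^ k) • t) S R, ?_, fun x hx => ?_⟩
    · refine (Finset.card_image₂_le _ _ _).trans ?_
      rw [Nat.mul_succ, pow_add]
      exact Nat.mul_le_mul hS hR
    · obtain ⟨s, hs, hxs⟩ := h x hx
      obtain ⟨t, ht, hst⟩ := h' ((2 : ℝ) ^ k • (x - s)) (by
        rw [norm_smul, norm_pow, Real.norm_ofNat]
        calc (2 : ℝ) ^ k * ‖x - s‖ ≤ 2 ^ k * (1 / 2) ^ k := by gcongr
          _ = 1 := by rw [← mul_pow]; norm_num)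
      refine ⟨_, Finset.mem_image₂_of_mem hs ht, ?_⟩
      have : x - (s + ((1 / 2 : ℝ) ^ k) • t)
          = ((1 / 2 : ℝ) ^ k) • ((2 : ℝ) ^ k • (x - s) - t) := by
        rw [smul_sub, smul_smul, ← mul_pow]; norm_num; abel
      rw [this, norm_smul, pow_succ, norm_pow, Real.norm_of_nonneg (by norm_num : (0 : ℝ) ≤ 1 / 2)]
      gcongr

/-- A linear functional bounded by `M` on a `1/2`-net is bounded by `2 M` on the unit ball. -/
lemma le_two_mul_of_net (l : E →ₗ[ℝ] ℝ) {S : Finset E}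
    (hS : ∀ x : E, ‖x‖ ≤ 1 → ∃ s ∈ S, ‖x - s‖ ≤ 1 / 2) {M : ℝ} (hM : ∀ s ∈ S, l s ≤ M)
    {x : E} (hx : ‖x‖ ≤ 1) : l x ≤ 2 * M := by
  have : ProperSpace E := FiniteDimensional.proper_real E
  obtain ⟨x₀, hx₀, hmax⟩ := (isCompact_closedBall (0 : E) 1).exists_isMaxOn
    ⟨0, by simp⟩ (LinearMap.continuous_of_finiteDimensional l).continuousOn
  simp only [mem_closedBall_zero_iff] at hx₀
  obtain ⟨s, hs, hxs⟩ := hS x₀ hx₀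
  have h1 : l ((2 : ℝ) • (x₀ - s)) ≤ l x₀ := hmax (by
    rw [mem_closedBall_zero_iff, norm_smul]; norm_num; linarith)
  have h2 : l x ≤ l x₀ := hmax (by rwa [mem_closedBall_zero_iff])
  rw [map_smul, map_sub, smul_eq_mul] at h1
  have := hM s hs
  linarith

end nets

/-! ### Contractions and orthogonal projections -/

section contraction

variable {m n : Type*} [Fintype m] [Fintype n]

/-- The matrix is a contraction for the Euclidean norms. -/
def IsContraction (V : Matrix m n ℝ) : Prop := ∀ x, (V *ᵥ x) ⬝ᵥ (V *ᵥ x) ≤ x ⬝ᵥ x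

lemma IsContraction.transpose {V : Matrix m n ℝ} (h : IsContraction V) : IsContraction Vᵀ := by
  intro x
  have h1 : (Vᵀ *ᵥ x) ⬝ᵥ (Vᵀ *ᵥ x) = x ⬝ᵥ (V *ᵥ (Vᵀ *ᵥ x)) := by
    rw [Matrix.dotProduct_mulVec x, ← Matrix.mulVec_transpose]
  have h2 := dotProduct_sq_le x (V *ᵥ (Vᵀ *ᵥ x))
  rw [← h1] at h2
  have h3 := h (Vᵀ *ᵥ x)
  have hx := dotProduct_self_nonneg' x
  rcases (dotProduct_self_nonneg' (Vᵀ *ᵥ x)).eq_or_lt with h0 | h0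
  · rw [← h0]; exact hx
  · have : ((Vᵀ *ᵥ x) ⬝ᵥ (Vᵀ *ᵥ x)) ^ 2 ≤ (x ⬝ᵥ x) * ((Vᵀ *ᵥ x) ⬝ᵥ (Vᵀ *ᵥ x)) :=
      h2.trans (mul_le_mul_of_nonneg_left h3 hx)
    nlinarith

lemma norm_toLp_sq (x : m → ℝ) : ‖WithLp.toLp 2 x‖ ^ 2 = x ⬝ᵥ x := by
  rw [EuclideanSpace.norm_sq_eq]
  simp [dotProduct, sq]

section

open scoped Matrix.Norms.L2Operator

lemma isContraction_iff_norm_le [DecidableEq n] {V : Matrix m n ℝ} :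
    IsContraction V ↔ ‖V‖ ≤ 1 := by
  constructor
  · intro h
    rw [Matrix.l2_opNorm_def]
    refine ContinuousLinearMap.opNorm_le_bound _ zero_le_one fun x => ?_
    rw [one_mul]
    refine abs_le_of_sq_le_sq' ?_ (norm_nonneg _) |>.2
    have := h x.ofLp
    rw [← norm_toLp_sq, ← norm_toLp_sq] at this
    exact this
  · intro h x
    have h1 := Matrix.l2_opNorm_mulVec V (WithLp.toLp 2 x)
    rw [← norm_toLp_sq, ← norm_toLp_sq]
    refine pow_le_pow_left₀ (norm_nonneg _) (h1.trans ?_) 2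
    exact mul_le_of_le_one_left (norm_nonneg _) h

/-- The set of contractions has a net, with `5 ^ (m n)` elements, on which it suffices to bound
linear functionals. -/
lemma exists_contraction_net (m n : ℕ) : ∃ S : Finset (Matrix (Fin m) (Fin n) ℝ),
    S.card ≤ 5 ^ (m * n) ∧ (∀ V ∈ S, IsContraction V) ∧
    ∀ (l : Matrix (Fin m) (Fin n) ℝ →ₗ[ℝ] ℝ) (M : ℝ), (∀ V ∈ S, l V ≤ M) →
      ∀ V, IsContraction V → l V ≤ 2 * M := by
  obtain ⟨S, h1, h2, h3⟩ := exists_half_net (Matrix (Fin m) (Fin n) ℝ)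
  refine ⟨S, ?_, fun V hV => isContraction_iff_norm_le.2 (h2 V hV), fun l M hM V hV => ?_⟩
  · simpa [Module.finrank_matrix] using h1
  · exact le_two_mul_of_net l h3 hM (isContraction_iff_norm_le.1 hV)

end

lemma exists_dotProduct_net (ι : Type*) [Fintype ι] : ∃ S : Finset (ι → ℝ),
    S.card ≤ 5 ^ Fintype.card ι ∧ (∀ v ∈ S, v ⬝ᵥ v ≤ 1) ∧
    ∀ (l : (ι → ℝ) →ₗ[ℝ] ℝ) (M : ℝ), (∀ v ∈ S, l v ≤ M) → ∀ v, v ⬝ᵥ v ≤ 1 → l v ≤ 2 * M := by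
  classical
  obtain ⟨S, h1, h2, h3⟩ := exists_half_net (EuclideanSpace ℝ ι)
  have hn : ∀ x : ι → ℝ, ‖WithLp.toLp 2 x‖ ≤ 1 ↔ x ⬝ᵥ x ≤ 1 := fun x => by
    rw [← norm_toLp_sq, sq_le_one_iff₀ (norm_nonneg _)]
  refine ⟨S.image WithLp.ofLp, Finset.card_image_le.trans (by simpa using h1), ?_, ?_⟩
  · simp only [Finset.mem_image, forall_exists_index, and_imp]
    rintro _ v hv rfl
    exact (hn v.ofLp).1 (h2 v hv)
  · intro l M hM v hv
    refine le_two_mul_of_net (l ∘ₗ (WithLp.linearEquiv 2 ℝ (ι → ℝ)).toLinearMap) h3 ?_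
      ((hn v).2 hv)
    intro s hs
    exact hM _ (Finset.mem_image_of_mem _ hs)

/-- A matrix of rank at most `r` is fixed by `V Vᵀ` for some contraction `V` with `r` columns. -/
lemma exists_contraction_fixing {p r : ℕ} (M : Matrix (Fin p) n ℝ) (hM : M.rank ≤ r) :
    ∃ V : Matrix (Fin p) (Fin r) ℝ, IsContraction V ∧ V * Vᵀ * M = M := by
  classical
  set L : (n → ℝ) →ₗ[ℝ] EuclideanSpace ℝ (Fin p) :=
    (WithLp.linearEquiv 2 ℝ (Fin p → ℝ)).symm.toLinearMap ∘ₗ M.mulVecLin with hL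
  set W := LinearMap.range L with hW
  have hrank : Module.finrank ℝ W ≤ r := by
    refine le_trans (le_of_eq ?_) hM
    rw [hW, hL, LinearMap.range_comp, Matrix.rank]
    exact LinearEquiv.finrank_map_eq _ _
  set b := stdOrthonormalBasis ℝ W
  set k := Module.finrank ℝ W
  set V : Matrix (Fin p) (Fin r) ℝ :=
    Matrix.of fun i a => if h : a.val < k then (b ⟨a.val, h⟩ : EuclideanSpace ℝ (Fin p)) i else 0
    with hV
  have hVt : ∀ x : Fin p → ℝ, ∀ a : Fin r, (Vᵀ *ᵥ x) a = if h : a.val < k then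
      inner ℝ (b ⟨a.val, h⟩ : EuclideanSpace ℝ (Fin p)) (WithLp.toLp 2 x) else 0 := by
    intro x a
    simp only [Matrix.mulVec, dotProduct, Matrix.transpose_apply, hV, Matrix.of_apply]
    split_ifs with h
    · simp [PiLp.inner_apply, mul_comm]
    · simp
  have hsum : ∀ g : Fin k → ℝ, ∑ a : Fin r, (if h : a.val < k then g ⟨a.val, h⟩ else 0)
      = ∑ a, g a := by
    intro g
    rw [← Finset.sum_subset (Finset.subset_univ (Finset.univ.image (Fin.castLE hrank)))]
    · rw [Finset.sum_image (fun _ _ _ _ h => Fin.castLE_injective hrank h)]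
      exact Finset.sum_congr rfl fun a _ => by simp
    · intro a _ ha
      rw [dif_neg]
      intro h
      exact ha (Finset.mem_image.2 ⟨⟨a.val, h⟩, Finset.mem_univ _, Fin.ext rfl⟩)
  have hon : Orthonormal ℝ fun a => (b a : EuclideanSpace ℝ (Fin p)) :=
    b.orthonormal.comp_linearIsometry W.subtypeₗᵢ
  have hcontr : IsContraction Vᵀ := by
    intro x
    rw [← norm_toLp_sq x]
    refine le_trans (le_of_eq ?_) (hon.sum_inner_products_le (s := Finset.univ) (WithLp.toLp 2 x))
    rw [← hsum, dotProduct]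
    refine Finset.sum_congr rfl fun a _ => ?_
    rw [hVt]
    split_ifs with h
    · rw [Real.norm_eq_abs, sq_abs, sq]
    · simp
  refine ⟨V, by simpa using hcontr.transpose, ?_⟩
  refine Matrix.ext_of_mulVec_single fun j => ?_
  set x := M *ᵥ Pi.single j 1 with hx
  have hxW : WithLp.toLp 2 x ∈ W := ⟨Pi.single j 1, rfl⟩
  rw [← Matrix.mulVec_mulVec, ← hx, ← Matrix.mulVec_mulVec]
  have h1 := b.sum_repr ⟨WithLp.toLp 2 x, hxW⟩
  have h2 := congrArg (fun w : W => (w : EuclideanSpace ℝ (Fin p))) h1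
  simp only [Submodule.coe_sum, Submodule.coe_smul] at h2
  ext i
  have h3 := congrArg (fun w : EuclideanSpace ℝ (Fin p) => w i) h2
  simp only [PiLp.smul_apply, smul_eq_mul, WithLp.ofLp_sum, Finset.sum_apply] at h3
  rw [← h3, Matrix.mulVec, dotProduct, ← hsum]
  refine Finset.sum_congr rfl fun a _ => ?_
  rw [hVt]
  simp only [hV, Matrix.of_apply]
  split_ifs with h
  · rw [b.repr_apply_apply, Submodule.coe_inner, mul_comm]
  · simp

end contraction


/-! ### Mode products and the Tucker decomposition -/

section tucker

variable {p₁ p₂ p₃ q₁ q₂ q₃ r₁ r₂ r₃ : ℕ}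

/-- The mode-1 product. -/
def mode₁ (V : Matrix (Fin q₁) (Fin p₁) ℝ) (X : Tensor p₁ p₂ p₃) : Tensor q₁ p₂ p₃ :=
  fun i j k => ∑ a, V i a * X a j k

/-- The mode-2 product. -/
def mode₂ (V : Matrix (Fin q₂) (Fin p₂) ℝ) (X : Tensor p₁ p₂ p₃) : Tensor p₁ q₂ p₃ :=
  fun i j k => ∑ b, V j b * X i b k

/-- The mode-3 product. -/
def mode₃ (V : Matrix (Fin q₃) (Fin p₃) ℝ) (X : Tensor p₁ p₂ p₃) : Tensor p₁ p₂ q₃ :=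
  fun i j k => ∑ c, V k c * X i j c

lemma tucker_eq_mode (G : Tensor r₁ r₂ r₃) (U₁ : Matrix (Fin p₁) (Fin r₁) ℝ)
    (U₂ : Matrix (Fin p₂) (Fin r₂) ℝ) (U₃ : Matrix (Fin p₃) (Fin r₃) ℝ) :
    tucker G U₁ U₂ U₃ = mode₁ U₁ (mode₂ U₂ (mode₃ U₃ G)) := by
  ext i j k
  simp only [tucker, mode₁, mode₂, mode₃, Finset.mul_sum]
  refine Finset.sum_congr rfl fun a _ => Finset.sum_congr rfl fun b _ =>
    Finset.sum_congr rfl fun c _ => ?_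
  ring

lemma mode₁_mode₁ (V : Matrix (Fin q₁) (Fin p₁) ℝ) (U : Matrix (Fin p₁) (Fin r₁) ℝ)
    (X : Tensor r₁ p₂ p₃) : mode₁ V (mode₁ U X) = mode₁ (V * U) X := by
  ext i j k
  simp only [mode₁, Matrix.mul_apply, Finset.mul_sum, Finset.sum_mul]
  rw [Finset.sum_comm]
  exact Finset.sum_congr rfl fun a _ => Finset.sum_congr rfl fun b _ => by ring

lemma mode₂_mode₂ (V : Matrix (Fin q₂) (Fin p₂) ℝ) (U : Matrix (Fin p₂) (Fin r₂) ℝ)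
    (X : Tensor p₁ r₂ p₃) : mode₂ V (mode₂ U X) = mode₂ (V * U) X := by
  ext i j k
  simp only [mode₂, Matrix.mul_apply, Finset.mul_sum, Finset.sum_mul]
  rw [Finset.sum_comm]
  exact Finset.sum_congr rfl fun a _ => Finset.sum_congr rfl fun b _ => by ring

lemma mode₃_mode₃ (V : Matrix (Fin q₃) (Fin p₃) ℝ) (U : Matrix (Fin p₃) (Fin r₃) ℝ)
    (X : Tensor p₁ p₂ r₃) : mode₃ V (mode₃ U X) = mode₃ (V * U) X := by
  ext i j k
  simp only [mode₃, Matrix.mul_apply, Finset.mul_sum, Finset.sum_mul]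
  rw [Finset.sum_comm]
  exact Finset.sum_congr rfl fun a _ => Finset.sum_congr rfl fun b _ => by ring

lemma mode₁_mode₂ (V : Matrix (Fin q₁) (Fin p₁) ℝ) (U : Matrix (Fin q₂) (Fin p₂) ℝ)
    (X : Tensor p₁ p₂ p₃) : mode₁ V (mode₂ U X) = mode₂ U (mode₁ V X) := by
  ext i j k
  simp only [mode₁, mode₂, Finset.mul_sum]
  rw [Finset.sum_comm]
  exact Finset.sum_congr rfl fun a _ => Finset.sum_congr rfl fun b _ => by ring

lemma mode₁_mode₃ (V : Matrix (Fin q₁) (Fin p₁) ℝ) (U : Matrix (Fin q₃) (Fin p₃) ℝ)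
    (X : Tensor p₁ p₂ p₃) : mode₁ V (mode₃ U X) = mode₃ U (mode₁ V X) := by
  ext i j k
  simp only [mode₁, mode₃, Finset.mul_sum]
  rw [Finset.sum_comm]
  exact Finset.sum_congr rfl fun a _ => Finset.sum_congr rfl fun b _ => by ring

lemma mode₂_mode₃ (V : Matrix (Fin q₂) (Fin p₂) ℝ) (U : Matrix (Fin q₃) (Fin p₃) ℝ)
    (X : Tensor p₁ p₂ p₃) : mode₂ V (mode₃ U X) = mode₃ U (mode₂ V X) := by
  ext i j k
  simp only [mode₂, mode₃, Finset.mul_sum]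
  rw [Finset.sum_comm]
  exact Finset.sum_congr rfl fun a _ => Finset.sum_congr rfl fun b _ => by ring

lemma unfold₁_mode₁ (V : Matrix (Fin q₁) (Fin p₁) ℝ) (X : Tensor p₁ p₂ p₃) :
    unfold₁ (mode₁ V X) = V * unfold₁ X := rfl

lemma unfold₂_mode₂ (V : Matrix (Fin q₂) (Fin p₂) ℝ) (X : Tensor p₁ p₂ p₃) :
    unfold₂ (mode₂ V X) = V * unfold₂ X := rfl

lemma unfold₃_mode₃ (V : Matrix (Fin q₃) (Fin p₃) ℝ) (X : Tensor p₁ p₂ p₃) :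
    unfold₃ (mode₃ V X) = V * unfold₃ X := rfl

lemma rank_mul_le_width {m n : ℕ} {k : Type*} [Fintype k] (V : Matrix (Fin m) (Fin n) ℝ)
    (Y : Matrix (Fin n) k ℝ) : (V * Y).rank ≤ n :=
  (Matrix.rank_mul_le_left V Y).trans (V.rank_le_width)

lemma rank_unfold₁_tucker_le (G : Tensor r₁ r₂ r₃) (U₁ : Matrix (Fin p₁) (Fin r₁) ℝ)
    (U₂ : Matrix (Fin p₂) (Fin r₂) ℝ) (U₃ : Matrix (Fin p₃) (Fin r₃) ℝ) :
    (unfold₁ (tucker G U₁ U₂ U₃)).rank ≤ r₁ := by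
  rw [tucker_eq_mode, unfold₁_mode₁]; exact rank_mul_le_width _ _

lemma rank_unfold₂_tucker_le (G : Tensor r₁ r₂ r₃) (U₁ : Matrix (Fin p₁) (Fin r₁) ℝ)
    (U₂ : Matrix (Fin p₂) (Fin r₂) ℝ) (U₃ : Matrix (Fin p₃) (Fin r₃) ℝ) :
    (unfold₂ (tucker G U₁ U₂ U₃)).rank ≤ r₂ := by
  rw [tucker_eq_mode, mode₁_mode₂, unfold₂_mode₂]; exact rank_mul_le_width _ _

lemma rank_unfold₃_tucker_le (G : Tensor r₁ r₂ r₃) (U₁ : Matrix (Fin p₁) (Fin r₁) ℝ)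
    (U₂ : Matrix (Fin p₂) (Fin r₂) ℝ) (U₃ : Matrix (Fin p₃) (Fin r₃) ℝ) :
    (unfold₃ (tucker G U₁ U₂ U₃)).rank ≤ r₃ := by
  rw [tucker_eq_mode, mode₂_mode₃, mode₁_mode₃, unfold₃_mode₃]; exact rank_mul_le_width _ _

lemma frob_nonneg (X : Tensor p₁ p₂ p₃) : 0 ≤ frob X := Real.sqrt_nonneg _

lemma frob_sq (X : Tensor p₁ p₂ p₃) : frob X ^ 2 = ∑ i, ∑ j, ∑ k, X i j k ^ 2 :=
  Real.sq_sqrt (by positivity)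

lemma IsContraction.sum_sq_le {m n : ℕ} {V : Matrix (Fin m) (Fin n) ℝ} (hV : IsContraction V)
    (x : Fin n → ℝ) : ∑ i, (∑ a, V i a * x a) ^ 2 ≤ ∑ a, x a ^ 2 := by
  have := hV x
  simpa only [dotProduct, Matrix.mulVec, ← sq] using this

lemma frob_mode₁_le {V : Matrix (Fin q₁) (Fin p₁) ℝ} (hV : IsContraction V)
    (X : Tensor p₁ p₂ p₃) : frob (mode₁ V X) ≤ frob X := by
  refine Real.sqrt_le_sqrt ?_
  rw [Finset.sum_comm, Finset.sum_comm (s := (Finset.univ : Finset (Fin p₁)))]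
  refine Finset.sum_le_sum fun j _ => ?_
  rw [Finset.sum_comm, Finset.sum_comm (s := (Finset.univ : Finset (Fin p₁)))]
  exact Finset.sum_le_sum fun k _ => hV.sum_sq_le fun a => X a j k

lemma frob_mode₂_le {V : Matrix (Fin q₂) (Fin p₂) ℝ} (hV : IsContraction V)
    (X : Tensor p₁ p₂ p₃) : frob (mode₂ V X) ≤ frob X := by
  refine Real.sqrt_le_sqrt (Finset.sum_le_sum fun i _ => ?_)
  rw [Finset.sum_comm, Finset.sum_comm (s := (Finset.univ : Finset (Fin p₂)))]
  exact Finset.sum_le_sum fun k _ => hV.sum_sq_le fun a => X i a k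

lemma frob_mode₃_le {V : Matrix (Fin q₃) (Fin p₃) ℝ} (hV : IsContraction V)
    (X : Tensor p₁ p₂ p₃) : frob (mode₃ V X) ≤ frob X :=
  Real.sqrt_le_sqrt (Finset.sum_le_sum fun i _ => Finset.sum_le_sum fun j _ =>
    hV.sum_sq_le fun a => X i j a)

lemma frob_tucker_le {U₁ : Matrix (Fin p₁) (Fin r₁) ℝ} {U₂ : Matrix (Fin p₂) (Fin r₂) ℝ}
    {U₃ : Matrix (Fin p₃) (Fin r₃) ℝ} (h₁ : IsContraction U₁) (h₂ : IsContraction U₂)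
    (h₃ : IsContraction U₃) (G : Tensor r₁ r₂ r₃) : frob (tucker G U₁ U₂ U₃) ≤ frob G := by
  rw [tucker_eq_mode]
  exact (frob_mode₁_le h₁ _).trans ((frob_mode₂_le h₂ _).trans (frob_mode₃_le h₃ _))

/-- A tensor of multilinear rank at most `(r₁, r₂, r₃)` has a Tucker decomposition whose factors
are contractions and whose core has at most the same norm. -/
lemma exists_tucker_of_rank_le (X : Tensor p₁ p₂ p₃) (h₁ : (unfold₁ X).rank ≤ r₁)
    (h₂ : (unfold₂ X).rank ≤ r₂) (h₃ : (unfold₃ X).rank ≤ r₃) :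
    ∃ (G : Tensor r₁ r₂ r₃) (U₁ : Matrix (Fin p₁) (Fin r₁) ℝ) (U₂ : Matrix (Fin p₂) (Fin r₂) ℝ)
      (U₃ : Matrix (Fin p₃) (Fin r₃) ℝ), X = tucker G U₁ U₂ U₃ ∧ frob G ≤ frob X ∧
      IsContraction U₁ ∧ IsContraction U₂ ∧ IsContraction U₃ := by
  obtain ⟨V₁, hV₁, e₁⟩ := exists_contraction_fixing _ h₁
  obtain ⟨V₂, hV₂, e₂⟩ := exists_contraction_fixing _ h₂
  obtain ⟨V₃, hV₃, e₃⟩ := exists_contraction_fixing _ h₃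
  have f₁ : mode₁ (V₁ * V₁ᵀ) X = X := by
    rw [← unfold₁_mode₁] at e₁
    ext i j k
    exact congrFun (congrFun e₁ i) (k, j)
  have f₂ : mode₂ (V₂ * V₂ᵀ) X = X := by
    rw [← unfold₂_mode₂] at e₂
    ext i j k
    exact congrFun (congrFun e₂ j) (k, i)
  have f₃ : mode₃ (V₃ * V₃ᵀ) X = X := by
    rw [← unfold₃_mode₃] at e₃
    ext i j k
    exact congrFun (congrFun e₃ k) (j, i)
  refine ⟨tucker X V₁ᵀ V₂ᵀ V₃ᵀ, V₁, V₂, V₃, ?_,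
    frob_tucker_le hV₁.transpose hV₂.transpose hV₃.transpose X, hV₁, hV₂, hV₃⟩
  rw [tucker_eq_mode, tucker_eq_mode, ← mode₁_mode₃, ← mode₁_mode₂, mode₁_mode₁,
    ← mode₂_mode₃, mode₂_mode₂, mode₃_mode₃, f₃, f₂, f₁]

lemma tucker_add_core (G G' : Tensor r₁ r₂ r₃) (U₁ : Matrix (Fin p₁) (Fin r₁) ℝ)
    (U₂ : Matrix (Fin p₂) (Fin r₂) ℝ) (U₃ : Matrix (Fin p₃) (Fin r₃) ℝ) :
    tucker (G + G') U₁ U₂ U₃ = tucker G U₁ U₂ U₃ + tucker G' U₁ U₂ U₃ := by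
  ext i j k
  simp only [tucker, Pi.add_apply, add_mul, Finset.sum_add_distrib]

lemma tucker_smul_core (t : ℝ) (G : Tensor r₁ r₂ r₃) (U₁ : Matrix (Fin p₁) (Fin r₁) ℝ)
    (U₂ : Matrix (Fin p₂) (Fin r₂) ℝ) (U₃ : Matrix (Fin p₃) (Fin r₃) ℝ) :
    tucker (t • G) U₁ U₂ U₃ = t • tucker G U₁ U₂ U₃ := by
  ext i j k
  simp only [tucker, Pi.smul_apply, smul_eq_mul, Finset.mul_sum, mul_assoc]

lemma isLinearMap_mode₁ (X : Tensor r₁ p₂ p₃) :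
    IsLinearMap ℝ fun V : Matrix (Fin p₁) (Fin r₁) ℝ => mode₁ V X :=
  ⟨fun V W => by ext; simp [mode₁, add_mul, Finset.sum_add_distrib],
    fun t V => by ext; simp [mode₁, mul_assoc, Finset.mul_sum]⟩

lemma isLinearMap_mode₂ (X : Tensor p₁ r₂ p₃) :
    IsLinearMap ℝ fun V : Matrix (Fin p₂) (Fin r₂) ℝ => mode₂ V X :=
  ⟨fun V W => by ext; simp [mode₂, add_mul, Finset.sum_add_distrib],
    fun t V => by ext; simp [mode₂, mul_assoc, Finset.mul_sum]⟩

lemma isLinearMap_mode₃ (X : Tensor p₁ p₂ r₃) :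
    IsLinearMap ℝ fun V : Matrix (Fin p₃) (Fin r₃) ℝ => mode₃ V X :=
  ⟨fun V W => by ext; simp [mode₃, add_mul, Finset.sum_add_distrib],
    fun t V => by ext; simp [mode₃, mul_assoc, Finset.mul_sum]⟩

lemma frob_smul (t : ℝ) (X : Tensor p₁ p₂ p₃) : frob (t • X) = |t| * frob X := by
  rw [frob, frob, ← Real.sqrt_sq_eq_abs, ← Real.sqrt_mul (sq_nonneg t)]
  simp only [Pi.smul_apply, smul_eq_mul, mul_pow, Finset.mul_sum]

lemma frob_eq_zero {X : Tensor p₁ p₂ p₃} (h : frob X = 0) : X = 0 := by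
  have h1 := frob_sq X
  rw [h, zero_pow two_ne_zero, eq_comm, Finset.sum_eq_zero_iff_of_nonneg
    (fun _ _ => by positivity)] at h1
  ext i j k
  have h2 := h1 i (Finset.mem_univ i)
  rw [Finset.sum_eq_zero_iff_of_nonneg (fun _ _ => by positivity)] at h2
  have h3 := h2 j (Finset.mem_univ j)
  rw [Finset.sum_eq_zero_iff_of_nonneg (fun _ _ => by positivity)] at h3
  simpa using h3 k (Finset.mem_univ k)

lemma exists_core_net (r₁ r₂ r₃ : ℕ) : ∃ S : Finset (Tensor r₁ r₂ r₃),
    S.card ≤ 5 ^ (r₁ * r₂ * r₃) ∧ (∀ G ∈ S, frob G ≤ 1) ∧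
    ∀ (l : Tensor r₁ r₂ r₃ →ₗ[ℝ] ℝ) (M : ℝ), (∀ G ∈ S, l G ≤ M) →
      ∀ G, frob G ≤ 1 → l G ≤ 2 * M := by
  classical
  obtain ⟨S, h1, h2, h3⟩ := exists_dotProduct_net (Fin r₁ × Fin r₂ × Fin r₃)
  set c : (Fin r₁ × Fin r₂ × Fin r₃ → ℝ) →ₗ[ℝ] Tensor r₁ r₂ r₃ :=
    { toFun := fun v i j k => v (i, j, k)
      map_add' := fun _ _ => rfl
      map_smul' := fun _ _ => rfl } with hc
  have hn : ∀ v, frob (c v) ≤ 1 ↔ v ⬝ᵥ v ≤ 1 := by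
    intro v
    rw [← sq_le_one_iff₀ (frob_nonneg _), frob_sq, dotProduct, Fintype.sum_prod_type]
    simp only [Fintype.sum_prod_type, ← sq]
    rfl
  refine ⟨S.image c, Finset.card_image_le.trans (by simpa [mul_assoc] using h1), ?_, ?_⟩
  · simp only [Finset.mem_image, forall_exists_index, and_imp]
    rintro _ v hv rfl
    exact (hn v).2 (h2 v hv)
  · intro l M hM G hG
    exact h3 (l ∘ₗ c) M (fun v hv => hM _ (Finset.mem_image_of_mem _ hv))
      (fun q => G q.1 q.2.1 q.2.2) ((hn _).1 hG)

/-- A finite set of tensors controlling linear functionals on tensors of low multilinear rank. -/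
lemma exists_lowRank_net (p₁ p₂ p₃ r₁ r₂ r₃ : ℕ) : ∃ S : Finset (Tensor p₁ p₂ p₃),
    S.card ≤ 5 ^ (r₁ * r₂ * r₃ + p₁ * r₁ + p₂ * r₂ + p₃ * r₃) ∧ (∀ X ∈ S, frob X ≤ 1) ∧
    ∀ (l : Tensor p₁ p₂ p₃ →ₗ[ℝ] ℝ) (M : ℝ), (∀ X ∈ S, l X ≤ M) →
      ∀ X : Tensor p₁ p₂ p₃, (unfold₁ X).rank ≤ r₁ → (unfold₂ X).rank ≤ r₂ →
        (unfold₃ X).rank ≤ r₃ → l X ≤ 16 * M * frob X := by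
  classical
  obtain ⟨S₀, c₀, b₀, n₀⟩ := exists_core_net r₁ r₂ r₃
  obtain ⟨S₁, c₁, b₁, n₁⟩ := exists_contraction_net p₁ r₁
  obtain ⟨S₂, c₂, b₂, n₂⟩ := exists_contraction_net p₂ r₂
  obtain ⟨S₃, c₃, b₃, n₃⟩ := exists_contraction_net p₃ r₃
  refine ⟨(S₀ ×ˢ S₁ ×ˢ S₂ ×ˢ S₃).image fun q => tucker q.1 q.2.1 q.2.2.1 q.2.2.2, ?_, ?_, ?_⟩
  · refine Finset.card_image_le.trans ?_
    simp only [Finset.card_product, pow_add, mul_assoc]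
    exact Nat.mul_le_mul (by simpa [mul_assoc] using c₀)
      (Nat.mul_le_mul c₁ (Nat.mul_le_mul c₂ c₃))
  · simp only [Finset.mem_image, Finset.mem_product, forall_exists_index, and_imp]
    rintro _ ⟨G, U₁, U₂, U₃⟩ h0 h1 h2 h3 rfl
    exact (frob_tucker_le (b₁ _ h1) (b₂ _ h2) (b₃ _ h3) G).trans (b₀ _ h0)
  · intro l M hM X h₁ h₂ h₃
    have hM' : ∀ G ∈ S₀, ∀ U₁ ∈ S₁, ∀ U₂ ∈ S₂, ∀ U₃ ∈ S₃, l (tucker G U₁ U₂ U₃) ≤ M :=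
      fun G h0 U₁ h1 U₂ h2 U₃ h3 => hM _ (Finset.mem_image.2
        ⟨(G, U₁, U₂, U₃), by simp [h0, h1, h2, h3], rfl⟩)
    have step₃ : ∀ G ∈ S₀, ∀ U₁ ∈ S₁, ∀ U₂ ∈ S₂, ∀ U₃, IsContraction U₃ →
        l (tucker G U₁ U₂ U₃) ≤ 2 * M := by
      intro G h0 U₁ h1 U₂ h2 U₃ h3
      have e : ∀ V : Matrix (Fin p₃) (Fin r₃) ℝ,
          tucker G U₁ U₂ V = mode₃ V (mode₁ U₁ (mode₂ U₂ G)) := fun V => by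
        rw [tucker_eq_mode, mode₂_mode₃, mode₁_mode₃]
      have := n₃ (l ∘ₗ (isLinearMap_mode₃ (mode₁ U₁ (mode₂ U₂ G))).mk') M
        (fun V hV => by
          have := hM' G h0 U₁ h1 U₂ h2 V hV; rw [e] at this; exact this) U₃ h3
      rw [e]; exact this
    have step₂ : ∀ G ∈ S₀, ∀ U₁ ∈ S₁, ∀ U₂, IsContraction U₂ → ∀ U₃, IsContraction U₃ →
        l (tucker G U₁ U₂ U₃) ≤ 2 * (2 * M) := by
      intro G h0 U₁ h1 U₂ h2 U₃ h3
      have e : ∀ V : Matrix (Fin p₂) (Fin r₂) ℝ,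
          tucker G U₁ V U₃ = mode₂ V (mode₁ U₁ (mode₃ U₃ G)) := fun V => by
        rw [tucker_eq_mode, mode₁_mode₂]
      have := n₂ (l ∘ₗ (isLinearMap_mode₂ (mode₁ U₁ (mode₃ U₃ G))).mk') (2 * M)
        (fun V hV => by
          have := step₃ G h0 U₁ h1 V hV U₃ h3; rw [e] at this; exact this) U₂ h2
      rw [e]; exact this
    have step₁ : ∀ G ∈ S₀, ∀ U₁, IsContraction U₁ → ∀ U₂, IsContraction U₂ →
        ∀ U₃, IsContraction U₃ → l (tucker G U₁ U₂ U₃) ≤ 2 * (2 * (2 * M)) := by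
      intro G h0 U₁ h1 U₂ h2 U₃ h3
      have e : ∀ V : Matrix (Fin p₁) (Fin r₁) ℝ,
          tucker G V U₂ U₃ = mode₁ V (mode₂ U₂ (mode₃ U₃ G)) := fun V =>
        tucker_eq_mode _ _ _ _
      have := n₁ (l ∘ₗ (isLinearMap_mode₁ (mode₂ U₂ (mode₃ U₃ G))).mk') (2 * (2 * M))
        (fun V hV => by
          have := step₂ G h0 V hV U₂ h2 U₃ h3; rw [e] at this; exact this) U₁ h1
      rw [e]; exact this
    have step₀ : ∀ G : Tensor r₁ r₂ r₃, frob G ≤ 1 → ∀ U₁, IsContraction U₁ →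
        ∀ U₂, IsContraction U₂ → ∀ U₃, IsContraction U₃ →
        l (tucker G U₁ U₂ U₃) ≤ 2 * (2 * (2 * (2 * M))) := by
      intro G h0 U₁ h1 U₂ h2 U₃ h3
      have hlin : IsLinearMap ℝ fun G : Tensor r₁ r₂ r₃ => tucker G U₁ U₂ U₃ :=
        ⟨fun G G' => tucker_add_core G G' U₁ U₂ U₃, fun t G => tucker_smul_core t G U₁ U₂ U₃⟩
      exact n₀ (l ∘ₗ hlin.mk') (2 * (2 * (2 * M)))
        (fun G hG => step₁ G hG U₁ h1 U₂ h2 U₃ h3) G h0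
    obtain ⟨G, U₁, U₂, U₃, hX, hG, hU₁, hU₂, hU₃⟩ := exists_tucker_of_rank_le X h₁ h₂ h₃
    rcases (frob_nonneg X).eq_or_lt with h | h
    · rw [← h, frob_eq_zero h.symm]; simp
    · have h5 := step₀ ((frob X)⁻¹ • G) (by
        rw [frob_smul, abs_of_nonneg (by positivity)]
        rw [inv_mul_le_iff₀ h]; linarith) U₁ hU₁ U₂ hU₂ U₃ hU₃
      rw [tucker_smul_core, ← hX, map_smul, smul_eq_mul, inv_mul_le_iff₀ h] at h5
      linarith

end tucker


/-! ### Convergence in probability -/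

section inMeasure

variable {Ω : Type*} [MeasurableSpace Ω] {μ : Measure Ω}

lemma tendstoInMeasure_finsetSum_zero {n : ℕ} {f : ℕ → ℕ → Ω → ℝ}
    (h : ∀ i, TendstoInMeasure μ (f i) atTop (fun _ => 0)) :
    TendstoInMeasure μ (fun J ω => ∑ i ∈ Finset.range n, f i J ω) atTop (fun _ => 0) := by
  rw [tendstoInMeasure_iff_norm]
  intro ε hε
  have hε' : 0 < ε / (n + 1) := by positivity
  have h1 : Tendsto (fun J => ∑ i ∈ Finset.range n, μ {ω | ε / (n + 1) ≤ ‖f i J ω - 0‖})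
      atTop (𝓝 0) := by
    have := tendsto_finsetSum (Finset.range n)
      fun i _ => (tendstoInMeasure_iff_norm.1 (h i)) _ hε'
    simpa only [Finset.sum_const_zero] using this
  refine tendsto_of_tendsto_of_tendsto_of_le_of_le tendsto_const_nhds h1 (fun _ => zero_le)
    fun J => ?_
  refine (measure_mono ?_).trans (measure_biUnion_finset_le (Finset.range n)
    fun i => {ω | ε / (n + 1) ≤ ‖f i J ω - 0‖})
  intro ω hω
  simp only [Set.mem_ofPred_eq, sub_zero] at hω
  simp only [Set.mem_iUnion, Set.mem_ofPred_eq, sub_zero, exists_prop]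
  by_contra! hcon
  have h2 : ‖∑ i ∈ Finset.range n, f i J ω‖ ≤ n * (ε / (n + 1)) := by
    refine (norm_sum_le _ _).trans ((Finset.sum_le_sum fun i hi => (hcon i hi).le).trans ?_)
    simp
  have h3 : n * (ε / (n + 1)) < ε := by
    rw [mul_div_assoc', div_lt_iff₀ (by positivity)]; nlinarith
  linarith

lemma tendstoInMeasure_dotProduct_zero [IsProbabilityMeasure μ] {N : ℕ} {z : Ω → Fin N → ℝ}
    {x : ℕ → Ω → Fin N → ℝ} (hx : ∀ J, IdentDistrib (x J) z μ μ) {a : ℕ → Fin N → ℝ}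
    (ha : Tendsto a atTop (𝓝 0)) :
    TendstoInMeasure μ (fun J ω => a J ⬝ᵥ x J ω) atTop (fun _ => 0) := by
  have h1 : TendstoInMeasure μ (fun J ω => a J ⬝ᵥ z ω) atTop (fun _ => 0) := by
    refine tendstoInMeasure_of_tendsto_ae (fun J => ?_) (ae_of_all _ fun ω => ?_)
    · have hz : AEMeasurable z μ := (hx 0).aemeasurable_snd
      have hm : Measurable fun v : Fin N → ℝ => a J ⬝ᵥ v := by
        unfold dotProduct; fun_prop
      exact (hm.comp_aemeasurable hz).aestronglyMeasurable
    · have hc : Continuous fun v : Fin N → ℝ => v ⬝ᵥ z ω := by fun_prop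
      have := (hc.tendsto 0).comp ha
      simp only [zero_dotProduct] at this
      exact this
  rw [tendstoInMeasure_iff_norm] at h1 ⊢
  intro ε hε
  refine (h1 ε hε).congr fun J => ?_
  have hm : Measurable fun v : Fin N → ℝ => ‖a J ⬝ᵥ v - 0‖ := by
    unfold dotProduct; fun_prop
  exact ((hx J).measure_mem_eq (hm measurableSet_Ici)).symm

end inMeasure

/-! ### Linear functionals of the innovations -/

section innovations

variable {Ω : Type*} [MeasurableSpace Ω] {μ : Measure Ω} {N : ℕ} {κ : ℝ≥0}
  {ξ : ℤ → Ω → Fin N → ℝ}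

lemma measurable_dotProduct (a : Fin N → ℝ) : Measurable fun v : Fin N → ℝ => a ⬝ᵥ v := by
  unfold dotProduct; fun_prop

lemma measurable_mulVec {m n : Type*} [Fintype m] [Fintype n] (B : Matrix m n ℝ) :
    Measurable fun v : n → ℝ => B *ᵥ v := by
  unfold Matrix.mulVec dotProduct; fun_prop

lemma IsSubGaussianNoise.iIndepFun_dotProduct (hξ : IsSubGaussianNoise μ κ ξ)
    (u : ℤ → Fin N → ℝ) : iIndepFun (fun k ω => u k ⬝ᵥ ξ k ω) μ :=
  hξ.indep.comp (fun k v => u k ⬝ᵥ v) fun k => measurable_dotProduct (u k)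

lemma IsSubGaussianNoise.hasSubgaussianMGF_dotProduct (hξ : IsSubGaussianNoise μ κ ξ)
    (k : ℤ) (u : Fin N → ℝ) :
    HasSubgaussianMGF (fun ω => u ⬝ᵥ ξ k ω) (κ ^ 2 * (u ⬝ᵥ u).toNNReal) μ := by
  have h := HasSubgaussianMGF.sum_of_iIndepFun
    (X := fun i ω => u i * ξ k ω i) (s := Finset.univ)
    (c := fun i => ⟨u i ^ 2, sq_nonneg _⟩ * κ ^ 2)
    ((hξ.indep_entries k).comp (fun i x => u i * x) fun i => by fun_prop)
    (fun i _ => (hξ.subGaussian k i).const_mul (u i))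
  convert h using 1
  · rfl
  refine NNReal.coe_injective ?_
  rw [NNReal.coe_mul, Real.coe_toNNReal _ (dotProduct_self_nonneg' u), NNReal.coe_sum, dotProduct,
    Finset.mul_sum]
  refine Finset.sum_congr rfl fun i _ => ?_
  change ((κ ^ 2 : ℝ≥0) : ℝ) * (u i * u i) = u i ^ 2 * ((κ ^ 2 : ℝ≥0) : ℝ)
  ring

lemma IsSubGaussianNoise.hasSubgaussianMGF_sum (hξ : IsSubGaussianNoise μ κ ξ)
    (s : Finset ℤ) (u : ℤ → Fin N → ℝ) :
    HasSubgaussianMGF (fun ω => ∑ k ∈ s, u k ⬝ᵥ ξ k ω)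
      (κ ^ 2 * (∑ k ∈ s, u k ⬝ᵥ u k).toNNReal) μ := by
  have h := HasSubgaussianMGF.sum_of_iIndepFun (s := s) (hξ.iIndepFun_dotProduct u)
    (fun k _ => hξ.hasSubgaussianMGF_dotProduct k (u k))
  convert h using 1
  rw [← Finset.mul_sum, Real.toNNReal_sum_of_nonneg fun k _ => dotProduct_self_nonneg' _]

lemma IsSubGaussianNoise.integral_dotProduct (hξ : IsSubGaussianNoise μ κ ξ)
    (k : ℤ) (u : Fin N → ℝ) : ∫ ω, u ⬝ᵥ ξ k ω ∂μ = 0 := by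
  simp only [dotProduct]
  rw [integral_finsetSum _ fun i _ => ((hξ.subGaussian k i).integrable.const_mul _)]
  refine Finset.sum_eq_zero fun i _ => ?_
  rw [integral_const_mul, hξ.mean_zero, mul_zero]

lemma IsSubGaussianNoise.memLp_two (hξ : IsSubGaussianNoise μ κ ξ) (k : ℤ) (i : Fin N) :
    MemLp (fun ω => ξ k ω i) 2 μ := by
  simpa using (hξ.subGaussian k i).memLp 2

lemma IsSubGaussianNoise.integral_dotProduct_sq (hξ : IsSubGaussianNoise μ κ ξ)
    (k : ℤ) (u : Fin N → ℝ) : ∫ ω, (u ⬝ᵥ ξ k ω) ^ 2 ∂μ = u ⬝ᵥ u := by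
  have hint : ∀ i j, Integrable (fun ω => ξ k ω i * ξ k ω j) μ := fun i j =>
    (hξ.memLp_two k i).integrable_mul (hξ.memLp_two k j)
  have h1 : ∀ ω, (u ⬝ᵥ ξ k ω) ^ 2 = ∑ i, ∑ j, u i * u j * (ξ k ω i * ξ k ω j) := by
    intro ω
    rw [dotProduct, sq, Finset.sum_mul_sum]
    exact Finset.sum_congr rfl fun i _ => Finset.sum_congr rfl fun j _ => by ring
  simp only [h1]
  rw [integral_finsetSum _ fun i _ => integrable_finsetSum _ fun j _ => (hint i j).const_mul _]
  refine Finset.sum_congr rfl fun i _ => ?_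
  rw [integral_finsetSum _ fun j _ => (hint i j).const_mul _]
  simp only [integral_const_mul, hξ.cov_one, Matrix.one_apply]
  simp

lemma IsSubGaussianNoise.integral_sum (hξ : IsSubGaussianNoise μ κ ξ)
    (s : Finset ℤ) (u : ℤ → Fin N → ℝ) : ∫ ω, ∑ k ∈ s, u k ⬝ᵥ ξ k ω ∂μ = 0 := by
  rw [integral_finsetSum _ fun k _ => (hξ.hasSubgaussianMGF_dotProduct k (u k)).integrable]
  exact Finset.sum_eq_zero fun k _ => hξ.integral_dotProduct k (u k)

lemma IsSubGaussianNoise.integral_sum_sq [IsProbabilityMeasure μ] (hξ : IsSubGaussianNoise μ κ ξ)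
    (s : Finset ℤ) (u : ℤ → Fin N → ℝ) :
    ∫ ω, (∑ k ∈ s, u k ⬝ᵥ ξ k ω) ^ 2 ∂μ = ∑ k ∈ s, u k ⬝ᵥ u k := by
  have hL : ∀ k, MemLp (fun ω => u k ⬝ᵥ ξ k ω) 2 μ := fun k => by
    simpa using (hξ.hasSubgaussianMGF_dotProduct k (u k)).memLp 2
  have h := IndepFun.variance_sum (X := fun k ω => u k ⬝ᵥ ξ k ω) (s := s) (fun k _ => hL k)
    fun k _ l _ hkl => (hξ.iIndepFun_dotProduct u).indepFun hkl
  rw [variance_eq_sub (memLp_finsetSum' s fun k _ => hL k)] at h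
  have h0 : ∫ ω, (∑ k ∈ s, fun ω => u k ⬝ᵥ ξ k ω) ω ∂μ = 0 := by
    simpa only [Finset.sum_apply] using hξ.integral_sum s u
  rw [h0] at h
  simp only [Pi.pow_apply, Finset.sum_apply] at h
  rw [zero_pow two_ne_zero, sub_zero] at h
  rw [h]
  refine Finset.sum_congr rfl fun k _ => ?_
  rw [variance_eq_sub (hL k), hξ.integral_dotProduct, zero_pow two_ne_zero, sub_zero]
  exact hξ.integral_dotProduct_sq k (u k)

end innovations

/-! ### The stationary solution -/

lemma measurable_seq {Ω β : Type*} {m : MeasurableSpace Ω} [MeasurableSpace β] {g : ℤ → Ω → β}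
    (h : ∀ k, Measurable[m] (g k)) : Measurable[m] fun ω k => g k ω :=
  measurable_pi_lambda _ h

lemma measurable_ite_seq {Ω β : Type*} {m : MeasurableSpace Ω} [MeasurableSpace β] [Zero β]
    {p : ℤ → Prop} [DecidablePred p] {g : ℤ → Ω → β} (h : ∀ k, p k → Measurable[m] (g k)) :
    Measurable[m] fun ω k => if p k then g k ω else 0 :=
  measurable_pi_lambda _ fun k => by
    by_cases hk : p k
    · simpa [hk] using h k hk
    · simp [hk]

section stationary

variable {Ω : Type*} {mΩ : MeasurableSpace Ω} {μ : Measure Ω} {N P : ℕ}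
  {A : Tensor N N P} {ε y : ℤ → Ω → Fin N → ℝ}

lemma IsStationaryVAR.identDistrib (hy : IsStationaryVAR μ A ε y) (n : ℤ) :
    IdentDistrib (y n) (y 0) μ μ := by
  have h := (hy.stationary n).comp (measurable_pi_apply (X := fun _ : ℤ => Fin N → ℝ) 0)
  simpa [Function.comp_def] using h

lemma IsStationaryVAR.residual_eq (hy : IsStationaryVAR μ A ε y) :
    ∀ᵐ ω ∂μ, ∀ n, residual A (fun k => y k ω) n = ε n ω := by
  rw [ae_all_iff]
  intro n
  filter_upwards [hy.equation n] with ω h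
  rw [residual, h]
  simp

/-- Linear functionals of the stationary solution are limits of linear functionals of the
model errors. -/
lemma IsStationaryVAR.exists_seq_tendsto [IsProbabilityMeasure μ] (hy : IsStationaryVAR μ A ε y) (hP : 0 < P) (hN : 0 < N)
    (hst : ∀ z : ℂ, ‖z‖ < 1 → (matPoly A z).det ≠ 0) (hA : 0 < muMin A)
    (W : ℕ → Fin N → ℝ) {k₀ : ℕ} (hW : ∀ k, k₀ ≤ k → W k = 0) (t : ℤ) :
    ∃ ns : ℕ → ℕ, StrictMono ns ∧ ∀ᵐ ω ∂μ, Tendsto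
      (fun i => ∑ k ∈ Finset.range (ns i), dualSol A W k ⬝ᵥ ε (t - k) ω) atTop
      (𝓝 (∑ k ∈ Finset.range k₀, W k ⬝ᵥ y (t - k) ω)) := by
  have h0 : TendstoInMeasure μ (fun J ω => ∑ i ∈ Finset.range P,
      adjointFilter A (trunc J (dualSol A W)) (J + i) ⬝ᵥ y (t - (J + i : ℕ)) ω) atTop
      (fun _ => 0) :=
    tendstoInMeasure_finsetSum_zero fun i => tendstoInMeasure_dotProduct_zero
      (fun J => hy.identDistrib _) (tendsto_adjointFilter_trunc A hP hN hst hA W hW i)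
  obtain ⟨ns, hns, h⟩ := h0.exists_seq_tendsto_ae
  refine ⟨ns, hns, ?_⟩
  filter_upwards [h, hy.residual_eq] with ω h1 h2
  have h3 := h1.const_add (∑ k ∈ Finset.range k₀, W k ⬝ᵥ y (t - k) ω)
  rw [add_zero] at h3
  refine h3.congr' ?_
  filter_upwards [hns.tendsto_atTop.eventually_ge_atTop k₀] with i hi
  have h4 := sum_dotProduct_residual_dualSol A W (ns i) (fun k => y k ω) t
  simp only [h2] at h4
  rw [h4]
  congr 1
  obtain ⟨l, hl⟩ := Nat.exists_eq_add_of_le hi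
  rw [hl, sum_range_extend]
  intro k hk
  rw [hW k hk, zero_dotProduct]

/-- The stationary solution at time `n` is determined by the model errors up to time `n`. -/
lemma IsStationaryVAR.exists_measurable_version [IsProbabilityMeasure μ] (hy : IsStationaryVAR μ A ε y)
    (hP : 0 < P) (hN : 0 < N)
    (hst : ∀ z : ℂ, ‖z‖ < 1 → (matPoly A z).det ≠ 0) (hA : 0 < muMin A)
    (m : MeasurableSpace Ω) (n : ℤ) (hm : ∀ k, k ≤ n → Measurable[m] (ε k)) :
    ∃ g : Ω → Fin N → ℝ, Measurable[m] g ∧ y n =ᵐ[μ] g := by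
  set W : Fin N → ℕ → Fin N → ℝ := fun i k => if k = 0 then Pi.single i 1 else 0 with hWd
  have hW : ∀ i k, 1 ≤ k → W i k = 0 := fun i k hk => if_neg (by omega)
  choose ns hns h using fun i => hy.exists_seq_tendsto hP hN hst hA (W i) (hW i) n
  refine ⟨fun ω i => limsup (fun l => ∑ k ∈ Finset.range (ns i l),
    dualSol A (W i) k ⬝ᵥ ε (n - k) ω) atTop, ?_, ?_⟩
  · refine @measurable_pi_lambda _ _ _ _ _ _ fun i => Measurable.limsup fun l => ?_
    refine Finset.measurable_fun_sum _ fun k _ => ?_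
    exact (measurable_dotProduct _).comp (hm _ (by omega))
  · filter_upwards [ae_all_iff.2 h] with ω hω
    ext i
    rw [(hω i).limsup_eq]
    simp [hWd]

lemma IsStationaryVAR.indepFun_past_future [IsProbabilityMeasure μ] {κ : ℝ≥0} {S : Matrix (Fin N) (Fin N) ℝ}
    {ξ : ℤ → Ω → Fin N → ℝ} (hξ : IsSubGaussianNoise μ κ ξ)
    (hy : IsStationaryVAR μ A (modelError S ξ) y) (hP : 0 < P) (hN : 0 < N)
    (hst : ∀ z : ℂ, ‖z‖ < 1 → (matPoly A z).det ≠ 0) (hA : 0 < muMin A) (n : ℤ) :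
    IndepFun (fun ω k => if k < n then y k ω else 0) (fun ω k => if n ≤ k then ξ k ω else 0) μ := by
  set m : ℤ → MeasurableSpace Ω := fun k => MeasurableSpace.comap (ξ k) inferInstance with hm
  have hind : Indep (⨆ k ∈ Set.Iio n, m k) (⨆ k ∈ Set.Ici n, m k) μ := by
    refine indep_iSup_of_disjoint (fun k => (hξ.measurable k).comap_le) ?_ ?_
    · exact hξ.indep
    · exact Set.disjoint_left.2 fun k h1 h2 => absurd (Set.mem_Iio.1 h1) (not_lt.2 h2)
  have hver : ∀ k, ∃ g : Ω → Fin N → ℝ, k < n →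
      Measurable[⨆ k ∈ Set.Iio n, m k] g ∧ y k =ᵐ[μ] g := by
    intro k
    by_cases hk : k < n
    · obtain ⟨g, hg⟩ := hy.exists_measurable_version hP hN hst hA (⨆ k ∈ Set.Iio n, m k) k
        (fun l hl => by
          refine (measurable_mulVec (sqrtm S)).comp ?_
          refine Measurable.mono (comap_measurable (ξ l)) ?_ le_rfl
          exact le_iSup₂_of_le (f := fun k (_ : k ∈ Set.Iio n) => m k) l
            (Set.mem_Iio.2 (by omega)) le_rfl)
      exact ⟨g, fun _ => hg⟩
    · exact ⟨0, fun h => absurd h hk⟩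
  choose g hg using hver
  have h1 : IndepFun (fun ω k => if k < n then g k ω else 0)
      (fun ω k => if n ≤ k then ξ k ω else 0) μ := by
    refine indep_of_indep_of_le_right (indep_of_indep_of_le_left hind ?_) ?_
    · rw [← measurable_iff_comap_le]
      exact measurable_ite_seq fun k hk => (hg k hk).1
    · rw [← measurable_iff_comap_le]
      refine measurable_ite_seq fun k hk => ?_
      refine Measurable.mono (comap_measurable (ξ k)) ?_ le_rfl
      exact le_iSup₂_of_le (f := fun k (_ : k ∈ Set.Ici n) => m k) k (Set.mem_Ici.2 hk) le_rfl
  refine h1.congr ?_ (ae_eq_refl _)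
  have h2 : ∀ᵐ ω ∂μ, ∀ k, k < n → y k ω = g k ω := by
    rw [ae_all_iff]
    intro k
    by_cases hk : k < n
    · filter_upwards [(hg k hk).2] with ω h _ using h
    · exact ae_of_all _ fun ω h => absurd h hk
  filter_upwards [h2] with ω h
  ext k : 1
  by_cases hk : k < n
  · simp [hk, h k hk]
  · simp [hk]

lemma IsStationaryVAR.indepFun_of_indepFun_error [IsProbabilityMeasure μ] (hy : IsStationaryVAR μ A ε y)
    (hP : 0 < P) (hN : 0 < N)
    (hst : ∀ z : ℂ, ‖z‖ < 1 → (matPoly A z).det ≠ 0) (hA : 0 < muMin A)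
    {β : Type*} [MeasurableSpace β] {η : Ω → β}
    (hη : IndepFun (fun ω (n : ℤ) => ε n ω) η μ) :
    IndepFun (fun ω (n : ℤ) => y n ω) η μ := by
  choose g hg using fun k => hy.exists_measurable_version hP hN hst hA
    (MeasurableSpace.comap (fun ω (n : ℤ) => ε n ω) inferInstance) k
    (fun l _ => (measurable_pi_apply l).comp (comap_measurable (fun ω (n : ℤ) => ε n ω)))
  have h1 : IndepFun (fun ω k => g k ω) η μ := by
    refine indep_of_indep_of_le_left hη ?_
    rw [← measurable_iff_comap_le]
    exact measurable_seq fun k => (hg k).1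
  refine h1.congr ?_ (ae_eq_refl _)
  filter_upwards [ae_all_iff.2 fun k => (hg k).2] with ω h
  ext k : 1
  exact (h k).symm

lemma IsSubGaussianNoise.lintegral_exp_sum_modelError_le {κ : ℝ≥0}
    {S : Matrix (Fin N) (Fin N) ℝ} (hS : S.PosSemidef)
    {ξ : ℤ → Ω → Fin N → ℝ} (hξ : IsSubGaussianNoise μ κ ξ) (u : ℕ → Fin N → ℝ) (J : ℕ) (t : ℤ) :
    ∫⁻ ω, ENNReal.ofReal (Real.exp (∑ k ∈ Finset.range J, u k ⬝ᵥ modelError S ξ (t - k) ω)) ∂μ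
      ≤ ENNReal.ofReal (Real.exp ((κ : ℝ) ^ 2 * lamMax S *
        (∑ k ∈ Finset.range J, u k ⬝ᵥ u k) / 2)) := by
  set f : ℕ ↪ ℤ := ⟨fun k => t - k, fun a b h => by simpa using h⟩ with hf
  set v : ℤ → Fin N → ℝ := fun k => sqrtm S *ᵥ u (t - k).toNat with hv
  have hsum : ∀ ω, ∑ k ∈ (Finset.range J).map f, v k ⬝ᵥ ξ k ω
      = ∑ k ∈ Finset.range J, u k ⬝ᵥ modelError S ξ (t - k) ω := by
    intro ω
    rw [Finset.sum_map]
    refine Finset.sum_congr rfl fun k _ => ?_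
    rw [modelError, dotProduct_sqrtm_mulVec]
    change (sqrtm S *ᵥ u (t - (t - k)).toNat) ⬝ᵥ ξ (t - k) ω = _
    simp
  have hsq : ∑ k ∈ (Finset.range J).map f, v k ⬝ᵥ v k
      ≤ lamMax S * ∑ k ∈ Finset.range J, u k ⬝ᵥ u k := by
    rw [Finset.sum_map, Finset.mul_sum]
    refine Finset.sum_le_sum fun k _ => ?_
    change (sqrtm S *ᵥ u (t - (t - k)).toNat) ⬝ᵥ (sqrtm S *ᵥ u (t - (t - k)).toNat) ≤ _
    simpa using sqrtm_dotProduct_le hS (u k)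
  have h := hξ.hasSubgaussianMGF_sum ((Finset.range J).map f) v
  have h1 := h.mgf_le 1
  have h2 := h.integrable_exp_mul 1
  simp only [mgf, one_mul, hsum] at h1 h2
  rw [← ofReal_integral_eq_lintegral_ofReal h2 (ae_of_all _ fun _ => (Real.exp_pos _).le)]
  refine ENNReal.ofReal_le_ofReal (h1.trans (Real.exp_le_exp.2 ?_))
  rw [NNReal.coe_mul, Real.coe_toNNReal _ (Finset.sum_nonneg fun k _ => dotProduct_self_nonneg' _)]
  push_cast
  rw [one_pow, mul_one, mul_assoc]
  gcongr

/-- Linear functionals of the stationary solution are sub-Gaussian. -/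
lemma IsStationaryVAR.lintegral_exp_le [IsProbabilityMeasure μ] {κ : ℝ≥0} {S : Matrix (Fin N) (Fin N) ℝ}
    (hS : S.PosDef) {ξ : ℤ → Ω → Fin N → ℝ} (hξ : IsSubGaussianNoise μ κ ξ)
    (hy : IsStationaryVAR μ A (modelError S ξ) y) (hP : 0 < P) (hN : 0 < N)
    (hst : ∀ z : ℂ, ‖z‖ < 1 → (matPoly A z).det ≠ 0) (hA : 0 < muMin A)
    (W : ℕ → Fin N → ℝ) (k₀ : ℕ) (t : ℤ) :
    ∫⁻ ω, ENNReal.ofReal (Real.exp (∑ k ∈ Finset.range k₀, W k ⬝ᵥ y (t - k) ω)) ∂μ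
      ≤ ENNReal.ofReal (Real.exp ((κ : ℝ) ^ 2 * kappaU A S *
        (∑ k ∈ Finset.range k₀, W k ⬝ᵥ W k) / 2)) := by
  wlog hW : ∀ k, k₀ ≤ k → W k = 0 generalizing W with H
  · have := H (trunc k₀ W) (fun k hk => trunc_of_le _ hk)
    rw [Finset.sum_congr (g := fun k => W k ⬝ᵥ W k) rfl fun k hk => by
      rw [trunc_of_lt _ (Finset.mem_range.1 hk)]] at this
    refine le_trans (le_of_eq ?_) this
    refine lintegral_congr fun ω => ?_
    congr 2
    exact Finset.sum_congr rfl fun k hk => by rw [trunc_of_lt _ (Finset.mem_range.1 hk)]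
  obtain ⟨ns, hns, h⟩ := hy.exists_seq_tendsto hP hN hst hA W hW t
  set bd : ℕ → ℝ := fun J => ∑ i ∈ Finset.range P, adjointFilter A (trunc J (dualSol A W)) (J + i)
    ⬝ᵥ adjointFilter A (trunc J (dualSol A W)) (J + i) with hbd
  have hlm : 0 ≤ lamMax S := (lamMin_pos hN hS).le.trans (lamMin_le_lamMax hN hS.1)
  have hbound : ∀ J, k₀ ≤ J →
      ∫⁻ ω, ENNReal.ofReal (Real.exp (∑ k ∈ Finset.range J,
        dualSol A W k ⬝ᵥ modelError S ξ (t - k) ω)) ∂μ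
      ≤ ENNReal.ofReal (Real.exp ((κ : ℝ) ^ 2 * kappaU A S *
        ((∑ k ∈ Finset.range k₀, W k ⬝ᵥ W k) + bd J) / 2)) := by
    intro J hJ
    refine (hξ.lintegral_exp_sum_modelError_le hS.posSemidef (dualSol A W) J t).trans ?_
    refine ENNReal.ofReal_le_ofReal (Real.exp_le_exp.2 ?_)
    have h1 := muMin_mul_sum_dualSol_le A hA W J
    obtain ⟨l, rfl⟩ := Nat.exists_eq_add_of_le hJ
    rw [sum_range_extend (n := k₀) (fun k => W k ⬝ᵥ W k)
      (fun k hk => by rw [hW k hk, zero_dotProduct])] at h1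
    have h2 : ∑ k ∈ Finset.range (k₀ + l), dualSol A W k ⬝ᵥ dualSol A W k
        ≤ ((∑ k ∈ Finset.range k₀, W k ⬝ᵥ W k) + bd (k₀ + l)) / muMin A := by
      rw [le_div_iff₀ hA, mul_comm]; exact h1
    rw [kappaU]
    calc (κ : ℝ) ^ 2 * lamMax S * (∑ k ∈ Finset.range (k₀ + l), dualSol A W k ⬝ᵥ dualSol A W k) / 2
        ≤ (κ : ℝ) ^ 2 * lamMax S
          * (((∑ k ∈ Finset.range k₀, W k ⬝ᵥ W k) + bd (k₀ + l)) / muMin A) / 2 := by gcongr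
      _ = _ := by ring
  have hlim : Tendsto (fun i => ENNReal.ofReal (Real.exp ((κ : ℝ) ^ 2 * kappaU A S *
        ((∑ k ∈ Finset.range k₀, W k ⬝ᵥ W k) + bd (ns i)) / 2))) atTop
      (𝓝 (ENNReal.ofReal (Real.exp ((κ : ℝ) ^ 2 * kappaU A S *
        (∑ k ∈ Finset.range k₀, W k ⬝ᵥ W k) / 2)))) := by
    refine (ENNReal.continuous_ofReal.tendsto _).comp ((Real.continuous_exp.tendsto _).comp ?_)
    have h1 := (tendsto_boundary_sq A hP hN hst hA W hW).comp hns.tendsto_atTop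
    have h2 := ((h1.const_add (∑ k ∈ Finset.range k₀, W k ⬝ᵥ W k)).const_mul
      ((κ : ℝ) ^ 2 * kappaU A S)).div_const 2
    rw [add_zero] at h2
    exact h2
  have hmeas : ∀ i, Measurable fun ω => ENNReal.ofReal (Real.exp (∑ k ∈ Finset.range (ns i),
      dualSol A W k ⬝ᵥ modelError S ξ (t - k) ω)) := by
    intro i
    refine ENNReal.measurable_ofReal.comp (Real.measurable_exp.comp ?_)
    refine Finset.measurable_fun_sum _ fun k _ => (measurable_dotProduct _).comp ?_
    exact (measurable_mulVec _).comp (hξ.measurable _)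
  calc ∫⁻ ω, ENNReal.ofReal (Real.exp (∑ k ∈ Finset.range k₀, W k ⬝ᵥ y (t - k) ω)) ∂μ
      = ∫⁻ ω, liminf (fun i => ENNReal.ofReal (Real.exp (∑ k ∈ Finset.range (ns i),
        dualSol A W k ⬝ᵥ modelError S ξ (t - k) ω))) atTop ∂μ := by
        refine lintegral_congr_ae ?_
        filter_upwards [h] with ω hω
        exact (((ENNReal.continuous_ofReal.tendsto _).comp
          ((Real.continuous_exp.tendsto _).comp hω)).liminf_eq).symm
    _ ≤ liminf (fun i => ∫⁻ ω, ENNReal.ofReal (Real.exp (∑ k ∈ Finset.range (ns i),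
        dualSol A W k ⬝ᵥ modelError S ξ (t - k) ω)) ∂μ) atTop := lintegral_liminf_le hmeas
    _ ≤ liminf (fun i => ENNReal.ofReal (Real.exp ((κ : ℝ) ^ 2 * kappaU A S *
        ((∑ k ∈ Finset.range k₀, W k ⬝ᵥ W k) + bd (ns i)) / 2))) atTop := by
        refine liminf_le_liminf ?_
        filter_upwards [hns.tendsto_atTop.eventually_ge_atTop k₀] with i hi using hbound _ hi
    _ = _ := hlim.liminf_eq

end stationary


/-! ### Moments of sub-Gaussian variables and a small-ball estimate -/

section scalar

variable {Ω : Type*} [MeasurableSpace Ω] {μ : Measure Ω} {X : Ω → ℝ} {c : ℝ≥0}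

lemma integrable_pow_of_subgaussian (hX : HasSubgaussianMGF X c μ) (n : ℕ) :
    Integrable (fun ω => X ω ^ n) μ :=
  integrable_pow_of_mem_interior_integrableExpSet
    (by simp [hX.integrableExpSet_eq_univ]) n

lemma integral_pow_six_le (hX : HasSubgaussianMGF X c μ) (hc : 0 < c) :
    ∫ ω, X ω ^ 6 ∂μ ≤ 2400 * (c : ℝ) ^ 3 := by
  have hc' : (0 : ℝ) < c := hc
  set t : ℝ := (Real.sqrt c)⁻¹ with ht
  have ht0 : 0 < t := by positivity
  have ht2 : t ^ 2 * c = 1 := by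
    rw [ht, inv_pow, Real.sq_sqrt hc'.le]; field_simp
  have hpt : ∀ x : ℝ, x ^ 6 ≤ 720 * (c : ℝ) ^ 3 * (Real.exp (t * x) + Real.exp (-t * x)) := by
    intro x
    have h1 := Real.pow_div_factorial_le_exp (|t * x|) (abs_nonneg _) 6
    have h2 : Real.exp |t * x| ≤ Real.exp (t * x) + Real.exp (-t * x) := by
      rcases abs_choice (t * x) with h | h <;> rw [h]
      · linarith [Real.exp_pos (-t * x)]
      · rw [neg_mul]; linarith [Real.exp_pos (t * x)]
    have h3 : |t * x| ^ 6 = t ^ 6 * x ^ 6 := by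
      rw [← mul_pow, (by decide : Even 6).pow_abs]
    rw [h3] at h1
    have h5 : ((6 : ℕ).factorial : ℝ) = 720 := by norm_num [Nat.factorial]
    rw [h5, div_le_iff₀ (by norm_num)] at h1
    have h6 : x ^ 6 = (c : ℝ) ^ 3 * (t ^ 6 * x ^ 6) := by
      have : (c : ℝ) ^ 3 * t ^ 6 = 1 := by
        calc (c : ℝ) ^ 3 * t ^ 6 = (t ^ 2 * c) ^ 3 := by ring
          _ = 1 := by rw [ht2, one_pow]
      rw [← mul_assoc, this, one_mul]
    rw [h6]
    calc (c : ℝ) ^ 3 * (t ^ 6 * x ^ 6)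
        ≤ (c : ℝ) ^ 3 * ((Real.exp (t * x) + Real.exp (-t * x)) * 720) := by
          exact mul_le_mul_of_nonneg_left
            (h1.trans (mul_le_mul_of_nonneg_right h2 (by norm_num))) (by positivity)
      _ = _ := by ring
  have hi1 := hX.integrable_exp_mul t
  have hi2 := hX.integrable_exp_mul (-t)
  have hm1 := hX.mgf_le t
  have hm2 := hX.mgf_le (-t)
  have hce : (c : ℝ) * t ^ 2 / 2 = 1 / 2 := by rw [mul_comm, ht2]
  rw [neg_sq, hce, mgf] at hm2
  rw [hce, mgf] at hm1
  have hexp : Real.exp (1 / 2) ≤ 5 / 3 := by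
    have h1 : Real.exp (1 / 2) ^ 2 ≤ (5 / 3) ^ 2 := by
      rw [← Real.exp_nat_mul]
      have := Real.exp_one_lt_d9
      norm_num at this ⊢
      linarith
    exact le_of_sq_le_sq h1 (by norm_num) |>.trans le_rfl
  calc ∫ ω, X ω ^ 6 ∂μ
      ≤ ∫ ω, 720 * (c : ℝ) ^ 3 * (Real.exp (t * X ω) + Real.exp (-t * X ω)) ∂μ :=
        integral_mono (integrable_pow_of_subgaussian hX 6) ((hi1.add hi2).const_mul _)
          fun ω => hpt (X ω)
    _ = 720 * (c : ℝ) ^ 3 * (∫ ω, Real.exp (t * X ω) ∂μ + ∫ ω, Real.exp (-t * X ω) ∂μ) := by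
        rw [integral_const_mul, integral_add hi1 hi2]
    _ ≤ 720 * (c : ℝ) ^ 3 * (5 / 3 + 5 / 3) := by gcongr <;> linarith
    _ = _ := by ring

lemma two_add_sq_le_exp_add_exp (x : ℝ) : 2 + x ^ 2 ≤ Real.exp x + Real.exp (-x) := by
  have h1 : Real.cosh x = 1 + 2 * Real.sinh (x / 2) ^ 2 := by
    rw [show x = 2 * (x / 2) by ring, Real.cosh_two_mul, Real.cosh_sq]
    ring_nf
  have h2 : (x / 2) ^ 2 ≤ Real.sinh (x / 2) ^ 2 := by
    rcases le_total 0 (x / 2) with h | h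
    · exact pow_le_pow_left₀ h (Real.self_le_sinh_iff.2 h) 2
    · rw [← neg_sq (x / 2), ← neg_sq (Real.sinh _)]
      exact pow_le_pow_left₀ (by linarith) (by have := Real.sinh_le_self_iff.2 h; linarith) 2
  rw [Real.cosh_eq] at h1
  linarith

lemma one_le_of_subgaussian [IsProbabilityMeasure μ] (hX : HasSubgaussianMGF X c μ)
    (h2 : ∫ ω, X ω ^ 2 ∂μ = 1) : 1 ≤ (c : ℝ) := by
  by_contra! hc
  have hc0 : (0 : ℝ) ≤ c := c.2
  set τ : ℝ := (1 - c) / 2 with hτ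
  have hτ0 : 0 < τ := by rw [hτ]; linarith
  set t : ℝ := Real.sqrt (2 * τ) with ht
  have ht2 : t ^ 2 = 2 * τ := Real.sq_sqrt (by linarith)
  have hpt : ∀ x : ℝ, 2 + t ^ 2 * x ^ 2 ≤ Real.exp (t * x) + Real.exp (-t * x) := by
    intro x
    have h := two_add_sq_le_exp_add_exp (t * x)
    rw [neg_mul, ← mul_pow]
    exact h
  have hi1 := hX.integrable_exp_mul t
  have hi2 := hX.integrable_exp_mul (-t)
  have hm1 := hX.mgf_le t
  have hm2 := hX.mgf_le (-t)
  rw [neg_sq, mgf] at hm2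
  rw [mgf] at hm1
  have h3 : 2 + t ^ 2 ≤ 2 * Real.exp (c * t ^ 2 / 2) := by
    calc 2 + t ^ 2 = ∫ ω, (2 + t ^ 2 * X ω ^ 2) ∂μ := by
          rw [integral_add (integrable_const _)
            ((integrable_pow_of_subgaussian hX 2).const_mul _), integral_const_mul, h2]
          simp
      _ ≤ ∫ ω, (Real.exp (t * X ω) + Real.exp (-t * X ω)) ∂μ :=
          integral_mono ((integrable_const _).add
            ((integrable_pow_of_subgaussian hX 2).const_mul _)) (hi1.add hi2) fun ω => hpt (X ω)
      _ = _ := integral_add hi1 hi2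
      _ ≤ _ := by linarith
  rw [ht2, show (c : ℝ) * (2 * τ) / 2 = c * τ by ring] at h3
  have h4 : 1 - c * τ ≤ Real.exp (-(c * τ)) := by
    have := Real.add_one_le_exp (-(c * τ)); linarith
  have h5 : Real.exp (c * τ) * Real.exp (-(c * τ)) = 1 := by rw [← Real.exp_add]; simp
  have h6 : (1 + τ) * (1 - c * τ) ≤ 1 := by
    have hcτ : c * τ < 1 := by nlinarith
    calc (1 + τ) * (1 - c * τ) ≤ Real.exp (c * τ) * Real.exp (-(c * τ)) := by
          gcongr
          linarith
      _ = 1 := h5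
  have hceq : (c : ℝ) = 1 - 2 * τ := by rw [hτ]; ring
  rw [hceq] at h6
  have h7 : 0 < τ ^ 2 + 2 * τ ^ 3 := by positivity
  nlinarith

/-- A variance-normalized bound for the fourth moment. -/
lemma integral_pow_four_le (hX : HasSubgaussianMGF X c μ) {k s : ℝ} (hk : 1 ≤ k) (hs : 0 < s)
    (hc : (c : ℝ) = k ^ 2 * s) (h2 : ∫ ω, X ω ^ 2 ∂μ = s) :
    ∫ ω, X ω ^ 4 ∂μ ≤ 49 * k ^ 3 * s ^ 2 := by
  have hc0 : 0 < c := by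
    have : (0 : ℝ) < c := by rw [hc]; positivity
    exact_mod_cast this
  have h6 := integral_pow_six_le hX hc0
  rw [hc] at h6
  have hk0 : 0 < k := by linarith
  set θ : ℝ := 49 * k ^ 3 * s with hθ
  have hθ0 : 0 < θ := by positivity
  have hpt : ∀ x : ℝ, x ^ 4 ≤ (θ * x ^ 2 + θ⁻¹ * x ^ 6) / 2 := by
    intro x
    have h1 : 0 ≤ θ⁻¹ * x ^ 2 * (θ - x ^ 2) ^ 2 := by positivity
    have h2 : θ⁻¹ * x ^ 2 * (θ - x ^ 2) ^ 2 = θ * x ^ 2 - 2 * x ^ 4 + θ⁻¹ * x ^ 6 := by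
      field_simp; ring
    linarith
  have i2 := integrable_pow_of_subgaussian hX 2
  have i6 := integrable_pow_of_subgaussian hX 6
  calc ∫ ω, X ω ^ 4 ∂μ ≤ ∫ ω, (θ * X ω ^ 2 + θ⁻¹ * X ω ^ 6) / 2 ∂μ :=
        integral_mono (integrable_pow_of_subgaussian hX 4)
          (((i2.const_mul _).add (i6.const_mul _)).div_const 2) fun ω => hpt (X ω)
    _ = (θ * s + θ⁻¹ * ∫ ω, X ω ^ 6 ∂μ) / 2 := by
        rw [integral_div, integral_add (i2.const_mul _) (i6.const_mul _), integral_const_mul,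
          integral_const_mul, h2]
    _ ≤ (θ * s + θ⁻¹ * (2400 * (k ^ 2 * s) ^ 3)) / 2 := by gcongr
    _ ≤ 49 * k ^ 3 * s ^ 2 := by
        have : θ⁻¹ * (2400 * (k ^ 2 * s) ^ 3) = 2400 / 49 * (k ^ 3 * s ^ 2) := by
          rw [hθ]; field_simp
        rw [this, hθ]
        have : 0 < k ^ 3 * s ^ 2 := by positivity
        nlinarith

lemma exp_neg_le_quadratic {w : ℝ} (hw : 0 ≤ w) : Real.exp (-w) ≤ 1 - w + w ^ 2 / 2 := by
  have h1 := Real.quadratic_le_exp_of_nonneg hw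
  have h2 : Real.exp w * Real.exp (-w) = 1 := by rw [← Real.exp_add]; simp
  have h3 : 0 < 1 + w + w ^ 2 / 2 := by positivity
  have h4 : (1 + w + w ^ 2 / 2) * Real.exp (-w) ≤ 1 := by
    calc (1 + w + w ^ 2 / 2) * Real.exp (-w) ≤ Real.exp w * Real.exp (-w) := by gcongr
      _ = 1 := h2
  have h5 : 1 ≤ (1 + w + w ^ 2 / 2) * (1 - w + w ^ 2 / 2) := by nlinarith [sq_nonneg (w ^ 2)]
  exact le_of_mul_le_mul_left (h4.trans h5) h3

/-- The small-ball estimate: the bound does not depend on the shift `a`. -/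
lemma integral_exp_neg_sq_le [IsProbabilityMeasure μ] (hX : HasSubgaussianMGF X c μ) {k s : ℝ}
    (hk : 1 ≤ k) (hs : 0 < s) (hc : (c : ℝ) = k ^ 2 * s) (h1 : ∫ ω, X ω ∂μ = 0)
    (h2 : ∫ ω, X ω ^ 2 ∂μ = s) (a : ℝ) :
    ∫ ω, Real.exp (-((196 * k ^ 3 * s)⁻¹ * (a + X ω) ^ 2)) ∂μ
      ≤ Real.exp (-(784 * k ^ 3)⁻¹) := by
  have hk0 : 0 < k := by linarith
  set l : ℝ := (196 * k ^ 3 * s)⁻¹ with hl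
  have hl0 : 0 < l := by positivity
  have h4 := integral_pow_four_le hX hk hs hc h2
  set m4 := ∫ ω, X ω ^ 4 ∂μ with hm4
  set e : Ω → ℝ := fun ω => Real.exp (-(l * (a + X ω) ^ 2)) with he
  have hXm : AEMeasurable X μ := hX.aemeasurable
  have i1 : Integrable X μ := hX.integrable
  have i2 := integrable_pow_of_subgaussian hX 2
  have i4 := integrable_pow_of_subgaussian hX 4
  have hem : AEStronglyMeasurable e μ := by
    have : Measurable fun x : ℝ => Real.exp (-(l * (a + x) ^ 2)) := by fun_prop
    exact (this.comp_aemeasurable hXm).aestronglyMeasurable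
  have hei : Integrable e μ := Integrable.of_bound hem 1 (ae_of_all _ fun ω => by
    rw [Real.norm_of_nonneg (Real.exp_pos _).le]
    exact Real.exp_le_one_iff.2 (by have : 0 ≤ l * (a + X ω) ^ 2 := by positivity
                                    linarith))
  have hpt : ∀ x x' : ℝ, Real.exp (-(l * (a + x) ^ 2)) * Real.exp (-(l * (a + x') ^ 2))
      ≤ (1 - l * x ^ 2 / 2 + l ^ 2 * x ^ 4) + (l * x) * x' + (-(l / 2)) * x' ^ 2
        + l ^ 2 * x' ^ 4 := by
    intro x x'
    rw [← Real.exp_add]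
    have h5 : -(l * (a + x) ^ 2) + -(l * (a + x') ^ 2) ≤ -(l * (x - x') ^ 2 / 2) := by
      have : 0 ≤ l * ((a + x) + (a + x')) ^ 2 := by positivity
      nlinarith
    refine (Real.exp_le_exp.2 h5).trans ((exp_neg_le_quadratic (by positivity)).trans ?_)
    have h6 : (x - x') ^ 4 ≤ 8 * (x ^ 4 + x' ^ 4) := by
      have h7 : (x - x') ^ 2 ≤ 2 * (x ^ 2 + x' ^ 2) := by nlinarith [sq_nonneg (x + x')]
      calc (x - x') ^ 4 = ((x - x') ^ 2) ^ 2 := by ring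
        _ ≤ (2 * (x ^ 2 + x' ^ 2)) ^ 2 := by gcongr
        _ ≤ _ := by nlinarith [sq_nonneg (x ^ 2 - x' ^ 2)]
    have h8 : l ^ 2 * (x - x') ^ 4 ≤ l ^ 2 * (8 * (x ^ 4 + x' ^ 4)) := by gcongr
    nlinarith
  have hpoly : ∀ α β γ δ : ℝ, Integrable (fun ω => α + β * X ω + γ * X ω ^ 2 + δ * X ω ^ 4) μ ∧
      ∫ ω, (α + β * X ω + γ * X ω ^ 2 + δ * X ω ^ 4) ∂μ = α + γ * s + δ * m4 := by
    intro α β γ δ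
    have j1 : Integrable (fun ω => α + β * X ω) μ := (integrable_const _).add (i1.const_mul _)
    have j2 : Integrable (fun ω => α + β * X ω + γ * X ω ^ 2) μ := j1.add (i2.const_mul _)
    refine ⟨j2.add (i4.const_mul _), ?_⟩
    rw [integral_add j2 (i4.const_mul _), integral_add j1 (i2.const_mul _),
      integral_add (integrable_const _) (i1.const_mul _), integral_const_mul, integral_const_mul,
      integral_const_mul, h1, h2, ← hm4]
    simp
  have hinner : ∀ ω, e ω * ∫ ω', e ω' ∂μ
      ≤ (1 - l * X ω ^ 2 / 2 + l ^ 2 * X ω ^ 4) + (-(l / 2)) * s + l ^ 2 * m4 := by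
    intro ω
    rw [← integral_const_mul]
    obtain ⟨hb, hv⟩ := hpoly (1 - l * X ω ^ 2 / 2 + l ^ 2 * X ω ^ 4) (l * X ω) (-(l / 2)) (l ^ 2)
    exact (integral_mono (hei.const_mul _) hb fun ω' => hpt (X ω) (X ω')).trans hv.le
  have hsq : (∫ ω, e ω ∂μ) ^ 2 ≤ 1 - l * s + 2 * l ^ 2 * m4 := by
    rw [sq, ← integral_mul_const]
    obtain ⟨hb, hv⟩ := hpoly (1 - l / 2 * s + l ^ 2 * m4) 0 (-(l / 2)) (l ^ 2)
    refine (integral_mono (hei.mul_const _) hb fun ω => (hinner ω).trans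
      (le_of_eq (by ring))).trans (le_of_eq ?_)
    rw [hv]; ring
  have hls : l * s = (196 * k ^ 3)⁻¹ := by rw [hl]; field_simp
  have hm : 2 * l ^ 2 * m4 ≤ l * s / 2 := by
    calc 2 * l ^ 2 * m4 ≤ 2 * l ^ 2 * (49 * k ^ 3 * s ^ 2) := by gcongr
      _ = l * s / 2 * (l * (196 * k ^ 3 * s)) := by ring
      _ = l * s / 2 := by rw [hl, inv_mul_cancel₀ (by positivity), mul_one]
  have hfin : (∫ ω, e ω ∂μ) ^ 2 ≤ Real.exp (-(784 * k ^ 3)⁻¹) ^ 2 := by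
    rw [← Real.exp_nat_mul]
    have h9 := Real.add_one_le_exp (-(l * s / 2))
    have h10 : ((2 : ℕ) : ℝ) * -(784 * k ^ 3)⁻¹ = -(l * s / 2) := by
      rw [hls]; field_simp; norm_num
    rw [h10]
    linarith
  exact abs_le_of_sq_le_sq' hfin (Real.exp_pos _).le |>.2

end scalar

/-! ### Independence and iterated integrals -/

section indep

variable {Ω α β : Type*} [MeasurableSpace Ω] [MeasurableSpace α] [MeasurableSpace β]
  {μ : Measure Ω}

/-- Markov's inequality in exponential form. -/
lemma measure_le_of_lintegral_exp_le {Z : Ω → ℝ} (hZ : Measurable Z) {E : Set Ω} {t : ℝ}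
    (hE : ∀ ω ∈ E, t ≤ Z ω) {q : ℝ}
    (hq : ∫⁻ ω, ENNReal.ofReal (Real.exp (Z ω)) ∂μ ≤ ENNReal.ofReal (Real.exp q)) :
    μ E ≤ ENNReal.ofReal (Real.exp (q - t)) := by
  have h1 : μ E ≤ μ {ω | ENNReal.ofReal (Real.exp t) ≤ ENNReal.ofReal (Real.exp (Z ω))} :=
    measure_mono fun ω hω => ENNReal.ofReal_le_ofReal (Real.exp_le_exp.2 (hE ω hω))
  have hpos : ENNReal.ofReal (Real.exp t) ≠ 0 := by
    simp [Real.exp_pos]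
  have hm : Measurable fun ω => ENNReal.ofReal (Real.exp (Z ω)) := by fun_prop
  refine h1.trans ((meas_ge_le_lintegral_div hm.aemeasurable hpos ENNReal.ofReal_ne_top).trans ?_)
  rw [Real.exp_sub, ENNReal.ofReal_div_of_pos (Real.exp_pos t)]
  gcongr

variable [IsProbabilityMeasure μ]

lemma lintegral_comp_indepFun {X : Ω → α} {Y : Ω → β} (h : IndepFun X Y μ) (hX : Measurable X)
    (hY : Measurable Y) {g : α → β → ENNReal} (hg : Measurable (Function.uncurry g)) :
    ∫⁻ ω, g (X ω) (Y ω) ∂μ = ∫⁻ ω, ∫⁻ ω', g (X ω) (Y ω') ∂μ ∂μ := by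
  have h1 := h.map_prod_eq_prod_map_map hX.aemeasurable hY.aemeasurable
  have h2 : ∫⁻ ω, g (X ω) (Y ω) ∂μ = ∫⁻ p, Function.uncurry g p ∂(μ.map fun ω => (X ω, Y ω)) := by
    rw [lintegral_map hg (hX.prodMk hY)]; rfl
  have : IsProbabilityMeasure (μ.map Y) := Measure.isProbabilityMeasure_map hY.aemeasurable
  rw [h2, h1, lintegral_prod _ hg.aemeasurable,
    lintegral_map hg.lintegral_prod_right' hX]
  refine lintegral_congr fun ω => ?_
  exact lintegral_map (f := fun b => g (X ω) b) (hg.comp measurable_prodMk_left) hY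

lemma lintegral_mul_le_of_indepFun {X : Ω → α} {Y : Ω → β} (h : IndepFun X Y μ)
    (hX : Measurable X) (hY : Measurable Y) {f : α → ENNReal} (hf : Measurable f)
    {g : α → β → ENNReal} (hg : Measurable (Function.uncurry g)) {q : ENNReal}
    (hq : ∀ a, ∫⁻ ω, g a (Y ω) ∂μ ≤ q) :
    ∫⁻ ω, f (X ω) * g (X ω) (Y ω) ∂μ ≤ q * ∫⁻ ω, f (X ω) ∂μ := by
  rw [lintegral_comp_indepFun h hX hY (g := fun a b => f a * g a b)
    ((hf.comp measurable_fst).mul hg),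
    ← lintegral_const_mul (f := fun ω => f (X ω)) _ (hf.comp hX)]
  refine lintegral_mono fun ω => ?_
  rw [lintegral_const_mul (f := fun ω' => g (X ω) (Y ω')) _
    ((hg.comp measurable_prodMk_left).comp hY), mul_comm]
  gcongr
  exact hq _

end indep


/-! ### Paths cut at a time point -/

/-- The part of a path strictly before time `n`. -/
def cut {N : ℕ} (n : ℤ) (p : ℤ → Fin N → ℝ) : ℤ → Fin N → ℝ := fun k => if k < n then p k else 0

/-- The part of a path from time `n` on. -/
def tailFrom {N : ℕ} (n : ℤ) (p : ℤ → Fin N → ℝ) : ℤ → Fin N → ℝ :=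
  fun k => if n ≤ k then p k else 0

section paths

variable {N P : ℕ}

lemma cut_of_lt {n k : ℤ} (p : ℤ → Fin N → ℝ) (h : k < n) : cut n p k = p k := if_pos h

lemma tailFrom_of_le {n k : ℤ} (p : ℤ → Fin N → ℝ) (h : n ≤ k) : tailFrom n p k = p k := if_pos h

lemma predictor_cut {n k : ℤ} (p : ℤ → Fin N → ℝ) (h : n ≤ k) :
    predictor P (cut k p) n = predictor P p n := by
  ext q
  rw [predictor, cut_of_lt _ (by omega), predictor]

lemma residual_cut (A : Tensor N N P) {n k : ℤ} (p : ℤ → Fin N → ℝ) (h : n < k) :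
    residual A (cut k p) n = residual A p n := by
  rw [residual, residual, cut_of_lt _ h]
  congr 1
  refine Finset.sum_congr rfl fun j _ => ?_
  rw [cut_of_lt _ (by omega)]

lemma predictor_add (p h : ℤ → Fin N → ℝ) (n : ℤ) :
    predictor P (p + h) n = predictor P p n + predictor P h n := rfl

lemma continuous_predictor (n : ℤ) : Continuous fun p : ℤ → Fin N → ℝ => predictor P p n := by
  unfold predictor; fun_prop

lemma continuous_residual (A : Tensor N N P) (n : ℤ) :
    Continuous fun p : ℤ → Fin N → ℝ => residual A p n := by
  unfold residual Matrix.mulVec dotProduct; fun_prop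

lemma measurable_predictor (n : ℤ) : Measurable fun p : ℤ → Fin N → ℝ => predictor P p n :=
  (continuous_predictor n).measurable

lemma measurable_residual (A : Tensor N N P) (n : ℤ) :
    Measurable fun p : ℤ → Fin N → ℝ => residual A p n :=
  (continuous_residual A n).measurable

lemma measurable_cut (n : ℤ) : Measurable (cut (N := N) n) := by
  refine measurable_pi_lambda _ fun k => ?_
  unfold cut
  by_cases hk : k < n
  · simpa [hk] using measurable_pi_apply k
  · simp [hk]

lemma measurable_tailFrom (n : ℤ) : Measurable (tailFrom (N := N) n) := by
  refine measurable_pi_lambda _ fun k => ?_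
  unfold tailFrom
  by_cases hk : n ≤ k
  · simpa [hk] using measurable_pi_apply k
  · simp [hk]

lemma measurable_dotProduct₂ {α : Type*} [MeasurableSpace α] {f g : α → Fin N → ℝ}
    (hf : Measurable f) (hg : Measurable g) : Measurable fun a => f a ⬝ᵥ g a := by
  unfold dotProduct
  fun_prop

end paths

/-- A stationary vector autoregression with stable coefficients and sub-Gaussian errors. -/
structure IsStableVARModel {Ω : Type*} [MeasurableSpace Ω] (μ : Measure Ω) {N P : ℕ} (κ : ℝ≥0)
    (A : Tensor N N P) (S : Matrix (Fin N) (Fin N) ℝ) (ξ y : ℤ → Ω → Fin N → ℝ) : Prop where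
  P_pos : 0 < P
  N_pos : 0 < N
  stable : ∀ z : ℂ, ‖z‖ < 1 → (matPoly A z).det ≠ 0
  muMin_pos : 0 < muMin A
  posDef : S.PosDef
  noise : IsSubGaussianNoise μ κ ξ
  stationaryVAR : IsStationaryVAR μ A (modelError S ξ) y

section chain

variable {Ω : Type*} {mΩ : MeasurableSpace Ω} {μ : Measure Ω}

/-- Iterated conditioning: a bound on each factor given the past bounds the product. -/
lemma lintegral_prod_le_pow [IsProbabilityMeasure μ] {N : ℕ} {Y : Ω → ℤ → Fin N → ℝ}
    {φ : ℕ → (ℤ → Fin N → ℝ) → ENNReal} (hφ : ∀ i, Measurable (φ i)) {n : ℕ → ℤ} {q : ENNReal}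
    (hcut : ∀ i j, i < j → ∀ p, φ i (cut (n j) p) = φ i p)
    (hstep : ∀ (F : (ℤ → Fin N → ℝ) → ENNReal), Measurable F → ∀ i,
      ∫⁻ ω, F (cut (n i) (Y ω)) * φ i (Y ω) ∂μ ≤ q * ∫⁻ ω, F (cut (n i) (Y ω)) ∂μ) (M : ℕ) :
    ∫⁻ ω, ∏ i ∈ Finset.range M, φ i (Y ω) ∂μ ≤ q ^ M := by
  induction M with
  | zero => simp
  | succ M ih =>
    have h := hstep (fun p => ∏ i ∈ Finset.range M, φ i p)
      (Finset.measurable_fun_prod _ fun i _ => hφ i) M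
    have hc : ∀ ω, ∏ i ∈ Finset.range M, φ i (cut (n M) (Y ω))
        = ∏ i ∈ Finset.range M, φ i (Y ω) := fun ω =>
      Finset.prod_congr rfl fun i hi => hcut i M (Finset.mem_range.1 hi) _
    simp only [hc] at h
    simp only [Finset.prod_range_succ]
    refine h.trans ?_
    rw [pow_succ, mul_comm]
    gcongr

variable {N P : ℕ} {κ : ℝ≥0} {A : Tensor N N P} {S : Matrix (Fin N) (Fin N) ℝ}
  {ξ y : ℤ → Ω → Fin N → ℝ}

namespace IsStableVARModel

lemma measurable_path (hM : IsStableVARModel μ κ A S ξ y) : Measurable fun ω k => y k ω :=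
  measurable_seq hM.stationaryVAR.measurable

lemma modelError_eq (hM : IsStableVARModel μ κ A S ξ y) :
    ∀ᵐ ω ∂μ, ∀ n, residual A (fun k => y k ω) n = modelError S ξ n ω :=
  hM.stationaryVAR.residual_eq

lemma kappaL_pos (hM : IsStableVARModel μ κ A S ξ y) : 0 < kappaL A S :=
  div_pos (lamMin_pos hM.N_pos hM.posDef) (zero_lt_one.trans_le (one_le_muMax A hM.N_pos))

lemma lamMax_pos (hM : IsStableVARModel μ κ A S ξ y) : 0 < lamMax S :=
  (lamMin_pos hM.N_pos hM.posDef).trans_le (lamMin_le_lamMax hM.N_pos hM.posDef.1)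

lemma kappaU_pos (hM : IsStableVARModel μ κ A S ξ y) : 0 < kappaU A S :=
  div_pos hM.lamMax_pos hM.muMin_pos

variable [IsProbabilityMeasure μ]

lemma lintegral_mul_le (hM : IsStableVARModel μ κ A S ξ y) (n : ℤ)
    {F : (ℤ → Fin N → ℝ) → ENNReal} (hF : Measurable F)
    {g : (ℤ → Fin N → ℝ) → (ℤ → Fin N → ℝ) → ENNReal} (hg : Measurable (Function.uncurry g))
    {q : ENNReal} (hq : ∀ p, ∫⁻ ω, g p (tailFrom n fun k => ξ k ω) ∂μ ≤ q)
    {φ : (ℤ → Fin N → ℝ) → ENNReal}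
    (hφ : ∀ᵐ ω ∂μ, φ (fun k => y k ω) = g (cut n fun k => y k ω) (tailFrom n fun k => ξ k ω)) :
    ∫⁻ ω, F (cut n fun k => y k ω) * φ (fun k => y k ω) ∂μ
      ≤ q * ∫⁻ ω, F (cut n fun k => y k ω) ∂μ := by
  have hi := hM.stationaryVAR.indepFun_past_future hM.noise hM.P_pos hM.N_pos hM.stable
    hM.muMin_pos n
  refine le_trans (le_of_eq ?_) (lintegral_mul_le_of_indepFun hi
    ((measurable_cut n).comp hM.measurable_path)
    ((measurable_tailFrom n).comp (measurable_seq hM.noise.measurable)) hF hg hq)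
  refine lintegral_congr_ae ?_
  filter_upwards [hφ] with ω hω
  rw [hω]
  rfl

/-- Exponential supermartingale for sums `∑ ε_n ⬝ D_n` with predictable `D`. -/
lemma lintegral_exp_residual_le (hM : IsStableVARModel μ κ A S ξ y)
    {D : ℤ → (ℤ → Fin N → ℝ) → Fin N → ℝ} (hD : ∀ n, Measurable (D n))
    (hcut : ∀ n k, n ≤ k → ∀ p, D n (cut k p) = D n p) (n₀ : ℤ) (M : ℕ) :
    ∫⁻ ω, ENNReal.ofReal (Real.exp (∑ i ∈ Finset.range M,
      (residual A (fun k => y k ω) (n₀ + i) ⬝ᵥ D (n₀ + i) (fun k => y k ω)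
        - (κ : ℝ) ^ 2 * lamMax S *
          (D (n₀ + i) (fun k => y k ω) ⬝ᵥ D (n₀ + i) (fun k => y k ω)) / 2))) ∂μ ≤ 1 := by
  set φ : ℕ → (ℤ → Fin N → ℝ) → ENNReal := fun i p => ENNReal.ofReal (Real.exp
    (residual A p (n₀ + i) ⬝ᵥ D (n₀ + i) p
      - (κ : ℝ) ^ 2 * lamMax S * (D (n₀ + i) p ⬝ᵥ D (n₀ + i) p) / 2)) with hφ
  have h := lintegral_prod_le_pow (μ := μ) (Y := fun ω k => y k ω) (φ := φ)
    (n := fun i => n₀ + i) (q := 1) ?_ ?_ ?_ M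
  · rw [one_pow] at h
    refine le_trans (le_of_eq (lintegral_congr fun ω => ?_)) h
    rw [Real.exp_sum, ENNReal.ofReal_prod_of_nonneg fun _ _ => (Real.exp_pos _).le]
  · intro i
    exact ENNReal.measurable_ofReal.comp (Real.measurable_exp.comp
      ((measurable_dotProduct₂ (measurable_residual A _) (hD _)).sub
        (((measurable_dotProduct₂ (hD _) (hD _)).const_mul _).div_const _)))
  · intro i j hij p
    simp only [hφ]
    rw [residual_cut A p (by omega), hcut _ _ (by omega)]
  · intro F hF i
    refine hM.lintegral_mul_le (n₀ + i) hF
      (g := fun p z => ENNReal.ofReal (Real.exp ((sqrtm S *ᵥ z (n₀ + i)) ⬝ᵥ D (n₀ + i) p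
      - (κ : ℝ) ^ 2 * lamMax S * (D (n₀ + i) p ⬝ᵥ D (n₀ + i) p) / 2))) ?_ ?_ ?_
    · have h1 : Measurable fun a : (ℤ → Fin N → ℝ) × (ℤ → Fin N → ℝ) => D (n₀ + i) a.1 :=
        (hD _).comp measurable_fst
      have h2 : Measurable fun a : (ℤ → Fin N → ℝ) × (ℤ → Fin N → ℝ) => sqrtm S *ᵥ a.2 (n₀ + i) :=
        (measurable_mulVec _).comp ((measurable_pi_apply _).comp measurable_snd)
      exact ENNReal.measurable_ofReal.comp (Real.measurable_exp.comp
        ((measurable_dotProduct₂ h2 h1).sub (((measurable_dotProduct₂ h1 h1).const_mul _).div_const _)))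
    · intro p
      simp only [tailFrom_of_le _ (le_refl _), Real.exp_sub]
      have h1 := hM.noise.lintegral_exp_sum_modelError_le hM.posDef.posSemidef
        (fun _ => D (n₀ + i) p) 1 (n₀ + i)
      simp only [Finset.range_one, Finset.sum_singleton, Nat.cast_zero, sub_zero] at h1
      have h2 : ∀ ω, ENNReal.ofReal (Real.exp ((sqrtm S *ᵥ ξ (n₀ + i) ω) ⬝ᵥ D (n₀ + i) p) /
          Real.exp ((κ : ℝ) ^ 2 * lamMax S * (D (n₀ + i) p ⬝ᵥ D (n₀ + i) p) / 2))
          = ENNReal.ofReal (Real.exp (D (n₀ + i) p ⬝ᵥ modelError S ξ (n₀ + i) ω)) /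
            ENNReal.ofReal (Real.exp
              ((κ : ℝ) ^ 2 * lamMax S * (D (n₀ + i) p ⬝ᵥ D (n₀ + i) p) / 2)) := by
        intro ω
        rw [ENNReal.ofReal_div_of_pos (Real.exp_pos _), dotProduct_comm, modelError]
      simp only [h2, ENNReal.div_eq_inv_mul]
      rw [lintegral_const_mul' _ _ (ENNReal.inv_ne_top.2 (by simp [Real.exp_pos])),
        ← ENNReal.div_eq_inv_mul]
      exact ENNReal.div_le_of_le_mul (by rwa [one_mul])
    · filter_upwards [hM.modelError_eq] with ω hω
      simp only [hφ]
      rw [hω, hcut _ _ le_rfl, tailFrom_of_le _ le_rfl, modelError]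

lemma measure_residual_le (hM : IsStableVARModel μ κ A S ξ y) (hκ : 0 < κ)
    {D : ℤ → (ℤ → Fin N → ℝ) → Fin N → ℝ} (hD : ∀ n, Measurable (D n))
    (hcut : ∀ n k, n ≤ k → ∀ p, D n (cut k p) = D n p) (n₀ : ℤ) (M : ℕ) {τ V : ℝ} (hτ : 0 ≤ τ)
    (hV : 0 < V) :
    μ {ω | τ ≤ ∑ i ∈ Finset.range M,
        residual A (fun k => y k ω) (n₀ + i) ⬝ᵥ D (n₀ + i) (fun k => y k ω) ∧
      ∑ i ∈ Finset.range M, D (n₀ + i) (fun k => y k ω) ⬝ᵥ D (n₀ + i) (fun k => y k ω) ≤ V}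
      ≤ ENNReal.ofReal (Real.exp (-(τ ^ 2 / (2 * (κ : ℝ) ^ 2 * lamMax S * V)))) := by
  have hl : 0 < lamMax S := (lamMin_pos hM.N_pos hM.posDef).trans_le
    (lamMin_le_lamMax hM.N_pos hM.posDef.1)
  have hκ' : (0 : ℝ) < κ := hκ
  set l : ℝ := τ / ((κ : ℝ) ^ 2 * lamMax S * V) with hld
  have hl0 : 0 ≤ l := by positivity
  have h := hM.lintegral_exp_residual_le (D := fun n p => l • D n p) (fun n => (hD n).const_smul l)
    (fun n k hk p => by rw [hcut n k hk]) n₀ M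
  have h1 : (1 : ENNReal) = ENNReal.ofReal (Real.exp 0) := by simp
  rw [h1] at h
  have hm : ∀ n, Measurable fun ω => D n (fun k => y k ω) := fun n =>
    (hD n).comp hM.measurable_path
  refine (measure_le_of_lintegral_exp_le (t := τ ^ 2 / (2 * (κ : ℝ) ^ 2 * lamMax S * V))
    ?_ ?_ h).trans (by rw [zero_sub])
  · refine Finset.measurable_fun_sum _ fun i _ => ?_
    have h2 : Measurable fun ω => l • D (n₀ + i) (fun k => y k ω) := (hm _).const_smul l
    exact (measurable_dotProduct₂ ((measurable_residual A _).comp hM.measurable_path) h2).sub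
      (((measurable_dotProduct₂ h2 h2).const_mul _).div_const _)
  · rintro ω ⟨ha, hb⟩
    have e : ∑ i ∈ Finset.range M,
      (residual A (fun k => y k ω) (n₀ + i) ⬝ᵥ (l • D (n₀ + i) (fun k => y k ω))
        - (κ : ℝ) ^ 2 * lamMax S *
          ((l • D (n₀ + i) (fun k => y k ω)) ⬝ᵥ (l • D (n₀ + i) (fun k => y k ω))) / 2)
      = l * (∑ i ∈ Finset.range M,
        residual A (fun k => y k ω) (n₀ + i) ⬝ᵥ D (n₀ + i) (fun k => y k ω))
        - (κ : ℝ) ^ 2 * lamMax S * l ^ 2 / 2 * ∑ i ∈ Finset.range M,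
          D (n₀ + i) (fun k => y k ω) ⬝ᵥ D (n₀ + i) (fun k => y k ω) := by
      rw [Finset.mul_sum, Finset.mul_sum, ← Finset.sum_sub_distrib]
      refine Finset.sum_congr rfl fun i _ => ?_
      simp only [dotProduct_smul, smul_dotProduct, smul_eq_mul]
      ring
    rw [e]
    have e2 : τ ^ 2 / (2 * (κ : ℝ) ^ 2 * lamMax S * V)
        = l * τ - (κ : ℝ) ^ 2 * lamMax S * l ^ 2 / 2 * V := by
      rw [hld]; field_simp; ring
    rw [e2]
    gcongr

end IsStableVARModel

end chain


/-! ### Sums over residue classes -/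

lemma sum_range_mul_eq {M : Type*} [AddCommMonoid M] (f : ℕ → M) (m P : ℕ) :
    ∑ k ∈ Finset.range (m * P), f k
      = ∑ i ∈ Finset.range m, ∑ j ∈ Finset.range P, f (i * P + j) := by
  induction m with
  | zero => simp
  | succ m ih => rw [Nat.succ_mul, Finset.sum_range_add, ih, Finset.sum_range_succ]

lemma sum_Icc_eq_sum_range (f : ℤ → ℝ) {P T : ℕ} (h : P ≤ T) :
    ∑ n ∈ Finset.Icc ((P : ℤ) + 1) T, f n = ∑ k ∈ Finset.range (T - P), f (P + 1 + k) := by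
  refine (Finset.sum_bij (fun k _ => (P : ℤ) + 1 + (k : ℕ)) ?_ ?_ ?_ ?_).symm
  · intro k hk; rw [Finset.mem_range] at hk; rw [Finset.mem_Icc]; omega
  · intro a _ b _ hab; omega
  · intro n hn; rw [Finset.mem_Icc] at hn
    exact ⟨(n - P - 1).toNat, by rw [Finset.mem_range]; omega, by omega⟩
  · intro k _; rfl

lemma sum_Icc_eq_sum_range' (f : ℤ → ℝ) {P T : ℕ} (h : P ≤ T) :
    ∑ n ∈ Finset.Icc ((P : ℤ) + 1) T, f n = ∑ k ∈ Finset.range (T - P), f (T - k) := by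
  refine (Finset.sum_bij (fun k _ => (T : ℤ) - (k : ℕ)) ?_ ?_ ?_ ?_).symm
  · intro k hk; rw [Finset.mem_range] at hk; rw [Finset.mem_Icc]; omega
  · intro a _ b _ hab; omega
  · intro n hn; rw [Finset.mem_Icc] at hn
    exact ⟨(T - n).toNat, by rw [Finset.mem_range]; omega, by omega⟩
  · intro k _; rfl

lemma sum_classes_le_sum_Icc {f : ℤ → ℝ} (hf : ∀ n, 0 ≤ f n) {P T M : ℕ} (h : (M + 1) * P ≤ T) :
    ∑ j ∈ Finset.range P, ∑ i ∈ Finset.range M, f (P + 1 + j + i * P)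
      ≤ ∑ n ∈ Finset.Icc ((P : ℤ) + 1) T, f n := by
  rw [Nat.succ_mul] at h
  rw [sum_Icc_eq_sum_range f (by omega), Finset.sum_comm]
  calc _ = ∑ k ∈ Finset.range (M * P), f (P + 1 + k) := by
        rw [sum_range_mul_eq]
        refine Finset.sum_congr rfl fun i _ => Finset.sum_congr rfl fun j _ => ?_
        congr 1; push_cast; ring
    _ ≤ _ := Finset.sum_le_sum_of_subset_of_nonneg
        (Finset.range_subset_range.2 (by omega)) fun k _ _ => hf _

lemma sum_Icc_le_sum_classes {f : ℤ → ℝ} (hf : ∀ n, 0 ≤ f n) {P T M : ℕ} (hPT : P ≤ T)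
    (h : T ≤ (M + 1) * P) :
    ∑ n ∈ Finset.Icc ((P : ℤ) + 1) T, f n
      ≤ ∑ j ∈ Finset.range P, ∑ i ∈ Finset.range M, f (T - j - i * P) := by
  rw [Nat.succ_mul] at h
  rw [sum_Icc_eq_sum_range' f hPT, Finset.sum_comm]
  calc _ ≤ ∑ k ∈ Finset.range (M * P), f (T - k) := Finset.sum_le_sum_of_subset_of_nonneg
        (Finset.range_subset_range.2 (by omega)) fun k _ _ => hf _
    _ = _ := by
        rw [sum_range_mul_eq]
        refine Finset.sum_congr rfl fun i _ => Finset.sum_congr rfl fun j _ => ?_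
        congr 1; push_cast; ring

/-! ### Linear functionals of the predictor -/

section lag

variable {N P : ℕ}

/-- The coefficient of lag `k + 1` in a linear functional of the predictor. -/
def lagWeight (v : Fin P × Fin N → ℝ) (k : ℕ) : Fin N → ℝ :=
  fun i => if h : k < P then v (⟨k, h⟩, i) else 0

lemma dotProduct_predictor (v : Fin P × Fin N → ℝ) (p : ℤ → Fin N → ℝ) (n : ℤ) :
    v ⬝ᵥ predictor P p n = ∑ k ∈ Finset.range P, lagWeight v k ⬝ᵥ p (n - 1 - k) := by
  rw [Finset.sum_range, dotProduct, Fintype.sum_prod_type]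
  refine Finset.sum_congr rfl fun k _ => Finset.sum_congr rfl fun i _ => ?_
  simp [lagWeight, predictor]

lemma sum_lagWeight_sq (v : Fin P × Fin N → ℝ) :
    ∑ k ∈ Finset.range P, lagWeight v k ⬝ᵥ lagWeight v k = v ⬝ᵥ v := by
  rw [Finset.sum_range, dotProduct, Fintype.sum_prod_type]
  refine Finset.sum_congr rfl fun k _ => Finset.sum_congr rfl fun i _ => ?_
  simp [lagWeight]

/-- A linear functional of the predictor splits into a functional of the last `P` residuals and
one of the earlier past. -/
lemma exists_residual_representation (A : Tensor N N P) (hN : 0 < N) (v : Fin P × Fin N → ℝ) :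
    ∃ u r : ℕ → Fin N → ℝ, (∀ p n, v ⬝ᵥ predictor P p n
      = ∑ k ∈ Finset.range P, u k ⬝ᵥ residual A p (n - 1 - k)
        + ∑ i ∈ Finset.range P, r i ⬝ᵥ p (n - 1 - (P + i : ℕ))) ∧
      v ⬝ᵥ v ≤ muMax A * ∑ k ∈ Finset.range P, u k ⬝ᵥ u k := by
  set W := lagWeight v with hW
  refine ⟨dualSol A W, fun i => -adjointFilter A (trunc P (dualSol A W)) (P + i), ?_, ?_⟩
  · intro p n
    rw [dotProduct_predictor, sum_dotProduct_residual_dualSol, add_assoc, ← Finset.sum_add_distrib]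
    simp [hW]
  · have h := sum_le_muMax_mul A hN (trunc P (dualSol A W)) (n := P) fun k hk => trunc_of_le _ hk
    rw [Finset.sum_congr (s₁ := Finset.range P) (g := fun k => dualSol A W k ⬝ᵥ dualSol A W k) rfl
      fun k hk => by rw [trunc_of_lt _ (Finset.mem_range.1 hk)]] at h
    refine le_trans ?_ h
    rw [Finset.sum_range_add, ← sum_lagWeight_sq]
    refine le_trans (le_of_eq ?_) (le_add_of_nonneg_right
      (Finset.sum_nonneg fun k _ => dotProduct_self_nonneg' _))
    refine Finset.sum_congr rfl fun k hk => ?_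
    rw [adjointFilter_trunc_dualSol A W (Finset.mem_range.1 hk)]

end lag

section tails

variable {Ω : Type*} {mΩ : MeasurableSpace Ω} {μ : Measure Ω} [IsProbabilityMeasure μ]
  {N P : ℕ} {κ : ℝ≥0} {A : Tensor N N P} {S : Matrix (Fin N) (Fin N) ℝ}
  {ξ y : ℤ → Ω → Fin N → ℝ}

lemma IsSubGaussianNoise.lintegral_exp_neg_sq_le (hξ : IsSubGaussianNoise μ κ ξ) (hκ : 1 ≤ κ)
    (S : Matrix (Fin N) (Fin N) ℝ) (u : ℕ → Fin N → ℝ) (J : ℕ) (t : ℤ) {s : ℝ} (hs : 0 < s)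
    (hu : ∑ k ∈ Finset.range J, (sqrtm S *ᵥ u k) ⬝ᵥ (sqrtm S *ᵥ u k) = s) (a : ℝ) :
    ∫⁻ ω, ENNReal.ofReal (Real.exp (-((196 * (κ : ℝ) ^ 3 * s)⁻¹ *
      (a + ∑ k ∈ Finset.range J, u k ⬝ᵥ modelError S ξ (t - k) ω) ^ 2))) ∂μ
      ≤ ENNReal.ofReal (Real.exp (-(784 * (κ : ℝ) ^ 3)⁻¹)) := by
  set f : ℕ ↪ ℤ := ⟨fun k => t - k, fun a b h => by simpa using h⟩ with hf
  set v : ℤ → Fin N → ℝ := fun k => sqrtm S *ᵥ u (t - k).toNat with hv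
  have hsum : ∀ ω, ∑ k ∈ (Finset.range J).map f, v k ⬝ᵥ ξ k ω
      = ∑ k ∈ Finset.range J, u k ⬝ᵥ modelError S ξ (t - k) ω := by
    intro ω
    rw [Finset.sum_map]
    refine Finset.sum_congr rfl fun k _ => ?_
    rw [modelError, dotProduct_sqrtm_mulVec]
    change (sqrtm S *ᵥ u (t - (t - k)).toNat) ⬝ᵥ ξ (t - k) ω = _
    simp
  have hsq : ∑ k ∈ (Finset.range J).map f, v k ⬝ᵥ v k = s := by
    rw [Finset.sum_map, ← hu]
    refine Finset.sum_congr rfl fun k _ => ?_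
    change (sqrtm S *ᵥ u (t - (t - k)).toNat) ⬝ᵥ (sqrtm S *ᵥ u (t - (t - k)).toNat) = _
    simp
  have h1 := hξ.hasSubgaussianMGF_sum ((Finset.range J).map f) v
  have h2 := hξ.integral_sum ((Finset.range J).map f) v
  have h3 := hξ.integral_sum_sq ((Finset.range J).map f) v
  simp only [hsum, hsq] at h1 h2 h3
  have h4 := integral_exp_neg_sq_le h1 (k := κ) (s := s) (by exact_mod_cast hκ) hs
    (by rw [NNReal.coe_mul, Real.coe_toNNReal _ hs.le]; push_cast; rfl) h2 h3 a
  rw [← ofReal_integral_eq_lintegral_ofReal ?_ (ae_of_all _ fun _ => (Real.exp_pos _).le)]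
  · exact ENNReal.ofReal_le_ofReal h4
  · refine Integrable.of_bound (C := 1) ?_ (ae_of_all _ fun ω => ?_)
    · have hm := h1.aemeasurable
      exact (Real.measurable_exp.comp_aemeasurable
        (((hm.const_add a).pow_const 2).const_mul _).neg).aestronglyMeasurable
    · rw [Real.norm_of_nonneg (Real.exp_pos _).le, Real.exp_le_one_iff]
      have : (0 : ℝ) ≤ κ := κ.2
      simp only [Left.neg_nonpos_iff]
      positivity

namespace IsStableVARModel

/-- Lower tail of the energy of a shifted linear functional along one residue class. -/
lemma measure_class_sum_sq_le (hM : IsStableVARModel μ κ A S ξ y) (hκ : 1 ≤ κ)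
    {v : Fin P × Fin N → ℝ} (hv : 0 < v ⬝ᵥ v) (a : ℤ → ℝ) (n₀ : ℤ) (M : ℕ) :
    μ {ω | ∑ i ∈ Finset.range M,
      (v ⬝ᵥ predictor P (fun k => y k ω) (n₀ + i * P) + a (n₀ + i * P)) ^ 2
        ≤ M * (kappaL A S * (v ⬝ᵥ v) / 8)}
      ≤ ENNReal.ofReal (Real.exp (-(M / (1568 * (κ : ℝ) ^ 3)))) := by
  obtain ⟨u, r, hrep, hvu⟩ := exists_residual_representation A hM.N_pos v
  set s : ℝ := ∑ k ∈ Finset.range P, (sqrtm S *ᵥ u k) ⬝ᵥ (sqrtm S *ᵥ u k) with hs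
  have hmu : 0 < muMax A := zero_lt_one.trans_le (one_le_muMax A hM.N_pos)
  have hvs : kappaL A S * (v ⬝ᵥ v) ≤ s := by
    have h1 : lamMin S * ∑ k ∈ Finset.range P, u k ⬝ᵥ u k ≤ s := by
      rw [Finset.mul_sum]
      exact Finset.sum_le_sum fun k _ => le_sqrtm_dotProduct hM.posDef.posSemidef (u k)
    refine le_trans ?_ h1
    rw [kappaL, div_mul_eq_mul_div, div_le_iff₀ hmu, mul_assoc, mul_comm _ (muMax A)]
    have := (lamMin_pos hM.N_pos hM.posDef).le
    gcongr
  have hs0 : 0 < s := (mul_pos hM.kappaL_pos hv).trans_le hvs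
  have hκ0 : (1 : ℝ) ≤ κ := by exact_mod_cast hκ
  have hκ1 : (0 : ℝ) < κ := by linarith
  set l : ℝ := (196 * (κ : ℝ) ^ 3 * s)⁻¹ with hl
  set φ : ℕ → (ℤ → Fin N → ℝ) → ENNReal := fun i p => ENNReal.ofReal (Real.exp
    (-(l * (v ⬝ᵥ predictor P p (n₀ + i * P) + a (n₀ + i * P)) ^ 2))) with hφ
  have hpm : ∀ n, Measurable fun p : ℤ → Fin N → ℝ => v ⬝ᵥ predictor P p n := by
    intro n; unfold dotProduct predictor; fun_prop
  have h := lintegral_prod_le_pow (μ := μ) (Y := fun ω k => y k ω) (φ := φ)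
    (n := fun i => n₀ + i * P - P)
    (q := ENNReal.ofReal (Real.exp (-(784 * (κ : ℝ) ^ 3)⁻¹))) ?_ ?_ ?_ M
  · have h2 : ∫⁻ ω, ENNReal.ofReal (Real.exp (∑ i ∈ Finset.range M,
        -(l * (v ⬝ᵥ predictor P (fun k => y k ω) (n₀ + i * P) + a (n₀ + i * P)) ^ 2))) ∂μ
        ≤ ENNReal.ofReal (Real.exp (M * -(784 * (κ : ℝ) ^ 3)⁻¹)) := by
      rw [Real.exp_nat_mul, ENNReal.ofReal_pow (Real.exp_pos _).le]
      refine le_trans (le_of_eq (lintegral_congr fun ω => ?_)) h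
      rw [Real.exp_sum, ENNReal.ofReal_prod_of_nonneg fun _ _ => (Real.exp_pos _).le]
    refine (measure_le_of_lintegral_exp_le (t := -(l * (M * (s / 8)))) ?_ ?_ h2).trans
      (ENNReal.ofReal_le_ofReal (Real.exp_le_exp.2 (le_of_eq ?_)))
    · refine Finset.measurable_fun_sum _ fun i _ => ?_
      exact (((((hpm _).comp hM.measurable_path).add_const _).pow_const 2).const_mul _).neg
    · intro ω hω
      rw [Finset.sum_neg_distrib, ← Finset.mul_sum, neg_le_neg_iff]
      have hl0 : 0 ≤ l := by positivity
      refine mul_le_mul_of_nonneg_left (le_trans hω ?_) hl0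
      gcongr
    · rw [hl]; field_simp; ring
  · intro i
    exact ENNReal.measurable_ofReal.comp (Real.measurable_exp.comp
      ((((hpm _).add_const _).pow_const 2).const_mul _).neg)
  · intro i j hij p
    simp only [hφ]
    rw [predictor_cut]
    have : ((i : ℤ) + 1) * P ≤ j * P := by gcongr; omega
    linarith
  · intro F hF i
    refine hM.lintegral_mul_le (n₀ + i * P - P) hF (g := fun p z => ENNReal.ofReal (Real.exp
      (-(l * ((∑ m ∈ Finset.range P, r m ⬝ᵥ p (n₀ + i * P - 1 - (P + m : ℕ)) + a (n₀ + i * P))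
        + ∑ k ∈ Finset.range P, u k ⬝ᵥ (sqrtm S *ᵥ z (n₀ + i * P - 1 - k))) ^ 2)))) ?_ ?_ ?_
    · unfold Function.uncurry Matrix.mulVec dotProduct
      fun_prop
    · intro p
      refine le_trans (le_of_eq (lintegral_congr fun ω => ?_)) (hM.noise.lintegral_exp_neg_sq_le hκ
        S u P (n₀ + i * P - 1) hs0 hs.symm
        (∑ m ∈ Finset.range P, r m ⬝ᵥ p (n₀ + i * P - 1 - (P + m : ℕ)) + a (n₀ + i * P)))
      congr 6
      refine Finset.sum_congr rfl fun k hk => ?_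
      have := Finset.mem_range.1 hk
      rw [tailFrom_of_le _ (by omega), modelError]
    · filter_upwards [hM.modelError_eq] with ω hω
      simp only [hφ, hrep, hω]
      congr 4
      have e1 : ∑ m ∈ Finset.range P, r m ⬝ᵥ (cut (n₀ + i * P - P) fun k => y k ω)
            (n₀ + i * P - 1 - (P + m : ℕ))
          = ∑ m ∈ Finset.range P, r m ⬝ᵥ y (n₀ + i * P - 1 - (P + m : ℕ)) ω := by
        refine Finset.sum_congr rfl fun m hm => ?_
        rw [cut_of_lt _ (by push_cast; omega)]
      have e2 : ∑ k ∈ Finset.range P, u k ⬝ᵥ (sqrtm S *ᵥ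
            (tailFrom (n₀ + i * P - P) fun k => ξ k ω) (n₀ + i * P - 1 - k))
          = ∑ k ∈ Finset.range P, u k ⬝ᵥ modelError S ξ (n₀ + i * P - 1 - k) ω := by
        refine Finset.sum_congr rfl fun k hk => ?_
        have := Finset.mem_range.1 hk
        rw [tailFrom_of_le _ (by omega), modelError]
      rw [e1, e2]
      ring

/-- Lower tail of the energy of a shifted linear functional of the predictors. -/
lemma measure_sum_sq_le (hM : IsStableVARModel μ κ A S ξ y) (hκ : 1 ≤ κ)
    {v : Fin P × Fin N → ℝ} (hv : 0 < v ⬝ᵥ v) (a : ℤ → ℝ) {M T : ℕ} (hMT : (M + 1) * P ≤ T) :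
    μ {ω | ∑ n ∈ Finset.Icc ((P : ℤ) + 1) T, (v ⬝ᵥ predictor P (fun k => y k ω) n + a n) ^ 2
        ≤ P * (M * (kappaL A S * (v ⬝ᵥ v) / 8))}
      ≤ ENNReal.ofReal (P * Real.exp (-(M / (1568 * (κ : ℝ) ^ 3)))) := by
  set E : ℕ → Set Ω := fun j => {ω | ∑ i ∈ Finset.range M,
      (v ⬝ᵥ predictor P (fun k => y k ω) (P + 1 + j + i * P) + a (P + 1 + j + i * P)) ^ 2
        ≤ M * (kappaL A S * (v ⬝ᵥ v) / 8)} with hE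
  have hsub : {ω | ∑ n ∈ Finset.Icc ((P : ℤ) + 1) T,
      (v ⬝ᵥ predictor P (fun k => y k ω) n + a n) ^ 2 ≤ P * (M * (kappaL A S * (v ⬝ᵥ v) / 8))}
      ⊆ ⋃ j ∈ Finset.range P, E j := by
    intro ω hω
    simp only [Set.mem_iUnion, exists_prop]
    by_contra! hcon
    have h1 := sum_classes_le_sum_Icc
      (f := fun n => (v ⬝ᵥ predictor P (fun k => y k ω) n + a n) ^ 2) (fun _ => sq_nonneg _) hMT
    have h2 : ∑ j ∈ Finset.range P, M * (kappaL A S * (v ⬝ᵥ v) / 8)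
        < ∑ j ∈ Finset.range P, ∑ i ∈ Finset.range M,
          (v ⬝ᵥ predictor P (fun k => y k ω) (P + 1 + j + i * P) + a (P + 1 + j + i * P)) ^ 2 := by
      refine Finset.sum_lt_sum_of_nonempty (by simpa using hM.P_pos.ne') fun j hj => ?_
      have := hcon j hj
      simp only [hE, Set.mem_ofPred_eq, not_le] at this
      exact this
    rw [Finset.sum_const, Finset.card_range, nsmul_eq_mul] at h2
    exact absurd (h2.trans_le (h1.trans hω)) (lt_irrefl _)
  refine (measure_mono hsub).trans ((measure_biUnion_finset_le _ _).trans ?_)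
  refine (Finset.sum_le_sum fun j _ => hM.measure_class_sum_sq_le hκ hv a (P + 1 + (j : ℕ)) M).trans ?_
  rw [Finset.sum_const, Finset.card_range, nsmul_eq_mul, ENNReal.ofReal_mul (by positivity),
    ENNReal.ofReal_natCast]

end IsStableVARModel

end tails


lemma five_pow_le_exp (n : ℕ) : (5 : ℝ) ^ n ≤ Real.exp (2 * n) := by
  rw [mul_comm, Real.exp_nat_mul]
  gcongr
  have h := Real.exp_one_gt_d9
  have : Real.exp 2 = Real.exp 1 ^ 2 := by rw [← Real.exp_nat_mul]; norm_num
  rw [this]; nlinarith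

lemma dotProduct_self_le_sq_of_forall {ι : Type*} [Fintype ι] {b : ι → ℝ} {c : ℝ}
    (h : ∀ g : ι → ℝ, g ⬝ᵥ g ≤ 1 → g ⬝ᵥ b ≤ c) : b ⬝ᵥ b ≤ c ^ 2 := by
  rcases (dotProduct_self_nonneg' b).eq_or_lt with h0 | h0
  · rw [← h0]; positivity
  have hs : 0 < Real.sqrt (b ⬝ᵥ b) := Real.sqrt_pos.2 h0
  have hss : Real.sqrt (b ⬝ᵥ b) * Real.sqrt (b ⬝ᵥ b) = b ⬝ᵥ b := Real.mul_self_sqrt h0.le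
  have h1 := h ((Real.sqrt (b ⬝ᵥ b))⁻¹ • b) (by
    rw [smul_dotProduct, dotProduct_smul, smul_eq_mul, smul_eq_mul, ← mul_assoc, ← mul_inv, hss,
      inv_mul_cancel₀ h0.ne'])
  rw [smul_dotProduct, smul_eq_mul, inv_mul_le_iff₀ hs] at h1
  have h2 : Real.sqrt (b ⬝ᵥ b) ≤ c := by
    refine le_of_mul_le_mul_left ?_ hs
    rwa [hss]
  rw [← Real.sq_sqrt h0.le]
  gcongr

/-- Nets for the seminorm `v ↦ ‖Φ v‖`. -/
lemma exists_net_of_linearMap {V E : Type*} [AddCommGroup V] [Module ℝ V] [FiniteDimensional ℝ V]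
    [NormedAddCommGroup E] [InnerProductSpace ℝ E] (Φ : V →ₗ[ℝ] E) (k : ℕ) :
    ∃ s : Finset V, s.card ≤ 5 ^ (Module.finrank ℝ V * k) ∧
      ∀ v, ‖Φ v‖ ≤ 1 → ∃ w ∈ s, ‖Φ (v - w)‖ ≤ (1 / 2) ^ k := by
  classical
  obtain ⟨s, hs, h⟩ := exists_pow_net (LinearMap.range Φ) k
  choose f hf using fun x : LinearMap.range Φ => LinearMap.mem_range.1 x.2
  refine ⟨s.image f, Finset.card_image_le.trans (hs.trans ?_), fun v hv => ?_⟩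
  · exact Nat.pow_le_pow_right (by norm_num) (Nat.mul_le_mul_right _ Φ.finrank_range_le)
  · obtain ⟨x, hx, hvx⟩ := h ⟨Φ v, LinearMap.mem_range_self Φ v⟩ hv
    refine ⟨f x, Finset.mem_image_of_mem f hx, ?_⟩
    rw [map_sub, hf]
    exact hvx

section tails

variable {Ω : Type*} {mΩ : MeasurableSpace Ω} {μ : Measure Ω} [IsProbabilityMeasure μ]
  {N P : ℕ} {κ : ℝ≥0} {A : Tensor N N P} {S : Matrix (Fin N) (Fin N) ℝ}
  {ξ y : ℤ → Ω → Fin N → ℝ}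

namespace IsStableVARModel

/-- Bilinear forms in the predictors of one residue class are sub-Gaussian. -/
lemma measure_bilinear_le (hM : IsStableVARModel μ κ A S ξ y) (hκ : 0 < κ)
    {v : Fin P × Fin N → ℝ} (hv : v ⬝ᵥ v ≤ 1) {M : ℕ} {g : Fin M → ℝ} (hg : g ⬝ᵥ g ≤ 1) (t : ℤ)
    {τ : ℝ} (hτ : 0 ≤ τ) :
    μ {ω | τ ≤ ∑ a, g a * (v ⬝ᵥ predictor P (fun k => y k ω) (t - a * P))}
      ≤ ENNReal.ofReal (Real.exp (-(τ ^ 2 / (2 * (κ : ℝ) ^ 2 * kappaU A S)))) := by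
  have hκ' : (0 : ℝ) < κ := hκ
  have hU := hM.kappaU_pos
  set l : ℝ := τ / ((κ : ℝ) ^ 2 * kappaU A S) with hl
  have hl0 : 0 ≤ l := by positivity
  set g' : ℕ → ℝ := fun a => if h : a < M then g ⟨a, h⟩ else 0 with hg'
  set W : ℕ → Fin N → ℝ := fun k => (l * g' (k / P)) • lagWeight v (k % P) with hW
  have hdiv : ∀ i j, j < P → (i * P + j) / P = i ∧ (i * P + j) % P = j := by
    intro i j hj
    refine ⟨?_, ?_⟩
    · rw [add_comm, Nat.add_mul_div_right _ _ hM.P_pos, Nat.div_eq_of_lt hj, zero_add]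
    · rw [add_comm, Nat.add_mul_mod_self_right, Nat.mod_eq_of_lt hj]
  have e1 : ∀ p : ℤ → Fin N → ℝ, ∑ k ∈ Finset.range (M * P), W k ⬝ᵥ p (t - 1 - k)
      = l * ∑ a, g a * (v ⬝ᵥ predictor P p (t - a * P)) := by
    intro p
    rw [sum_range_mul_eq, Finset.sum_range, Finset.mul_sum]
    refine Finset.sum_congr rfl fun a _ => ?_
    rw [dotProduct_predictor, Finset.mul_sum, Finset.mul_sum]
    refine Finset.sum_congr rfl fun j hj => ?_
    obtain ⟨h1, h2⟩ := hdiv a j (Finset.mem_range.1 hj)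
    simp only [hW, h1, h2, hg', a.2, dite_true, smul_dotProduct, smul_eq_mul, mul_assoc]
    congr 4
    push_cast; ring
  have e2 : ∑ k ∈ Finset.range (M * P), W k ⬝ᵥ W k ≤ l ^ 2 := by
    have : ∑ k ∈ Finset.range (M * P), W k ⬝ᵥ W k = l ^ 2 * ((g ⬝ᵥ g) * (v ⬝ᵥ v)) := by
      rw [sum_range_mul_eq, Finset.sum_range, dotProduct, Finset.sum_mul, Finset.mul_sum]
      refine Finset.sum_congr rfl fun a _ => ?_
      rw [← sum_lagWeight_sq, Finset.mul_sum, Finset.mul_sum]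
      refine Finset.sum_congr rfl fun j hj => ?_
      obtain ⟨h1, h2⟩ := hdiv a j (Finset.mem_range.1 hj)
      simp only [hW, h1, h2, hg', a.2, dite_true, smul_dotProduct, dotProduct_smul, smul_eq_mul]
      ring
    rw [this]
    refine mul_le_of_le_one_right (sq_nonneg _) (mul_le_one₀ hg (dotProduct_self_nonneg' v) hv)
  have h := hM.stationaryVAR.lintegral_exp_le hM.posDef hM.noise hM.P_pos hM.N_pos hM.stable
    hM.muMin_pos W (M * P) (t - 1)
  refine (measure_le_of_lintegral_exp_le (t := l * τ) ?_ ?_ h).trans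
    (ENNReal.ofReal_le_ofReal (Real.exp_le_exp.2 ?_))
  · exact Finset.measurable_fun_sum _ fun k _ =>
      (measurable_dotProduct _).comp (hM.stationaryVAR.measurable _)
  · intro ω hω
    rw [e1 fun k => y k ω]
    exact mul_le_mul_of_nonneg_left hω hl0
  · have h3 : (κ : ℝ) ^ 2 * kappaU A S * (∑ k ∈ Finset.range (M * P), W k ⬝ᵥ W k) / 2
        ≤ (κ : ℝ) ^ 2 * kappaU A S * l ^ 2 / 2 := by gcongr
    refine (sub_le_sub_right h3 _).trans (le_of_eq ?_)
    rw [hl]; field_simp; ring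

/-- Upper tail of the energy of all linear functionals along one residue class. -/
lemma measure_class_lt_sum_sq (hM : IsStableVARModel μ κ A S ξ y) (hκ : 0 < κ) (M : ℕ) (t : ℤ)
    {τ : ℝ} (hτ : 0 ≤ τ) :
    μ {ω | ∃ v : Fin P × Fin N → ℝ, v ⬝ᵥ v ≤ 1 ∧ (4 * τ) ^ 2
      < ∑ a ∈ Finset.range M, (v ⬝ᵥ predictor P (fun k => y k ω) (t - a * P)) ^ 2}
      ≤ ENNReal.ofReal (5 ^ (P * N + M)
        * Real.exp (-(τ ^ 2 / (2 * (κ : ℝ) ^ 2 * kappaU A S)))) := by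
  obtain ⟨S₁, hS₁, hS₁', hnet₁⟩ := exists_dotProduct_net (Fin P × Fin N)
  obtain ⟨S₂, hS₂, hS₂', hnet₂⟩ := exists_dotProduct_net (Fin M)
  rw [Fintype.card_prod, Fintype.card_fin, Fintype.card_fin] at hS₁
  rw [Fintype.card_fin] at hS₂
  set E : (Fin P × Fin N → ℝ) × (Fin M → ℝ) → Set Ω := fun q =>
    {ω | τ ≤ ∑ a, q.2 a * (q.1 ⬝ᵥ predictor P (fun k => y k ω) (t - a * P))} with hE
  refine (measure_mono (t := ⋃ q ∈ S₁ ×ˢ S₂, E q) ?_).trans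
    ((measure_biUnion_finset_le _ _).trans ?_)
  · rintro ω ⟨v, hv, hlt⟩
    simp only [Set.mem_iUnion, exists_prop]
    by_contra! hcon
    have h1 : ∀ w ∈ S₁, ∀ g ∈ S₂,
        ∑ a, g a * (w ⬝ᵥ predictor P (fun k => y k ω) (t - a * P)) ≤ τ := by
      intro w hw g hg
      have := hcon (w, g) (Finset.mem_product.2 ⟨hw, hg⟩)
      simp only [hE, Set.mem_ofPred_eq, not_le] at this
      exact this.le
    have h2 : ∀ g ∈ S₂, ∑ a, g a * (v ⬝ᵥ predictor P (fun k => y k ω) (t - a * P)) ≤ 2 * τ := by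
      intro g hg
      let L : (Fin P × Fin N → ℝ) →ₗ[ℝ] ℝ :=
        { toFun := fun w => ∑ a, g a * (w ⬝ᵥ predictor P (fun k => y k ω) (t - a * P))
          map_add' := fun w w' => by simp only [add_dotProduct, mul_add, Finset.sum_add_distrib]
          map_smul' := fun c w => by
            simp only [smul_dotProduct, smul_eq_mul, RingHom.id_apply, Finset.mul_sum]
            exact Finset.sum_congr rfl fun a _ => by ring }
      exact hnet₁ L τ (fun w hw => h1 w hw g hg) v hv
    have h3 : ∀ g : Fin M → ℝ, g ⬝ᵥ g ≤ 1 →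
        g ⬝ᵥ (fun a => v ⬝ᵥ predictor P (fun k => y k ω) (t - a * P)) ≤ 4 * τ := by
      intro g hg
      let L : (Fin M → ℝ) →ₗ[ℝ] ℝ :=
        { toFun := fun g => g ⬝ᵥ (fun a => v ⬝ᵥ predictor P (fun k => y k ω) (t - a * P))
          map_add' := fun w w' => add_dotProduct _ _ _
          map_smul' := fun c w => smul_dotProduct _ _ _ }
      exact (hnet₂ L (2 * τ) (fun g hg => h2 g hg) g hg).trans (le_of_eq (by ring))
    have h4 := dotProduct_self_le_sq_of_forall h3
    rw [Finset.sum_range] at hlt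
    refine absurd (le_trans (le_of_eq ?_) h4) (not_le.2 hlt)
    exact Finset.sum_congr rfl fun a _ => sq _
  · refine (Finset.sum_le_sum (g := fun _ => ENNReal.ofReal
      (Real.exp (-(τ ^ 2 / (2 * (κ : ℝ) ^ 2 * kappaU A S))))) fun q hq => ?_).trans ?_
    · rw [Finset.mem_product] at hq
      exact hM.measure_bilinear_le hκ (hS₁' _ hq.1) (hS₂' _ hq.2) t hτ
    · rw [Finset.sum_const, nsmul_eq_mul, ENNReal.ofReal_mul (by positivity)]
      gcongr
      rw [← ENNReal.ofReal_natCast]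
      refine ENNReal.ofReal_le_ofReal ?_
      have : (S₁ ×ˢ S₂).card ≤ 5 ^ (P * N + M) := by
        rw [Finset.card_product, pow_add]
        exact Nat.mul_le_mul hS₁ hS₂
      exact_mod_cast this

/-- Upper tail of the energy of all linear functionals of the predictors. -/
lemma measure_lt_sum_sq (hM : IsStableVARModel μ κ A S ξ y) (hκ : 0 < κ) {M T : ℕ} (hPT : P ≤ T)
    (hMT : T ≤ (M + 1) * P) {τ : ℝ} (hτ : 0 ≤ τ) :
    μ {ω | ∃ v : Fin P × Fin N → ℝ, P * (4 * τ) ^ 2 * (v ⬝ᵥ v)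
      < ∑ n ∈ Finset.Icc ((P : ℤ) + 1) T, (v ⬝ᵥ predictor P (fun k => y k ω) n) ^ 2}
      ≤ ENNReal.ofReal (P * (5 ^ (P * N + M)
        * Real.exp (-(τ ^ 2 / (2 * (κ : ℝ) ^ 2 * kappaU A S))))) := by
  set E : ℕ → Set Ω := fun j => {ω | ∃ v : Fin P × Fin N → ℝ, v ⬝ᵥ v ≤ 1 ∧ (4 * τ) ^ 2
      < ∑ a ∈ Finset.range M, (v ⬝ᵥ predictor P (fun k => y k ω) (T - j - a * P)) ^ 2} with hE
  refine (measure_mono (t := ⋃ j ∈ Finset.range P, E j) ?_).trans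
    ((measure_biUnion_finset_le _ _).trans ?_)
  · rintro ω ⟨v, hlt⟩
    have hv : 0 < v ⬝ᵥ v := by
      refine (dotProduct_self_nonneg' v).lt_of_ne fun h0 => ?_
      have : v = 0 := dotProduct_self_eq_zero.1 h0.symm
      simp [this] at hlt
    have hs : 0 < Real.sqrt (v ⬝ᵥ v) := Real.sqrt_pos.2 hv
    have hss : Real.sqrt (v ⬝ᵥ v) * Real.sqrt (v ⬝ᵥ v) = v ⬝ᵥ v := Real.mul_self_sqrt hv.le
    simp only [Set.mem_iUnion, exists_prop]
    by_contra! hcon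
    have h1 : ∀ j ∈ Finset.range P, ∑ a ∈ Finset.range M,
        (v ⬝ᵥ predictor P (fun k => y k ω) (T - j - a * P)) ^ 2 ≤ (4 * τ) ^ 2 * (v ⬝ᵥ v) := by
      intro j hj
      have h2 := hcon j hj
      simp only [hE, Set.mem_ofPred_eq, not_exists, not_and, not_lt] at h2
      have h3 := h2 ((Real.sqrt (v ⬝ᵥ v))⁻¹ • v) (by
        rw [smul_dotProduct, dotProduct_smul, smul_eq_mul, smul_eq_mul, ← mul_assoc, ← mul_inv,
          hss, inv_mul_cancel₀ hv.ne'])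
      simp only [smul_dotProduct, smul_eq_mul, mul_pow _ (v ⬝ᵥ _), inv_pow, Real.sq_sqrt hv.le,
        ← Finset.mul_sum] at h3
      rw [inv_mul_le_iff₀ hv] at h3
      linarith
    have h4 := sum_Icc_le_sum_classes
      (f := fun n => (v ⬝ᵥ predictor P (fun k => y k ω) n) ^ 2) (fun _ => sq_nonneg _) hPT hMT
    have h5 := h4.trans (Finset.sum_le_sum h1)
    rw [Finset.sum_const, Finset.card_range, nsmul_eq_mul] at h5
    linarith
  · refine (Finset.sum_le_sum fun j _ => hM.measure_class_lt_sum_sq hκ M (T - (j : ℕ)) hτ).trans ?_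
    rw [Finset.sum_const, Finset.card_range, nsmul_eq_mul,
      ENNReal.ofReal_mul (p := (P : ℝ)) (by positivity), ENNReal.ofReal_natCast]

end IsStableVARModel

end tails


/-- If `X` is bounded by `a`, then a lower bound for `X + E` on a finite set that depends only on
`E` and `a` extends to all vectors. -/
lemma exists_net_lower_bound {V F : Type*} [NormedAddCommGroup V] [InnerProductSpace ℝ V]
    [FiniteDimensional ℝ V] [NormedAddCommGroup F] [InnerProductSpace ℝ F] (E : V →ₗ[ℝ] F)
    {a b : ℝ} (ha : 0 < a) (hb : 0 < b) (hba : b ≤ a) (k : ℕ) (hk : 24 * a * (1 / 2) ^ k ≤ b) :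
    ∃ s : Finset V, s.card ≤ 5 ^ (Module.finrank ℝ V * k) ∧ ∀ X : V →ₗ[ℝ] F,
      (∀ v, ‖X v‖ ≤ a * ‖v‖) → (∀ w ∈ s, w ≠ 0 → b * ‖w‖ ≤ ‖X w + E w‖) →
      ∀ v, b / 4 * ‖v‖ ≤ ‖X v + E v‖ := by
  let Φ : V →ₗ[ℝ] WithLp 2 (V × F) :=
    ((3 * a)⁻¹ : ℝ) • ((WithLp.linearEquiv 2 ℝ (V × F)).symm.toLinearMap ∘ₗ
      (a • LinearMap.id).prod E)
  have hΦ : ∀ v, ‖Φ v‖ ^ 2 * (3 * a) ^ 2 = (a * ‖v‖) ^ 2 + ‖E v‖ ^ 2 := by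
    intro v
    have e : Φ v = ((3 * a)⁻¹ : ℝ) • WithLp.toLp 2 (a • v, E v) := rfl
    rw [e, norm_smul, mul_pow, WithLp.prod_norm_sq_eq_of_L2, norm_inv,
      Real.norm_of_nonneg (by positivity : 0 ≤ 3 * a), WithLp.toLp_fst, WithLp.toLp_snd,
      norm_smul, Real.norm_of_nonneg ha.le]
    field_simp
  obtain ⟨s, hs, hnet⟩ := exists_net_of_linearMap Φ k
  refine ⟨s, hs, fun X hX hsX => ?_⟩
  have hunit : ∀ v, ‖v‖ = 1 → b / 4 ≤ ‖X v + E v‖ := by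
    intro v hv
    have hXv := hX v
    rw [hv, mul_one] at hXv
    by_cases hE : 2 * a ≤ ‖E v‖
    · have h1 : ‖E v‖ - ‖X v‖ ≤ ‖X v + E v‖ := by
        have := norm_sub_le (X v + E v) (X v)
        rw [add_sub_cancel_left] at this
        linarith
      linarith
    push Not at hE
    have h1 : ‖Φ v‖ ≤ 1 := by
      have h2 := hΦ v
      rw [hv, mul_one] at h2
      have h3 : ‖Φ v‖ ^ 2 * (3 * a) ^ 2 ≤ 1 * (3 * a) ^ 2 := by
        rw [h2]; nlinarith [norm_nonneg (E v)]
      have h4 := le_of_mul_le_mul_right h3 (by positivity)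
      exact (sq_le_one_iff₀ (norm_nonneg _)).1 h4
    obtain ⟨w, hw, hvw⟩ := hnet v h1
    set ε : ℝ := (1 / 2) ^ k with hε
    have hε0 : 0 < ε := by positivity
    have h5 := hΦ (v - w)
    have h6 : (a * ‖v - w‖) ^ 2 + ‖E (v - w)‖ ^ 2 ≤ (3 * a * ε) ^ 2 := by
      rw [← h5, mul_pow (3 * a) ε, mul_comm]
      gcongr
    have h7 : a * ‖v - w‖ ≤ 3 * a * ε := by
      refine abs_le_of_sq_le_sq' ?_ (by positivity) |>.2
      nlinarith [sq_nonneg ‖E (v - w)‖]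
    have h8 : ‖E (v - w)‖ ≤ 3 * a * ε := by
      refine abs_le_of_sq_le_sq' ?_ (by positivity) |>.2
      nlinarith [sq_nonneg (a * ‖v - w‖)]
    have h9 : ‖v - w‖ ≤ 1 / 8 := by
      have : a * ‖v - w‖ ≤ a * (1 / 8) := by linarith
      exact le_of_mul_le_mul_left this ha
    have h10 : 7 / 8 ≤ ‖w‖ := by
      have := norm_sub_norm_le v w
      linarith
    have hw0 : w ≠ 0 := by
      rintro rfl; rw [norm_zero] at h10; norm_num at h10
    have h11 := hsX w hw hw0
    have h12 : ‖X w + E w‖ ≤ ‖X v + E v‖ + ‖X (v - w)‖ + ‖E (v - w)‖ := by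
      have : X w + E w = (X v + E v) - X (v - w) - E (v - w) := by
        rw [map_sub, map_sub]; abel
      rw [this]
      exact (norm_sub_le _ _).trans (add_le_add_left (norm_sub_le _ _) _)
    have h13 := hX (v - w)
    nlinarith
  intro v
  rcases eq_or_ne v 0 with rfl | hv
  · simp
  have hv' : 0 < ‖v‖ := norm_pos_iff.2 hv
  have h := hunit (‖v‖⁻¹ • v) (by rw [norm_smul, norm_inv, norm_norm, inv_mul_cancel₀ hv'.ne'])
  rw [map_smul, map_smul, ← smul_add, norm_smul, norm_inv, norm_norm, le_inv_mul_iff₀ hv'] at h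
  linarith

/-- The linear map `v ↦ (v ⬝ x_n)_{n ∈ s}`. -/
def rowMap {Q : Type*} [Fintype Q] (s : Finset ℤ) (x : ℤ → Q → ℝ) :
    EuclideanSpace ℝ Q →ₗ[ℝ] EuclideanSpace ℝ s where
  toFun v := WithLp.toLp 2 fun n => v.ofLp ⬝ᵥ x n
  map_add' v w := by ext n; simp [add_dotProduct]
  map_smul' c v := by ext n; simp [smul_dotProduct]

lemma norm_rowMap_sq {Q : Type*} [Fintype Q] (s : Finset ℤ) (x : ℤ → Q → ℝ)
    (v : EuclideanSpace ℝ Q) : ‖rowMap s x v‖ ^ 2 = ∑ n ∈ s, (v.ofLp ⬝ᵥ x n) ^ 2 := by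
  have : rowMap s x v = WithLp.toLp 2 fun n : s => v.ofLp ⬝ᵥ x n := rfl
  rw [this, norm_toLp_sq, ← Finset.sum_coe_sort s fun n => (v.ofLp ⬝ᵥ x n) ^ 2]
  exact Finset.sum_congr rfl fun n _ => (sq _).symm

lemma rowMap_add {Q : Type*} [Fintype Q] (s : Finset ℤ) (x e : ℤ → Q → ℝ)
    (v : EuclideanSpace ℝ Q) : rowMap s x v + rowMap s e v = rowMap s (x + e) v := by
  ext n
  simp [rowMap, dotProduct_add]

lemma exists_net_sum_sq_lower {Q : Type*} [Fintype Q] (s : Finset ℤ) (e : ℤ → Q → ℝ)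
    {a b : ℝ} (ha : 0 < a) (hb : 0 < b) (hba : b ≤ a) (k : ℕ) (hk : 24 * a * (1 / 2) ^ k ≤ b) :
    ∃ t : Finset (Q → ℝ), t.card ≤ 5 ^ (Fintype.card Q * k) ∧ (∀ w ∈ t, 0 < w ⬝ᵥ w) ∧
      ∀ x : ℤ → Q → ℝ,
      (∀ v : Q → ℝ, ∑ n ∈ s, (v ⬝ᵥ x n) ^ 2 ≤ a ^ 2 * (v ⬝ᵥ v)) →
      (∀ w ∈ t, b ^ 2 * (w ⬝ᵥ w) ≤ ∑ n ∈ s, (w ⬝ᵥ x n + w ⬝ᵥ e n) ^ 2) →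
      ∀ v : Q → ℝ, b ^ 2 / 16 * (v ⬝ᵥ v) ≤ ∑ n ∈ s, (v ⬝ᵥ x n + v ⬝ᵥ e n) ^ 2 := by
  classical
  obtain ⟨t, ht, hnet⟩ := exists_net_lower_bound (rowMap s e) ha hb hba k hk
  rw [finrank_euclideanSpace] at ht
  have hn : ∀ v : EuclideanSpace ℝ Q, ‖v‖ ^ 2 = v.ofLp ⬝ᵥ v.ofLp := fun v => norm_toLp_sq v.ofLp
  refine ⟨(t.image WithLp.ofLp).filter (· ≠ 0),
    (Finset.card_filter_le _ _).trans (Finset.card_image_le.trans ht), ?_, ?_⟩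
  · intro w hw
    rw [Finset.mem_filter] at hw
    exact (dotProduct_self_nonneg' w).lt_of_ne fun h => hw.2 (dotProduct_self_eq_zero.1 h.symm)
  · intro x hx hw v
    have hadd : ∀ w : EuclideanSpace ℝ Q, ‖rowMap s x w + rowMap s e w‖ ^ 2
        = ∑ n ∈ s, (w.ofLp ⬝ᵥ x n + w.ofLp ⬝ᵥ e n) ^ 2 := by
      intro w
      rw [rowMap_add, norm_rowMap_sq]
      simp only [Pi.add_apply, dotProduct_add]
    have h := hnet (rowMap s x) (fun v => ?_) (fun w hwt hw0 => ?_) (WithLp.toLp 2 v)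
    · have h2 := pow_le_pow_left₀ (by positivity) h 2
      rw [mul_pow, hn, hadd] at h2
      refine le_trans (le_of_eq ?_) h2
      ring
    · refine abs_le_of_sq_le_sq' ?_ (by positivity) |>.2
      rw [norm_rowMap_sq, mul_pow, hn]
      exact hx _
    · refine abs_le_of_sq_le_sq' ?_ (by positivity) |>.2
      rw [hadd, mul_pow, hn]
      refine hw _ (Finset.mem_filter.2 ⟨Finset.mem_image_of_mem _ hwt, fun h0 => hw0 ?_⟩)
      ext i
      exact congrFun h0 i

lemma sum_unfold₁_sq {p₁ p₂ p₃ : ℕ} (X : Tensor p₁ p₂ p₃) :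
    ∑ i, unfold₁ X i ⬝ᵥ unfold₁ X i = frob X ^ 2 := by
  rw [frob_sq]
  refine Finset.sum_congr rfl fun i _ => ?_
  rw [dotProduct, Fintype.sum_prod_type, Finset.sum_comm]
  refine Finset.sum_congr rfl fun j _ => Finset.sum_congr rfl fun k _ => ?_
  simp [unfold₁, sq]

lemma sum_unfold₁_mulVec_le {p₁ p₂ p₃ : ℕ} (X : Tensor p₁ p₂ p₃) (s : Finset ℤ)
    {x e : ℤ → Fin p₃ × Fin p₂ → ℝ} {a : ℝ}
    (hx : ∀ v : Fin p₃ × Fin p₂ → ℝ, ∑ n ∈ s, (v ⬝ᵥ x n) ^ 2 ≤ a * (v ⬝ᵥ v)) :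
    ∑ n ∈ s, (unfold₁ X *ᵥ (x n + e n)) ⬝ᵥ (unfold₁ X *ᵥ (x n + e n))
      ≤ 2 * (a + ∑ n ∈ s, e n ⬝ᵥ e n) * frob X ^ 2 := by
  have h1 : ∀ v : Fin p₃ × Fin p₂ → ℝ, ∑ n ∈ s, (v ⬝ᵥ (x n + e n)) ^ 2
      ≤ 2 * (a + ∑ n ∈ s, e n ⬝ᵥ e n) * (v ⬝ᵥ v) := by
    intro v
    have h2 : ∑ n ∈ s, (v ⬝ᵥ e n) ^ 2 ≤ (v ⬝ᵥ v) * ∑ n ∈ s, e n ⬝ᵥ e n := by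
      rw [Finset.mul_sum]
      exact Finset.sum_le_sum fun n _ => dotProduct_sq_le v (e n)
    have h3 : ∑ n ∈ s, (v ⬝ᵥ (x n + e n)) ^ 2
        ≤ ∑ n ∈ s, (2 * (v ⬝ᵥ x n) ^ 2 + 2 * (v ⬝ᵥ e n) ^ 2) := by
      refine Finset.sum_le_sum fun n _ => ?_
      rw [dotProduct_add]
      nlinarith [sq_nonneg (v ⬝ᵥ x n - v ⬝ᵥ e n)]
    rw [Finset.sum_add_distrib, ← Finset.mul_sum, ← Finset.mul_sum] at h3
    nlinarith [hx v]
  have h4 : ∀ n, (unfold₁ X *ᵥ (x n + e n)) ⬝ᵥ (unfold₁ X *ᵥ (x n + e n))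
      = ∑ i, (unfold₁ X i ⬝ᵥ (x n + e n)) ^ 2 := fun n =>
    Finset.sum_congr rfl fun i _ => (sq _).symm
  simp only [h4]
  rw [← sum_unfold₁_sq, Finset.mul_sum, Finset.sum_comm]
  exact Finset.sum_le_sum fun i _ => h1 (unfold₁ X i)

section tails

variable {Ω : Type*} {mΩ : MeasurableSpace Ω} {μ : Measure Ω} [IsProbabilityMeasure μ]
  {N P : ℕ} {κ : ℝ≥0} {A : Tensor N N P} {S : Matrix (Fin N) (Fin N) ℝ}
  {ξ y : ℤ → Ω → Fin N → ℝ}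

/-- The energy of all linear functionals of the predictors is bounded by `a`. -/
def EnergyBound (P T : ℕ) (a : ℝ) (p : ℤ → Fin N → ℝ) : Prop :=
  ∀ v : Fin P × Fin N → ℝ,
    ∑ n ∈ Finset.Icc ((P : ℤ) + 1) T, (v ⬝ᵥ predictor P p n) ^ 2 ≤ a * (v ⬝ᵥ v)

/-- The energy of all linear functionals of the predictors is bounded below by `b`. -/
def EnergyLower (P T : ℕ) (b : ℝ) (p : ℤ → Fin N → ℝ) : Prop :=
  ∀ v : Fin P × Fin N → ℝ,
    b * (v ⬝ᵥ v) ≤ ∑ n ∈ Finset.Icc ((P : ℤ) + 1) T, (v ⬝ᵥ predictor P p n) ^ 2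

/-- The deviation bound for the residuals of `p` against the predictors of `p + h`, uniformly over
tensors of low multilinear rank. -/
def DeviationBound (A : Tensor N N P) (T R₁ R₂ R₃ : ℕ) (c : ℝ) (p h : ℤ → Fin N → ℝ) : Prop :=
  ∀ D : Tensor N N P, (unfold₁ D).rank ≤ R₁ → (unfold₂ D).rank ≤ R₂ → (unfold₃ D).rank ≤ R₃ →
    ∑ n ∈ Finset.Icc ((P : ℤ) + 1) T,
      residual A p n ⬝ᵥ (unfold₁ D *ᵥ predictor P (p + h) n) ≤ c * frob D

namespace IsStableVARModel

lemma measure_not_energyLower_le (hM : IsStableVARModel μ κ A S ξ y) (hκ : 1 ≤ κ)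
    (h : ℤ → Fin N → ℝ) {M T : ℕ} (hMT : (M + 1) * P ≤ T) {a b : ℝ} (ha : 0 < a) (hb : 0 < b)
    (hba : b ≤ a) (hbM : b ^ 2 ≤ P * (M * (kappaL A S / 8))) (k : ℕ)
    (hk : 24 * a * (1 / 2) ^ k ≤ b) :
    μ {ω | EnergyBound P T (a ^ 2) (fun k => y k ω) ∧
        ¬EnergyLower P T (b ^ 2 / 16) ((fun k => y k ω) + h)}
      ≤ ENNReal.ofReal (5 ^ (P * N * k) * (P * Real.exp (-(M / (1568 * (κ : ℝ) ^ 3))))) := by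
  obtain ⟨t, ht, htpos, hnet⟩ := exists_net_sum_sq_lower (Finset.Icc ((P : ℤ) + 1) T)
    (fun n => predictor P h n) ha hb hba k hk
  rw [Fintype.card_prod, Fintype.card_fin, Fintype.card_fin] at ht
  set E : (Fin P × Fin N → ℝ) → Set Ω := fun w =>
    {ω | ∑ n ∈ Finset.Icc ((P : ℤ) + 1) T, (w ⬝ᵥ predictor P (fun k => y k ω) n
      + w ⬝ᵥ predictor P h n) ^ 2 ≤ P * (M * (kappaL A S * (w ⬝ᵥ w) / 8))} with hE
  refine (measure_mono (t := ⋃ w ∈ t, E w) ?_).trans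
    ((measure_biUnion_finset_le _ _).trans ?_)
  · rintro ω ⟨h1, h2⟩
    simp only [Set.mem_iUnion, exists_prop]
    by_contra! hcon
    refine h2 fun v => ?_
    simp only [predictor_add, dotProduct_add]
    refine hnet (fun n => predictor P (fun k => y k ω) n) h1 (fun w hw => ?_) v
    have := hcon w hw
    simp only [hE, Set.mem_ofPred_eq, not_le] at this
    refine le_trans ?_ this.le
    calc b ^ 2 * (w ⬝ᵥ w) ≤ P * (M * (kappaL A S / 8)) * (w ⬝ᵥ w) := by
          have := (htpos w hw).le
          gcongr
      _ = _ := by ring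
  · refine (Finset.sum_le_sum fun w hw => hM.measure_sum_sq_le hκ (htpos w hw) _ hMT).trans ?_
    rw [Finset.sum_const, nsmul_eq_mul,
      ENNReal.ofReal_mul (p := (5 : ℝ) ^ (P * N * k)) (by positivity)]
    gcongr
    rw [← ENNReal.ofReal_natCast]
    exact ENNReal.ofReal_le_ofReal (by exact_mod_cast ht)

lemma measure_not_deviationBound_le (hM : IsStableVARModel μ κ A S ξ y) (hκ : 0 < κ)
    (h : ℤ → Fin N → ℝ) {T : ℕ} (hPT : P ≤ T) (R₁ R₂ R₃ : ℕ) {a V τ : ℝ} (hV : 0 < V) (hτ : 0 ≤ τ)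
    (haV : 2 * (a + ∑ n ∈ Finset.Icc ((P : ℤ) + 1) T, predictor P h n ⬝ᵥ predictor P h n) ≤ V) :
    μ {ω | EnergyBound P T a (fun k => y k ω) ∧
        ¬DeviationBound A T R₁ R₂ R₃ (16 * τ) (fun k => y k ω) h}
      ≤ ENNReal.ofReal (5 ^ (R₁ * R₂ * R₃ + N * R₁ + N * R₂ + P * R₃)
        * Real.exp (-(τ ^ 2 / (2 * (κ : ℝ) ^ 2 * lamMax S * V)))) := by
  obtain ⟨t, ht, ht1, hnet⟩ := exists_lowRank_net N N P R₁ R₂ R₃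
  set E : Tensor N N P → Set Ω := fun X => {ω | τ ≤ ∑ i ∈ Finset.range (T - P),
      residual A (fun k => y k ω) (P + 1 + i) ⬝ᵥ
        (unfold₁ X *ᵥ predictor P ((fun k => y k ω) + h) (P + 1 + i)) ∧
      ∑ i ∈ Finset.range (T - P), (unfold₁ X *ᵥ predictor P ((fun k => y k ω) + h) (P + 1 + i)) ⬝ᵥ
        (unfold₁ X *ᵥ predictor P ((fun k => y k ω) + h) (P + 1 + i)) ≤ V} with hE
  refine (measure_mono (t := ⋃ X ∈ t, E X) ?_).trans
    ((measure_biUnion_finset_le _ _).trans ?_)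
  · rintro ω ⟨h1, h2⟩
    simp only [Set.mem_iUnion, exists_prop]
    by_contra! hcon
    refine h2 fun D hD₁ hD₂ hD₃ => ?_
    let L : Tensor N N P →ₗ[ℝ] ℝ :=
      { toFun := fun X => ∑ n ∈ Finset.Icc ((P : ℤ) + 1) T, residual A (fun k => y k ω) n ⬝ᵥ
          (unfold₁ X *ᵥ predictor P ((fun k => y k ω) + h) n)
        map_add' := fun X Y => by
          have : unfold₁ (X + Y) = unfold₁ X + unfold₁ Y := rfl
          simp only [this, Matrix.add_mulVec, dotProduct_add, Finset.sum_add_distrib]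
        map_smul' := fun c X => by
          have : unfold₁ (c • X) = c • unfold₁ X := rfl
          simp only [this, Matrix.smul_mulVec, dotProduct_smul, Finset.smul_sum, RingHom.id_apply] }
    refine hnet L τ (fun X hX => ?_) D hD₁ hD₂ hD₃
    have h3 := hcon X hX
    simp only [hE, Set.mem_ofPred_eq, not_and_or, not_le] at h3
    have h4 := sum_unfold₁_mulVec_le X (Finset.Icc ((P : ℤ) + 1) T)
      (x := fun n => predictor P (fun k => y k ω) n) (e := fun n => predictor P h n) h1
    have h5 : frob X ^ 2 ≤ 1 := pow_le_one₀ (frob_nonneg X) (ht1 X hX)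
    have h6 := h4.trans (mul_le_mul_of_nonneg_right haV (sq_nonneg _))
    rw [sum_Icc_eq_sum_range _ hPT] at h6
    rcases h3 with h3 | h3
    · rw [← sum_Icc_eq_sum_range (fun n => residual A (fun k => y k ω) n ⬝ᵥ
        (unfold₁ X *ᵥ predictor P ((fun k => y k ω) + h) n)) hPT] at h3
      exact h3.le
    · exfalso
      have h7 : V * frob X ^ 2 ≤ V := mul_le_of_le_one_right hV.le h5
      exact absurd (h6.trans h7) (not_le.2 h3)
  · refine (Finset.sum_le_sum fun X hX => hM.measure_residual_le hκ
      (D := fun n p => unfold₁ X *ᵥ predictor P (p + h) n) ?_ ?_ (P + 1) (T - P) hτ hV).trans ?_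
    · intro n
      exact (measurable_mulVec _).comp
        ((measurable_predictor n).comp (measurable_id.add_const h))
    · intro n k hk p
      simp only [predictor_add, predictor_cut p hk]
    · rw [Finset.sum_const, nsmul_eq_mul, ENNReal.ofReal_mul (by positivity)]
      gcongr
      rw [← ENNReal.ofReal_natCast]
      exact ENNReal.ofReal_le_ofReal (by exact_mod_cast ht)

end IsStableVARModel

end tails


lemma exponent_le {P N k d M κ ρ : ℝ} (hP1 : 1 ≤ P) (hNd : N ≤ d) (hd : 1 ≤ d)
    (hκ1 : 1 ≤ κ) (hρ1 : 1 ≤ ρ) (hk0 : 0 ≤ k) (hkx : k ≤ 13 * (κ * Real.sqrt ρ))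
    (h4 : 10 ^ 5 * P ^ 2 * (κ ^ 4 * ρ ^ 2 * d) ≤ 2 * (P * M)) :
    2 * (P * N * k) + (P + -(M / (1568 * κ ^ 3))) ≤ -(2 * d) := by
  have hP0 : 0 < P := by linarith
  have hκ0 : 0 < κ := by linarith
  set x : ℝ := κ * Real.sqrt ρ with hx
  have hx1 : 1 ≤ x := one_le_mul_of_one_le_of_one_le hκ1 (Real.one_le_sqrt.2 hρ1)
  set z : ℝ := κ * ρ ^ 2 with hz
  have hxz : x ≤ z := by
    have : Real.sqrt ρ ≤ ρ ^ 2 := by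
      have h3 : Real.sqrt ρ ≤ ρ := Real.sqrt_le_iff.2 ⟨by linarith, by nlinarith⟩
      nlinarith
    rw [hx, hz]; gcongr
  have hz1 : 1 ≤ z := hx1.trans hxz
  have h3 : 31 * P * d * z ≤ M / (1568 * κ ^ 3) := by
    rw [le_div_iff₀ (by positivity)]
    have h5 : P * (31 * P * d * z * (1568 * κ ^ 3)) ≤ P * M := by
      have e : P * (31 * P * d * z * (1568 * κ ^ 3))
          = 48608 * (P ^ 2 * (κ ^ 4 * ρ ^ 2 * d)) := by rw [hz]; ring
      rw [e]
      have : 0 ≤ P ^ 2 * (κ ^ 4 * ρ ^ 2 * d) := by positivity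
      linarith
    exact le_of_mul_le_mul_left h5 hP0
  have h6 : P * N * k ≤ P * d * (13 * z) := by
    have : (k : ℝ) ≤ 13 * z := by linarith
    gcongr
  have h7 : P ≤ P * d * z := by
    calc P = P * 1 * 1 := by ring
      _ ≤ P * d * z := by gcongr
  have h8 : d ≤ P * d * z := by
    calc d = 1 * d * 1 := by ring
      _ ≤ P * d * z := by gcongr
  nlinarith

/-- The stochastic part of the rate of convergence. -/
noncomputable def noiseRate {N P : ℕ} (A : Tensor N N P) (S : Matrix (Fin N) (Fin N) ℝ) (κ : ℝ)
    (d T : ℕ) : ℝ :=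
  (κ ^ 2 * Real.sqrt (lamMax S * kappaU A S) + κ * Real.sqrt (kappaU A S))
      * Real.sqrt ((d : ℝ) / T)

section good

variable {Ω : Type*} {mΩ : MeasurableSpace Ω} {μ : Measure Ω}
  {N P : ℕ} {κ : ℝ≥0} {A : Tensor N N P} {S : Matrix (Fin N) (Fin N) ℝ}
  {ξ y : ℤ → Ω → Fin N → ℝ}

namespace IsStableVARModel

lemma lamMax_le_kappaU (hM : IsStableVARModel μ κ A S ξ y) : lamMax S ≤ kappaU A S := by
  rw [kappaU, le_div_iff₀ hM.muMin_pos]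
  exact mul_le_of_le_one_right hM.lamMax_pos.le
    (muMin_le_one A hM.P_pos hM.N_pos hM.stable hM.muMin_pos)

lemma kappaL_le_lamMin (hM : IsStableVARModel μ κ A S ξ y) : kappaL A S ≤ lamMin S :=
  div_le_self (lamMin_pos hM.N_pos hM.posDef).le (one_le_muMax A hM.N_pos)

lemma kappaL_le_kappaU (hM : IsStableVARModel μ κ A S ξ y) : kappaL A S ≤ kappaU A S :=
  hM.kappaL_le_lamMin.trans ((lamMin_le_lamMax hM.N_pos hM.posDef.1).trans hM.lamMax_le_kappaU)

variable [IsProbabilityMeasure μ]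

lemma one_le_kappa (hM : IsStableVARModel μ κ A S ξ y) : 1 ≤ κ := by
  have i : Fin N := ⟨0, hM.N_pos⟩
  have h := one_le_of_subgaussian (hM.noise.subGaussian 0 i) (by
    have := hM.noise.cov_one 0 i i
    rw [Matrix.one_apply_eq] at this
    simpa only [sq] using this)
  have h1 : (1 : ℝ≥0) ≤ κ ^ 2 := by exact_mod_cast h
  exact (one_le_sq_iff₀ zero_le).1 h1

lemma measure_not_energyBound_le (hM : IsStableVARModel μ κ A S ξ y) {T : ℕ} {d : ℝ} (hPT : P ≤ T)
    (hNd : N ≤ d) (hd : 1 ≤ d) (hT : 4 * P ^ 2 * d ≤ T) :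
    μ {ω | ¬EnergyBound P T (128 * (κ : ℝ) ^ 2 * kappaU A S * T) (fun k => y k ω)}
      ≤ ENNReal.ofReal (Real.exp (-(2 * d))) := by
  have hκ := hM.one_le_kappa
  have hκ' : (0 : ℝ) < κ := zero_lt_one.trans_le (by exact_mod_cast hκ)
  have hU := hM.kappaU_pos
  have hP1 : (1 : ℝ) ≤ P := by exact_mod_cast hM.P_pos
  have hP0 : (0 : ℝ) < P := by linarith
  set τ : ℝ := Real.sqrt (8 * (κ : ℝ) ^ 2 * kappaU A S * T / P) with hτd
  have hτ2 : τ ^ 2 = 8 * (κ : ℝ) ^ 2 * kappaU A S * T / P := Real.sq_sqrt (by positivity)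
  have h := hM.measure_lt_sum_sq (M := T / P) (T := T) (zero_lt_one.trans_le hκ) hPT
    (by rw [Nat.succ_mul]; exact (Nat.lt_div_mul_add hM.P_pos).le) (Real.sqrt_nonneg _ : 0 ≤ τ)
  have e1 : (P : ℝ) * (4 * τ) ^ 2 = 128 * (κ : ℝ) ^ 2 * kappaU A S * T := by
    rw [mul_pow, hτ2]; field_simp; ring
  have e2 : τ ^ 2 / (2 * (κ : ℝ) ^ 2 * kappaU A S) = 4 * (T / P) := by
    rw [hτ2]; field_simp; ring
  rw [e1, e2] at h
  have hset : {ω | ¬EnergyBound P T (128 * (κ : ℝ) ^ 2 * kappaU A S * T) (fun k => y k ω)}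
      = {ω | ∃ v : Fin P × Fin N → ℝ, 128 * (κ : ℝ) ^ 2 * kappaU A S * T * (v ⬝ᵥ v)
      < ∑ n ∈ Finset.Icc ((P : ℤ) + 1) T, (v ⬝ᵥ predictor P (fun k => y k ω) n) ^ 2} := by
    ext ω
    simp only [EnergyBound, Set.mem_ofPred_eq, not_forall, not_le]
  rw [hset]
  refine h.trans (ENNReal.ofReal_le_ofReal ?_)
  have h1 : (P : ℝ) ≤ Real.exp P := by linarith [Real.add_one_le_exp (P : ℝ)]
  have h2 := five_pow_le_exp (P * N + T / P)
  have h3 : ((T / P : ℕ) : ℝ) ≤ T / P := Nat.cast_div_le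
  calc (P : ℝ) * (5 ^ (P * N + T / P) * Real.exp (-(4 * (T / P))))
      ≤ Real.exp P * (Real.exp (2 * (P * N + T / P : ℕ)) * Real.exp (-(4 * (T / P)))) := by
        gcongr
    _ = Real.exp (P + 2 * (P * N + T / P : ℕ) + -(4 * (T / P))) := by
        rw [Real.exp_add, Real.exp_add, mul_assoc]
    _ ≤ Real.exp (-(2 * d)) := by
        refine Real.exp_le_exp.2 ?_
        push_cast
        have h4 : 4 * P * d ≤ T / P := by
          rw [le_div_iff₀ hP0]; nlinarith
        have h5 : (P : ℝ) * N ≤ P * d := by gcongr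
        nlinarith

lemma measure_not_energyLower_le' (hM : IsStableVARModel μ κ A S ξ y) (h : ℤ → Fin N → ℝ)
    {T : ℕ} {d : ℝ} (hNd : N ≤ d) (hd : 1 ≤ d)
    (hT : 10 ^ 5 * P ^ 2 * ((κ : ℝ) ^ 4 * (kappaU A S / kappaL A S) ^ 2 * d) ≤ T) :
    μ {ω | EnergyBound P T (128 * (κ : ℝ) ^ 2 * kappaU A S * T) (fun k => y k ω) ∧
        ¬EnergyLower P T (kappaL A S * T / 256) ((fun k => y k ω) + h)}
      ≤ ENNReal.ofReal (Real.exp (-(2 * d))) := by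
  have hκ := hM.one_le_kappa
  have hκ1 : (1 : ℝ) ≤ κ := by exact_mod_cast hκ
  have hκ' : (0 : ℝ) < κ := by linarith
  have hU := hM.kappaU_pos
  have hL := hM.kappaL_pos
  have hP1 : (1 : ℝ) ≤ P := by exact_mod_cast hM.P_pos
  have hP0 : (0 : ℝ) < P := by linarith
  set ρ : ℝ := kappaU A S / kappaL A S with hρ
  have hUρ : kappaU A S = ρ * kappaL A S := by rw [hρ]; field_simp
  have hρ1 : 1 ≤ ρ := by rw [hρ, le_div_iff₀ hL, one_mul]; exact hM.kappaL_le_kappaU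
  have hκ4 : (1 : ℝ) ≤ (κ : ℝ) ^ 4 := one_le_pow₀ hκ1
  have hρ2 : 1 ≤ ρ ^ 2 := one_le_pow₀ hρ1
  have hq : 1 ≤ (κ : ℝ) ^ 4 * ρ ^ 2 * d := by
    have := one_le_mul_of_one_le_of_one_le (one_le_mul_of_one_le_of_one_le hκ4 hρ2) hd
    exact this
  have hTP : 10 ^ 5 * (P : ℝ) ≤ T := by
    refine le_trans ?_ hT
    have : (P : ℝ) ≤ P ^ 2 := by nlinarith
    calc 10 ^ 5 * (P : ℝ) ≤ 10 ^ 5 * P ^ 2 * 1 := by linarith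
      _ ≤ _ := by gcongr
  have hT0 : (0 : ℝ) < T := by linarith
  have hdiv : (T : ℝ) / P < (T / P : ℕ) + 1 := Nat.lt_floor_add_one _ |>.trans_eq (by
    rw [Nat.floor_div_natCast, Nat.floor_natCast])
  have hdiv1 : 1 ≤ T / P := by
    rw [Nat.one_le_div_iff hM.P_pos]
    have : (P : ℝ) ≤ T := by linarith
    exact_mod_cast this
  obtain ⟨M, hMd⟩ : ∃ M, T / P = M + 1 := ⟨T / P - 1, by omega⟩
  have hMT : (M + 1) * P ≤ T := by rw [← hMd]; exact Nat.div_mul_le_self T P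
  rw [hMd] at hdiv
  push_cast at hdiv
  have hM2 : (T : ℝ) ≤ 2 * (P * M) := by
    rw [div_lt_iff₀ hP0] at hdiv
    nlinarith
  set a : ℝ := Real.sqrt (128 * (κ : ℝ) ^ 2 * kappaU A S * T) with ha
  have ha2 : a ^ 2 = 128 * (κ : ℝ) ^ 2 * kappaU A S * T := Real.sq_sqrt (by positivity)
  have ha0 : 0 < a := Real.sqrt_pos.2 (by positivity)
  set b : ℝ := Real.sqrt (kappaL A S * T / 16) with hb
  have hb2 : b ^ 2 = kappaL A S * T / 16 := Real.sq_sqrt (by positivity)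
  have hb0 : 0 < b := Real.sqrt_pos.2 (by positivity)
  have hκρ : 1 ≤ (κ : ℝ) ^ 2 * ρ :=
    one_le_mul_of_one_le_of_one_le (one_le_pow₀ hκ1) hρ1
  have ha2' : a ^ 2 = 128 * ((κ : ℝ) ^ 2 * ρ) * (kappaL A S * T) := by rw [ha2, hUρ]; ring
  have hLT : 0 < kappaL A S * T := by positivity
  have hba : b ≤ a := by
    refine abs_le_of_sq_le_sq' ?_ ha0.le |>.2
    rw [ha2', hb2]
    nlinarith
  set x : ℝ := κ * Real.sqrt ρ with hx
  have hsρ : 1 ≤ Real.sqrt ρ := Real.one_le_sqrt.2 hρ1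
  have hx1 : 1 ≤ x := one_le_mul_of_one_le_of_one_le hκ1 hsρ
  have hx2 : x ^ 2 = (κ : ℝ) ^ 2 * ρ := by rw [hx, mul_pow, Real.sq_sqrt (by linarith)]
  set k : ℕ := ⌈x⌉₊ + 11 with hk
  have h2k : 2048 * x ≤ (2 : ℝ) ^ k := by
    have h1 : x ≤ (⌈x⌉₊ : ℝ) := Nat.le_ceil x
    have h2 : (⌈x⌉₊ : ℝ) ≤ (2 : ℝ) ^ ⌈x⌉₊ := by
      exact_mod_cast Nat.lt_two_pow_self.le
    rw [hk, pow_add]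
    norm_num
    linarith
  have hkx : (k : ℝ) ≤ 13 * x := by
    have := Nat.ceil_lt_add_one (by linarith : 0 ≤ x)
    rw [hk]; push_cast; linarith
  have hkab : 24 * a * (1 / 2) ^ k ≤ b := by
    rw [one_div, inv_pow, ← div_eq_mul_inv, div_le_iff₀ (by positivity)]
    have h1 : 24 * a ≤ b * (2048 * x) := by
      refine abs_le_of_sq_le_sq' ?_ (by positivity) |>.2
      rw [mul_pow, mul_pow b, mul_pow 2048, ha2', hb2, hx2]
      nlinarith [mul_pos (zero_lt_one.trans_le hκρ) hLT]
    exact h1.trans (mul_le_mul_of_nonneg_left h2k hb0.le)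
  have hmain := hM.measure_not_energyLower_le hκ h hMT ha0 hb0 hba (by rw [hb2]; nlinarith) k hkab
  rw [ha2, hb2, div_div, show (16 * 16 : ℝ) = 256 by norm_num] at hmain
  refine hmain.trans (ENNReal.ofReal_le_ofReal ?_)
  have h1 : (P : ℝ) ≤ Real.exp P := by linarith [Real.add_one_le_exp (P : ℝ)]
  have h2 := five_pow_le_exp (P * N * k)
  calc (5 : ℝ) ^ (P * N * k) * (P * Real.exp (-(M / (1568 * (κ : ℝ) ^ 3))))
      ≤ Real.exp (2 * (P * N * k : ℕ)) * (Real.exp P * Real.exp (-(M / (1568 * (κ : ℝ) ^ 3)))) := by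
        gcongr
    _ = Real.exp (2 * (P * N * k : ℕ) + (P + -(M / (1568 * (κ : ℝ) ^ 3)))) := by
        rw [Real.exp_add, Real.exp_add]
    _ ≤ Real.exp (-(2 * d)) := by
        refine Real.exp_le_exp.2 ?_
        push_cast
        exact exponent_le hP1 hNd hd hκ1 hρ1 (Nat.cast_nonneg _) hkx
          (hT.trans hM2)

lemma measure_not_deviationBound_le' (hM : IsStableVARModel μ κ A S ξ y) (h : ℤ → Fin N → ℝ)
    {T : ℕ} (hPT : P ≤ T) {r₁ r₂ r₃ : ℕ}
    (hh : ∑ n ∈ Finset.Icc ((P : ℤ) + 1) T, predictor P h n ⬝ᵥ predictor P h n ≤ T) :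
    μ {ω | EnergyBound P T (128 * (κ : ℝ) ^ 2 * kappaU A S * T) (fun k => y k ω) ∧
        ¬DeviationBound A T (2 * r₁) (2 * r₂) (2 * r₃)
          (1632 * (T * noiseRate A S κ (dM N P r₁ r₂ r₃) T)) (fun k => y k ω) h}
      ≤ ENNReal.ofReal (Real.exp (-(2 * dM N P r₁ r₂ r₃))) := by
  have hκ := hM.one_le_kappa
  have hκ1 : (1 : ℝ) ≤ κ := by exact_mod_cast hκ
  have hκ' : (0 : ℝ) < κ := by linarith
  have hU := hM.kappaU_pos
  have hl := hM.lamMax_pos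
  have hlU := hM.lamMax_le_kappaU
  have hT0 : (0 : ℝ) < T := by exact_mod_cast hM.P_pos.trans_le hPT
  set d := dM N P r₁ r₂ r₃ with hd
  set q := noiseRate A S κ d T with hq
  have hq0 : 0 ≤ q := by rw [hq, noiseRate]; positivity
  set V : ℝ := 2 * (128 * (κ : ℝ) ^ 2 * kappaU A S * T + T) with hV
  have hV0 : 0 < V := by positivity
  have hmain := hM.measure_not_deviationBound_le (zero_lt_one.trans_le hκ) h hPT (2 * r₁) (2 * r₂)
    (2 * r₃) (τ := 102 * (T * q)) hV0 (by positivity)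
    (a := 128 * (κ : ℝ) ^ 2 * kappaU A S * T) (by rw [hV]; gcongr)
  rw [← mul_assoc, show (16 * 102 : ℝ) = 1632 by norm_num] at hmain
  refine hmain.trans (ENNReal.ofReal_le_ofReal ?_)
  have h1 : 2 * r₁ * (2 * r₂) * (2 * r₃) + N * (2 * r₁) + N * (2 * r₂) + P * (2 * r₃) ≤ 8 * d := by
    rw [hd, dM]; nlinarith
  have h2 : ((κ : ℝ) ^ 4 * (lamMax S * kappaU A S) + (κ : ℝ) ^ 2 * kappaU A S) * (d / T) ≤ q ^ 2 := by
    rw [hq, noiseRate, mul_pow, Real.sq_sqrt (by positivity)]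
    gcongr
    have e1 := Real.sq_sqrt (by positivity : 0 ≤ lamMax S * kappaU A S)
    have e2 := Real.sq_sqrt hU.le
    have e3 : 0 ≤ (κ : ℝ) ^ 2 * Real.sqrt (lamMax S * kappaU A S) * (κ * Real.sqrt (kappaU A S)) := by
      positivity
    calc _ = ((κ : ℝ) ^ 2 * Real.sqrt (lamMax S * kappaU A S)) ^ 2
          + (κ * Real.sqrt (kappaU A S)) ^ 2 := by rw [mul_pow, mul_pow, e1, e2]; ring
      _ ≤ _ := by nlinarith
  have h3 : 20 * (d : ℝ) ≤ (102 * (T * q)) ^ 2 / (2 * (κ : ℝ) ^ 2 * lamMax S * V) := by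
    rw [le_div_iff₀ (by positivity)]
    have e : (102 * (T * q)) ^ 2 = 10404 * (T : ℝ) ^ 2 * q ^ 2 := by ring
    rw [e]
    calc 20 * (d : ℝ) * (2 * (κ : ℝ) ^ 2 * lamMax S * V)
        = (10240 * ((κ : ℝ) ^ 4 * (lamMax S * kappaU A S)) + 80 * (κ : ℝ) ^ 2 * lamMax S)
          * (d * T) := by rw [hV]; ring
      _ ≤ (10404 * ((κ : ℝ) ^ 4 * (lamMax S * kappaU A S)) + 10404 * (κ : ℝ) ^ 2 * kappaU A S)
          * (d * T) := by
          gcongr <;> norm_num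
      _ = 10404 * (T : ℝ) ^ 2 * (((κ : ℝ) ^ 4 * (lamMax S * kappaU A S)
          + (κ : ℝ) ^ 2 * kappaU A S) * (d / T)) := by field_simp
      _ ≤ _ := by gcongr
  calc _ ≤ (5 : ℝ) ^ (8 * d) * Real.exp (-(20 * d)) := by
        gcongr
        norm_num
    _ ≤ Real.exp (2 * (8 * d : ℕ)) * Real.exp (-(20 * d)) := by
        gcongr; exact five_pow_le_exp _
    _ = Real.exp (2 * (8 * d : ℕ) + -(20 * d)) := by rw [Real.exp_add]
    _ ≤ _ := by
        refine Real.exp_le_exp.2 ?_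
        push_cast
        have : (0 : ℝ) ≤ d := by positivity
        linarith

end IsStableVARModel

/-- The event on which the estimation error is controlled, as a property of the path `p` of the
process and the path `h` of the estimation errors. -/
def Good (A : Tensor N N P) (S : Matrix (Fin N) (Fin N) ℝ) (κ : ℝ) (T r₁ r₂ r₃ : ℕ)
    (p h : ℤ → Fin N → ℝ) : Prop :=
  EnergyLower P T (kappaL A S * T / 256) (p + h) ∧
    DeviationBound A T (2 * r₁) (2 * r₂) (2 * r₃)
      (1632 * (T * noiseRate A S κ (dM N P r₁ r₂ r₃) T)) p h

lemma IsStableVARModel.measure_not_good_le [IsProbabilityMeasure μ]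
    (hM : IsStableVARModel μ κ A S ξ y) (h : ℤ → Fin N → ℝ)
    {T r₁ r₂ r₃ : ℕ} (hNd : N ≤ dM N P r₁ r₂ r₃)
    (hT : 10 ^ 5 * P ^ 2 * ((κ : ℝ) ^ 4 * (kappaU A S / kappaL A S) ^ 2 * dM N P r₁ r₂ r₃) ≤ T)
    (hh : ∑ n ∈ Finset.Icc ((P : ℤ) + 1) T, predictor P h n ⬝ᵥ predictor P h n ≤ 1) :
    μ {ω | ¬Good A S κ T r₁ r₂ r₃ (fun k => y k ω) h}
      ≤ ENNReal.ofReal (3 * Real.exp (-(2 * dM N P r₁ r₂ r₃))) := by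
  set d := dM N P r₁ r₂ r₃ with hdd
  have hd1 : (1 : ℝ) ≤ d := by exact_mod_cast Nat.lt_of_lt_of_le hM.N_pos hNd
  have hNd' : (N : ℝ) ≤ d := by exact_mod_cast hNd
  have hP1 : (1 : ℝ) ≤ P := by exact_mod_cast hM.P_pos
  have hκ1 : (1 : ℝ) ≤ κ := by exact_mod_cast hM.one_le_kappa
  have hρ1 : 1 ≤ kappaU A S / kappaL A S := by
    rw [le_div_iff₀ hM.kappaL_pos, one_mul]; exact hM.kappaL_le_kappaU
  have h1 : (1 : ℝ) ≤ (κ : ℝ) ^ 4 * (kappaU A S / kappaL A S) ^ 2 :=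
    one_le_mul_of_one_le_of_one_le (one_le_pow₀ hκ1) (one_le_pow₀ hρ1)
  have hTd : 10 ^ 5 * (P : ℝ) ^ 2 * d ≤ T := by
    refine le_trans ?_ hT
    gcongr
    exact le_mul_of_one_le_left (by positivity) h1
  have hP2 : (P : ℝ) ≤ P ^ 2 * d := by
    calc (P : ℝ) = P * 1 * 1 := by ring
      _ ≤ P * P * d := by gcongr
      _ = _ := by ring
  have hPT' : (P : ℝ) ≤ T := by nlinarith
  have hPT : P ≤ T := by exact_mod_cast hPT'
  have a1 := hM.measure_not_energyBound_le hPT hNd' hd1 (by nlinarith)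
  have a2 := hM.measure_not_energyLower_le' h hNd' hd1 hT
  have a3 := hM.measure_not_deviationBound_le' h hPT (r₁ := r₁) (r₂ := r₂) (r₃ := r₃)
    (by linarith)
  have hsub : {ω | ¬Good A S κ T r₁ r₂ r₃ (fun k => y k ω) h}
      ⊆ {ω | ¬EnergyBound P T (128 * (κ : ℝ) ^ 2 * kappaU A S * T) (fun k => y k ω)} ∪
        ({ω | EnergyBound P T (128 * (κ : ℝ) ^ 2 * kappaU A S * T) (fun k => y k ω) ∧
        ¬EnergyLower P T (kappaL A S * T / 256) ((fun k => y k ω) + h)} ∪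
        {ω | EnergyBound P T (128 * (κ : ℝ) ^ 2 * kappaU A S * T) (fun k => y k ω) ∧
        ¬DeviationBound A T (2 * r₁) (2 * r₂) (2 * r₃)
          (1632 * (T * noiseRate A S κ (dM N P r₁ r₂ r₃) T)) (fun k => y k ω) h}) := by
    intro ω hω
    simp only [Good, Set.mem_ofPred_eq, Set.mem_union] at hω ⊢
    tauto
  refine (measure_mono hsub).trans ((measure_union_le _ _).trans
    ((add_le_add a1 ((measure_union_le _ _).trans (add_le_add a2 a3))).trans ?_))
  rw [← ENNReal.ofReal_add (by positivity) (by positivity),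
    ← ENNReal.ofReal_add (by positivity) (by positivity)]
  exact ENNReal.ofReal_le_ofReal (le_of_eq (by ring))

lemma isClosed_good (A : Tensor N N P) (S : Matrix (Fin N) (Fin N) ℝ) (κ : ℝ) (T r₁ r₂ r₃ : ℕ) :
    IsClosed {q : (ℤ → Fin N → ℝ) × (ℤ → Fin N → ℝ) | Good A S κ T r₁ r₂ r₃ q.1 q.2} := by
  have hp : ∀ n, Continuous fun q : (ℤ → Fin N → ℝ) × (ℤ → Fin N → ℝ) =>
      predictor P (q.1 + q.2) n := fun n =>
    (continuous_predictor n).comp (continuous_fst.add continuous_snd)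
  have hr : ∀ n, Continuous fun q : (ℤ → Fin N → ℝ) × (ℤ → Fin N → ℝ) => residual A q.1 n :=
    fun n => (continuous_residual A n).comp continuous_fst
  simp only [Good, EnergyLower, DeviationBound, Set.ofPred_and, Set.ofPred_forall]
  refine (isClosed_iInter fun v => isClosed_le continuous_const ?_).inter
    (isClosed_iInter fun D => isClosed_iInter fun _ => isClosed_iInter fun _ =>
      isClosed_iInter fun _ => isClosed_le ?_ continuous_const)
  · exact continuous_finsetSum _ fun n _ => (continuous_const.dotProduct (hp n)).pow 2
  · exact continuous_finsetSum _ fun n _ =>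
      (hr n).dotProduct (Continuous.matrix_mulVec continuous_const (hp n))

end good


section deterministic

variable {N P : ℕ}

lemma unfold₁_mulVec_predictor (A : Tensor N N P) (u : ℤ → Fin N → ℝ) (n : ℤ) :
    unfold₁ A *ᵥ predictor P u n = ∑ j : Fin P, slice A j *ᵥ u (n - 1 - (j.val : ℤ)) := by
  ext i
  rw [Finset.sum_apply, Matrix.mulVec, dotProduct, Fintype.sum_prod_type]
  rfl

lemma residual_eq_sub (A : Tensor N N P) (u : ℤ → Fin N → ℝ) (n : ℤ) :
    residual A u n = u n - unfold₁ A *ᵥ predictor P u n := by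
  rw [unfold₁_mulVec_predictor, residual]

lemma residual_add (A : Tensor N N P) (p h : ℤ → Fin N → ℝ) (n : ℤ) :
    residual A (p + h) n = residual A p n + residual A h n := by
  rw [residual_eq_sub, residual_eq_sub, residual_eq_sub, predictor_add, Matrix.mulVec_add,
    Pi.add_apply]
  abel

lemma unfold₁_sub (B A : Tensor N N P) : unfold₁ (B - A) = unfold₁ B - unfold₁ A := rfl

/-- The squared prediction difference is controlled by the correlation with the residuals whenever
the loss does not increase. -/
lemma sum_sq_le_of_loss_le {T : ℕ} (hT : 0 < T) {u : ℤ → Fin N → ℝ} {A B : Tensor N N P}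
    (h : loss T u B ≤ loss T u A) :
    ∑ n ∈ Finset.Icc ((P : ℤ) + 1) T, (unfold₁ (B - A) *ᵥ predictor P u n) ⬝ᵥ
      (unfold₁ (B - A) *ᵥ predictor P u n)
      ≤ 2 * ∑ n ∈ Finset.Icc ((P : ℤ) + 1) T, residual A u n ⬝ᵥ
        (unfold₁ (B - A) *ᵥ predictor P u n) := by
  have hT' : (0 : ℝ) < 1 / T := by positivity
  have h1 := le_of_mul_le_mul_left h hT'
  rw [Finset.mul_sum, ← sub_nonneg, ← Finset.sum_sub_distrib]
  rw [← sub_nonneg, ← Finset.sum_sub_distrib] at h1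
  refine h1.trans (le_of_eq (Finset.sum_congr rfl fun n _ => ?_))
  rw [unfold₁_sub, Matrix.sub_mulVec, residual_eq_sub, dotProduct, dotProduct, Finset.mul_sum,
    ← Finset.sum_sub_distrib, ← Finset.sum_sub_distrib]
  refine Finset.sum_congr rfl fun i _ => ?_
  simp only [Pi.sub_apply]
  ring

lemma sum_dotProduct_le_sqrt {ι κ : Type*} [Fintype κ] (s : Finset ι) (f g : ι → κ → ℝ) :
    ∑ n ∈ s, f n ⬝ᵥ g n
      ≤ Real.sqrt (∑ n ∈ s, f n ⬝ᵥ f n) * Real.sqrt (∑ n ∈ s, g n ⬝ᵥ g n) := by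
  have e : ∀ f g : ι → κ → ℝ, ∑ n ∈ s, f n ⬝ᵥ g n
      = ∑ q ∈ s ×ˢ (Finset.univ : Finset κ), f q.1 q.2 * g q.1 q.2 := fun f g => by
    rw [Finset.sum_product]; rfl
  rw [e, e, e]
  simp only [← sq]
  exact Real.sum_mul_le_sqrt_mul_sqrt _ _ _

lemma error_bounds_of_basic {Q F W q L T : ℝ} (hL : 0 < L) (hT : 0 < T) (hq : 0 ≤ q)
    (hQ0 : 0 ≤ Q) (hQ : Q ≤ 2 * (1632 * (T * q) * F + Real.sqrt W * Real.sqrt Q))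
    (hF : L * T / 256 * F ^ 2 ≤ Q) (hW : W ≤ T * q ^ 2 / L) :
    Q ≤ 3 * 10 ^ 9 * (T * q ^ 2 / L) ∧ F ≤ 10 ^ 6 * (q / L) := by
  set x := Real.sqrt Q with hx
  have hx2 : x ^ 2 = Q := Real.sq_sqrt hQ0
  have hx0 : 0 ≤ x := Real.sqrt_nonneg _
  set l := Real.sqrt L with hl
  have hl2 : l ^ 2 = L := Real.sq_sqrt hL.le
  have hl0 : 0 < l := Real.sqrt_pos.2 hL
  set t := Real.sqrt T with ht
  have ht2 : t ^ 2 = T := Real.sq_sqrt hT.le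
  have ht0 : 0 < t := Real.sqrt_pos.2 hT
  have hF' : l * t * F ≤ 16 * x := by
    refine abs_le_of_sq_le_sq' ?_ (by positivity) |>.2
    have e : (l * t * F) ^ 2 = 256 * (L * T / 256 * F ^ 2) := by rw [← hl2, ← ht2]; ring
    rw [e, mul_pow, hx2]; linarith
  have hW' : Real.sqrt W ≤ t * q / l := by
    refine Real.sqrt_le_iff.2 ⟨by positivity, hW.trans (le_of_eq ?_)⟩
    rw [div_pow, mul_pow, ht2, hl2]
  set z := t * q / l with hz
  have hz0 : 0 ≤ z := by positivity
  have h1 : T * q * F ≤ 16 * z * x := by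
    calc T * q * F = z * (l * t * F) := by rw [hz, ← ht2]; field_simp
      _ ≤ z * (16 * x) := by gcongr
      _ = _ := by ring
  have h2 : Real.sqrt W * x ≤ z * x := by gcongr
  have h3 : x * x ≤ 52226 * z * x := by nlinarith
  have h4 : x ≤ 52226 * z := by
    rcases hx0.eq_or_lt with h0 | h0
    · rw [← h0]; positivity
    · exact le_of_mul_le_mul_right h3 h0
  constructor
  · have h5 : Q ≤ (52226 * z) ^ 2 := by rw [← hx2]; gcongr
    have h6 : z ^ 2 = T * q ^ 2 / L := by rw [hz, div_pow, mul_pow, ht2, hl2]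
    rw [mul_pow, h6] at h5
    have : 0 ≤ T * q ^ 2 / L := by positivity
    linarith
  · have h5 : l * t * F ≤ l * t * (10 ^ 6 * (q / L)) := by
      have e : l * t * (10 ^ 6 * (q / L)) = 10 ^ 6 * z := by rw [hz, ← hl2]; field_simp
      rw [e]; linarith
    exact le_of_mul_le_mul_left h5 (by positivity)

lemma EnergyLower.frob_sq_le {T : ℕ} {b : ℝ} {u : ℤ → Fin N → ℝ} (h : EnergyLower P T b u)
    (D : Tensor N N P) :
    b * frob D ^ 2 ≤ ∑ n ∈ Finset.Icc ((P : ℤ) + 1) T,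
      (unfold₁ D *ᵥ predictor P u n) ⬝ᵥ (unfold₁ D *ᵥ predictor P u n) := by
  have h4 : ∀ n, (unfold₁ D *ᵥ predictor P u n) ⬝ᵥ (unfold₁ D *ᵥ predictor P u n)
      = ∑ i, (unfold₁ D i ⬝ᵥ predictor P u n) ^ 2 := fun n =>
    Finset.sum_congr rfl fun i _ => (sq _).symm
  simp only [h4]
  rw [← sum_unfold₁_sq, Finset.mul_sum, Finset.sum_comm]
  exact Finset.sum_le_sum fun i _ => h (unfold₁ D i)

lemma rank_sub_le {m n : Type*} [Finite m] [Fintype n] (X Y : Matrix m n ℝ)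
    {r : ℕ} (hX : X.rank ≤ r) (hY : Y.rank ≤ r) : (X - Y).rank ≤ 2 * r := by
  have h1 : LinearMap.range (X - Y).mulVecLin
      ≤ LinearMap.range X.mulVecLin ⊔ LinearMap.range Y.mulVecLin := by
    rintro _ ⟨v, rfl⟩
    rw [Matrix.mulVecLin_apply, Matrix.sub_mulVec]
    exact sub_mem (Submodule.mem_sup_left ⟨v, rfl⟩) (Submodule.mem_sup_right ⟨v, rfl⟩)
  have h2 := (Submodule.finrank_mono h1).trans (Submodule.finrank_add_le_finrank_add_finrank _ _)
  have h3 : (X - Y).rank ≤ X.rank + Y.rank := h2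
  omega

/-- Estimation error bounds for every tensor of low multilinear rank that fits at least as well as
the coefficient tensor. -/
lemma Good.error_bounds {A B : Tensor N N P} {S : Matrix (Fin N) (Fin N) ℝ} {κ : ℝ}
    {T r₁ r₂ r₃ : ℕ} {p h : ℤ → Fin N → ℝ} (hg : Good A S κ T r₁ r₂ r₃ p h) (hT : 0 < T)
    (hL : 0 < kappaL A S)
    (hA₁ : (unfold₁ A).rank ≤ r₁) (hA₂ : (unfold₂ A).rank ≤ r₂) (hA₃ : (unfold₃ A).rank ≤ r₃)
    (hB₁ : (unfold₁ B).rank ≤ r₁) (hB₂ : (unfold₂ B).rank ≤ r₂) (hB₃ : (unfold₃ B).rank ≤ r₃)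
    (hq : 0 ≤ noiseRate A S κ (dM N P r₁ r₂ r₃) T)
    (hW : ∑ n ∈ Finset.Icc ((P : ℤ) + 1) T, residual A h n ⬝ᵥ residual A h n
      ≤ T * noiseRate A S κ (dM N P r₁ r₂ r₃) T ^ 2 / kappaL A S)
    (hloss : loss T (p + h) B ≤ loss T (p + h) A) :
    frob (B - A) ≤ 10 ^ 6 * (noiseRate A S κ (dM N P r₁ r₂ r₃) T / kappaL A S) ∧
      predError T (p + h) A B
        ≤ 3 * 10 ^ 9 * (noiseRate A S κ (dM N P r₁ r₂ r₃) T ^ 2 / kappaL A S) := by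
  have hT' : (0 : ℝ) < T := by exact_mod_cast hT
  set q := noiseRate A S κ (dM N P r₁ r₂ r₃) T with hqd
  have h1 := sum_sq_le_of_loss_le hT hloss
  simp only [residual_add, add_dotProduct, Finset.sum_add_distrib] at h1
  have h2 := hg.2 (B - A) (rank_sub_le _ _ hB₁ hA₁) (rank_sub_le _ _ hB₂ hA₂)
    (rank_sub_le _ _ hB₃ hA₃)
  have h3 := sum_dotProduct_le_sqrt (Finset.Icc ((P : ℤ) + 1) T) (fun n => residual A h n)
    (fun n => unfold₁ (B - A) *ᵥ predictor P (p + h) n)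
  have h4 := hg.1.frob_sq_le (B - A)
  obtain ⟨h5, h6⟩ := error_bounds_of_basic hL hT' hq
    (Finset.sum_nonneg fun n _ => dotProduct_self_nonneg' _)
    (h1.trans (mul_le_mul_of_nonneg_left (add_le_add h2 h3) zero_le_two)) h4 hW
  refine ⟨h6, ?_⟩
  have e : predError T (p + h) A B = (1 / (T : ℝ)) * ∑ n ∈ Finset.Icc ((P : ℤ) + 1) T,
      (unfold₁ (B - A) *ᵥ predictor P (p + h) n) ⬝ᵥ
        (unfold₁ (B - A) *ᵥ predictor P (p + h) n) := by
    rw [predError]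
    congr 1
    refine Finset.sum_congr rfl fun n _ => Finset.sum_congr rfl fun i _ => ?_
    rw [unfold₁_sub, Matrix.sub_mulVec, Pi.sub_apply, sq]
  rw [e, one_div, inv_mul_le_iff₀ hT']
  refine h5.trans (le_of_eq ?_)
  ring

lemma abs_le_frob {p₁ p₂ p₃ : ℕ} (X : Tensor p₁ p₂ p₃) (i : Fin p₁) (j : Fin p₂) (k : Fin p₃) :
    |X i j k| ≤ frob X := by
  rw [← Real.sqrt_sq_eq_abs]
  refine Real.sqrt_le_sqrt ?_
  calc X i j k ^ 2 ≤ ∑ k, X i j k ^ 2 :=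
        Finset.single_le_sum (f := fun k => X i j k ^ 2) (fun _ _ => sq_nonneg _)
          (Finset.mem_univ k)
    _ ≤ ∑ j, ∑ k, X i j k ^ 2 :=
        Finset.single_le_sum (f := fun j => ∑ k, X i j k ^ 2)
          (fun _ _ => Finset.sum_nonneg fun _ _ => sq_nonneg _) (Finset.mem_univ j)
    _ ≤ _ := Finset.single_le_sum (f := fun i => ∑ j, ∑ k, X i j k ^ 2)
          (fun _ _ => Finset.sum_nonneg fun _ _ => Finset.sum_nonneg fun _ _ => sq_nonneg _)
          (Finset.mem_univ i)

lemma IsContraction.abs_le_one {m n : ℕ} {V : Matrix (Fin m) (Fin n) ℝ} (hV : IsContraction V)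
    (i : Fin m) (j : Fin n) : |V i j| ≤ 1 := by
  have h := hV (Pi.single j 1)
  rw [Matrix.mulVec_single_one] at h
  have h1 : V.col j ⬝ᵥ V.col j ≤ 1 := by simpa using h
  have h2 : V i j * V i j ≤ V.col j ⬝ᵥ V.col j :=
    Finset.single_le_sum (f := fun i => V i j * V i j) (fun _ _ => mul_self_nonneg _)
      (Finset.mem_univ i)
  exact abs_le_one_iff_mul_self_le_one.2 (h2.trans h1)

lemma frob_add_le {p₁ p₂ p₃ : ℕ} (X Y : Tensor p₁ p₂ p₃) : frob (X + Y) ≤ frob X + frob Y := by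
  have e : ∀ X : Tensor p₁ p₂ p₃,
      frob X = ‖WithLp.toLp 2 fun q : Fin p₁ × Fin p₂ × Fin p₃ => X q.1 q.2.1 q.2.2‖ := by
    intro X
    rw [EuclideanSpace.norm_eq, frob]
    simp [Fintype.sum_prod_type]
  rw [e, e, e]
  exact norm_add_le (WithLp.toLp 2 fun q : Fin p₁ × Fin p₂ × Fin p₃ => X q.1 q.2.1 q.2.2)
    (WithLp.toLp 2 fun q : Fin p₁ × Fin p₂ × Fin p₃ => Y q.1 q.2.1 q.2.2)

/-- A minimizer exists when the tensors that fit at least as well as `A` are bounded. -/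
lemma exists_isMLREstimate {T r₁ r₂ r₃ : ℕ} {u : ℤ → Fin N → ℝ} {A : Tensor N N P} {R : ℝ}
    (hA₁ : (unfold₁ A).rank ≤ r₁) (hA₂ : (unfold₂ A).rank ≤ r₂) (hA₃ : (unfold₃ A).rank ≤ r₃)
    (hR : ∀ B : Tensor N N P, (unfold₁ B).rank ≤ r₁ → (unfold₂ B).rank ≤ r₂ →
      (unfold₃ B).rank ≤ r₃ → loss T u B ≤ loss T u A → frob (B - A) ≤ R) :
    ∃ B : Tensor N N P, IsMLREstimate T r₁ r₂ r₃ u B := by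
  set c : ℝ := R + frob A with hc
  set b : Tensor r₁ r₂ r₃ × (Fin N → Fin r₁ → ℝ) × (Fin N → Fin r₂ → ℝ) × (Fin P → Fin r₃ → ℝ) :=
    (fun _ _ _ => c, fun _ _ => 1, fun _ _ => 1, fun _ _ => 1) with hb
  let f : Tensor r₁ r₂ r₃ × (Fin N → Fin r₁ → ℝ) × (Fin N → Fin r₂ → ℝ) × (Fin P → Fin r₃ → ℝ) →
      Tensor N N P := fun x =>
    tucker x.1 (Matrix.of x.2.1) (Matrix.of x.2.2.1) (Matrix.of x.2.2.2)
  have hmem : ∀ B : Tensor N N P, (unfold₁ B).rank ≤ r₁ → (unfold₂ B).rank ≤ r₂ →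
      (unfold₃ B).rank ≤ r₃ → loss T u B ≤ loss T u A → ∃ x ∈ Set.Icc (-b) b, f x = B := by
    intro B h₁ h₂ h₃ hB
    obtain ⟨G, U₁, U₂, U₃, hBt, hG, hU₁, hU₂, hU₃⟩ := exists_tucker_of_rank_le B h₁ h₂ h₃
    have hBc : frob B ≤ c := by
      have := frob_add_le (B - A) A
      rw [sub_add_cancel] at this
      linarith [hR B h₁ h₂ h₃ hB]
    have e1 : ∀ i j k, |G i j k| ≤ c := fun i j k => (abs_le_frob G i j k).trans (hG.trans hBc)
    refine ⟨(G, U₁, U₂, U₃), ⟨⟨fun i j k => (abs_le.1 (e1 i j k)).1,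
      fun i j => (abs_le.1 (hU₁.abs_le_one i j)).1, fun i j => (abs_le.1 (hU₂.abs_le_one i j)).1,
      fun i j => (abs_le.1 (hU₃.abs_le_one i j)).1⟩, ⟨fun i j k => (abs_le.1 (e1 i j k)).2,
      fun i j => (abs_le.1 (hU₁.abs_le_one i j)).2, fun i j => (abs_le.1 (hU₂.abs_le_one i j)).2,
      fun i j => (abs_le.1 (hU₃.abs_le_one i j)).2⟩⟩, hBt.symm⟩
  have hcont : Continuous fun x => loss T u (f x) := by
    simp only [f, loss, tucker, unfold₁, Matrix.mulVec, dotProduct, Matrix.of_apply]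
    fun_prop
  obtain ⟨x₀, hx₀, hf₀⟩ := hmem A hA₁ hA₂ hA₃ le_rfl
  obtain ⟨x, hx, hmin⟩ := (isCompact_Icc (a := -b) (b := b)).exists_isMinOn ⟨x₀, hx₀⟩
    hcont.continuousOn
  have hxA : loss T u (f x) ≤ loss T u A := by rw [← hf₀]; exact hmin hx₀
  refine ⟨f x, x.1, Matrix.of x.2.1, Matrix.of x.2.2.1, Matrix.of x.2.2.2, rfl, ?_⟩
  intro G' U₁' U₂' U₃'
  rcases le_total (loss T u A) (loss T u (tucker G' U₁' U₂' U₃')) with h | h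
  · exact hxA.trans h
  · obtain ⟨x', hx', hf'⟩ := hmem (tucker G' U₁' U₂' U₃') (rank_unfold₁_tucker_le _ _ _ _)
      (rank_unfold₂_tucker_le _ _ _ _) (rank_unfold₃_tucker_le _ _ _ _) h
    rw [← hf']
    exact hmin hx'

end deterministic


section energy

variable {N P : ℕ}

/-- The energy of a path over the sample period. -/
noncomputable def sampleEnergy (T : ℕ) (h : ℤ → Fin N → ℝ) : ℝ := ∑ n ∈ Finset.Icc (1 : ℤ) T, h n ⬝ᵥ h n

lemma sum_predictor_sq_le (T : ℕ) (h : ℤ → Fin N → ℝ) :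
    ∑ n ∈ Finset.Icc ((P : ℤ) + 1) T, predictor P h n ⬝ᵥ predictor P h n
      ≤ P * sampleEnergy T h := by
  have e : ∀ n, predictor P h n ⬝ᵥ predictor P h n
      = ∑ j : Fin P, h (n - 1 - (j.val : ℤ)) ⬝ᵥ h (n - 1 - (j.val : ℤ)) := by
    intro n
    rw [dotProduct, Fintype.sum_prod_type]
    rfl
  simp only [e]
  rw [Finset.sum_comm]
  have h1 : ∀ j : Fin P, ∑ n ∈ Finset.Icc ((P : ℤ) + 1) T,
      h (n - 1 - (j.val : ℤ)) ⬝ᵥ h (n - 1 - (j.val : ℤ)) ≤ sampleEnergy T h := by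
    intro j
    rw [← Finset.sum_image (f := fun k => h k ⬝ᵥ h k) (g := fun n : ℤ => n - 1 - (j.val : ℤ))
      (fun a _ b _ hab => by simpa using hab)]
    refine Finset.sum_le_sum_of_subset_of_nonneg ?_ fun k _ _ => dotProduct_self_nonneg' _
    intro k hk
    obtain ⟨n, hn, rfl⟩ := Finset.mem_image.1 hk
    rw [Finset.mem_Icc] at hn ⊢
    have := j.2
    omega
  refine (Finset.sum_le_sum fun j _ => h1 j).trans (le_of_eq ?_)
  simp

lemma sum_residual_sq_le (A : Tensor N N P) (hP : 0 < P) (hN : 0 < N) (T : ℕ)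
    (h : ℤ → Fin N → ℝ) :
    ∑ n ∈ Finset.Icc ((P : ℤ) + 1) T, residual A h n ⬝ᵥ residual A h n
      ≤ 4 * P * muMax A * sampleEnergy T h := by
  have hmu := one_le_muMax A hN
  have hP1 : (1 : ℝ) ≤ P := by exact_mod_cast hP
  have hS : 0 ≤ sampleEnergy T h := Finset.sum_nonneg fun n _ => dotProduct_self_nonneg' _
  have h1 : ∀ n, residual A h n ⬝ᵥ residual A h n
      ≤ 2 * (h n ⬝ᵥ h n) + 2 * muMax A * (predictor P h n ⬝ᵥ predictor P h n) := by
    intro n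
    have h2 := unfold₁_mulVec_le_muMax A hN (predictor P h n)
    rw [residual_eq_sub]
    set z := unfold₁ A *ᵥ predictor P h n
    have h3 := dotProduct_self_nonneg' (h n + z)
    simp only [sub_dotProduct, dotProduct_sub, add_dotProduct, dotProduct_add] at h3 ⊢
    linarith
  refine (Finset.sum_le_sum fun n _ => h1 n).trans ?_
  rw [Finset.sum_add_distrib, ← Finset.mul_sum, ← Finset.mul_sum]
  have h4 : ∑ n ∈ Finset.Icc ((P : ℤ) + 1) T, h n ⬝ᵥ h n ≤ sampleEnergy T h :=
    Finset.sum_le_sum_of_subset_of_nonneg (Finset.Icc_subset_Icc_left (by omega))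
      fun k _ _ => dotProduct_self_nonneg' _
  have h5 := sum_predictor_sq_le (P := P) T h
  have h6 : 1 ≤ P * muMax A := one_le_mul_of_one_le_of_one_le hP1 hmu
  calc _ ≤ 2 * sampleEnergy T h + 2 * muMax A * (P * sampleEnergy T h) := by gcongr
    _ ≤ _ := by nlinarith

lemma predictor_congr {T : ℕ} {u u' : ℤ → Fin N → ℝ}
    (h : ∀ n ∈ Finset.Icc (1 : ℤ) T, u n = u' n) {n : ℤ} (hn : n ∈ Finset.Icc ((P : ℤ) + 1) T) :
    predictor P u n = predictor P u' n := by
  ext q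
  rw [Finset.mem_Icc] at hn
  have := q.1.2
  rw [predictor, predictor, h _ (by rw [Finset.mem_Icc]; omega)]

lemma loss_congr {T : ℕ} {u u' : ℤ → Fin N → ℝ} (h : ∀ n ∈ Finset.Icc (1 : ℤ) T, u n = u' n)
    (B : Tensor N N P) : loss T u B = loss T u' B := by
  rw [loss, loss]
  congr 1
  refine Finset.sum_congr rfl fun n hn => ?_
  rw [predictor_congr h hn, h n (Finset.Icc_subset_Icc_left (by omega) hn)]

lemma predError_congr {T : ℕ} {u u' : ℤ → Fin N → ℝ} (h : ∀ n ∈ Finset.Icc (1 : ℤ) T, u n = u' n)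
    (A B : Tensor N N P) : predError T u A B = predError T u' A B := by
  rw [predError, predError]
  congr 1
  refine Finset.sum_congr rfl fun n hn => ?_
  rw [predictor_congr h hn]

lemma measurable_sampleEnergy (T : ℕ) : Measurable (sampleEnergy (N := N) T) := by
  unfold sampleEnergy dotProduct
  fun_prop

end energy

/-- Extension of a family indexed by the sample period by zero. -/
noncomputable def extendZero {N T : ℕ} (z : Set.Icc (1 : ℤ) T → Fin N → ℝ) : ℤ → Fin N → ℝ :=
  fun k => if h : k ∈ Set.Icc (1 : ℤ) T then z ⟨k, h⟩ else 0

lemma measurable_extendZero {N T : ℕ} : Measurable (extendZero (N := N) (T := T)) := by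
  refine measurable_pi_lambda _ fun k => ?_
  unfold extendZero
  by_cases hk : k ∈ Set.Icc (1 : ℤ) T
  · simpa only [hk, dite_true] using measurable_pi_apply _
  · simp only [hk, dite_false]; exact measurable_const

/-- A conditional probability bound integrates to an unconditional one. -/
lemma measure_le_of_indepFun {Ω α β : Type*} [MeasurableSpace Ω] [MeasurableSpace α]
    [MeasurableSpace β] {μ : Measure Ω} [IsProbabilityMeasure μ] {X : Ω → α} {Y : Ω → β}
    (h : IndepFun X Y μ) (hX : Measurable X) (hY : Measurable Y) {B : Set (α × β)}
    (hB : MeasurableSet B) {q : ENNReal} (hq : ∀ a, μ {ω | (a, Y ω) ∈ B} ≤ q) :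
    μ {ω | (X ω, Y ω) ∈ B} ≤ q := by
  have h1 := lintegral_mul_le_of_indepFun h hX hY (f := fun _ => 1) measurable_const
    (g := fun a b => B.indicator 1 (a, b)) (measurable_one.indicator hB) (q := q) fun a => by
      refine le_trans (le_of_eq ?_) (hq a)
      exact lintegral_indicator_one ((measurable_const.prodMk hY) hB)
  simp only [one_mul, lintegral_one, measure_univ, mul_one] at h1
  refine le_trans (le_of_eq ?_) h1
  exact (lintegral_indicator_one ((hX.prodMk hY) hB)).symm

section assembly

variable {Ω : Type*} {mΩ : MeasurableSpace Ω} {μ : Measure Ω}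
  {N P : ℕ} {κ : ℝ≥0} {A : Tensor N N P} {S : Matrix (Fin N) (Fin N) ℝ}
  {ξ y η : ℤ → Ω → Fin N → ℝ} {K : ℝ} {T m : ℕ}

/-- The estimation errors, extended by zero outside the sample period. -/
noncomputable def errorPath (T : ℕ) (η : ℤ → Ω → Fin N → ℝ) (ω : Ω) : ℤ → Fin N → ℝ :=
  extendZero fun n : Set.Icc (1 : ℤ) T => η n ω

lemma errorPath_of_mem {n : ℤ} (hn : n ∈ Finset.Icc (1 : ℤ) T) (η : ℤ → Ω → Fin N → ℝ) (ω : Ω) :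
    errorPath T η ω n = η n ω :=
  dif_pos (by rwa [Finset.mem_Icc] at hn)

lemma HasMomentBound.measurable_errorPath (hη : HasMomentBound μ K T m η) :
    Measurable (errorPath T η) :=
  measurable_extendZero.comp (measurable_pi_lambda _ fun n => hη.measurable n n.2)

lemma sampleEnergy_errorPath (η : ℤ → Ω → Fin N → ℝ) (ω : Ω) :
    sampleEnergy T (errorPath T η ω) = ∑ n ∈ Finset.Icc (1 : ℤ) T, ∑ i, η n ω i ^ 2 := by
  refine Finset.sum_congr rfl fun n hn => ?_
  rw [errorPath_of_mem hn]
  exact Finset.sum_congr rfl fun i _ => (sq _).symm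

lemma HasMomentBound.measure_le_sampleEnergy (hη : HasMomentBound μ K T m η) {ε : ℝ} (hε : 0 < ε) :
    μ.real {ω | ε ≤ sampleEnergy T (errorPath T η ω)}
      ≤ T * (N * (K * (m : ℝ) ^ (-(1 / 2) : ℝ))) / ε := by
  have hint : ∀ n ∈ Finset.Icc (1 : ℤ) T, ∀ i, Integrable (fun ω => η n ω i ^ 2) μ := by
    intro n hn i
    exact (hη.memLp n (by rwa [Finset.mem_Icc] at hn) i).integrable_sq
  have h1 : Integrable (fun ω => sampleEnergy T (errorPath T η ω)) μ := by
    simp only [sampleEnergy_errorPath]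
    exact integrable_finsetSum _ fun n hn => integrable_finsetSum _ fun i _ => hint n hn i
  have h2 := mul_meas_ge_le_integral_of_nonneg (μ := μ) (ae_of_all _ fun ω => show (0 : ℝ) ≤
    sampleEnergy T (errorPath T η ω) from Finset.sum_nonneg fun n _ => dotProduct_self_nonneg' _)
    h1 ε
  rw [le_div_iff₀ hε, mul_comm]
  refine h2.trans ?_
  simp only [sampleEnergy_errorPath]
  rw [integral_finsetSum _ fun n hn => integrable_finsetSum _ fun i _ => hint n hn i]
  calc _ ≤ ∑ n ∈ Finset.Icc (1 : ℤ) T, (N : ℝ) * (K * (m : ℝ) ^ (-(1 / 2) : ℝ)) := by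
        refine Finset.sum_le_sum fun n hn => ?_
        rw [integral_finsetSum _ fun i _ => hint n hn i]
        refine (Finset.sum_le_sum fun i _ =>
          hη.bound n (by rwa [Finset.mem_Icc] at hn) i).trans (le_of_eq ?_)
        simp
    _ = _ := by simp

namespace IsStableVARModel

lemma noiseRate_nonneg (hM : IsStableVARModel μ κ A S ξ y) (d : ℕ) : 0 ≤ noiseRate A S κ d T := by
  have := hM.kappaU_pos
  have := hM.lamMax_pos
  rw [noiseRate]
  positivity

variable [IsProbabilityMeasure μ]

lemma measure_not_good_and_le (hM : IsStableVARModel μ κ A S ξ y)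
    (hη : HasMomentBound μ K T m η)
    (hind : IndepFun (fun ω (n : ℤ) => modelError S ξ n ω)
      (fun ω (n : Set.Icc (1 : ℤ) T) => η n ω) μ) {r₁ r₂ r₃ : ℕ} (hNd : N ≤ dM N P r₁ r₂ r₃)
    (hT : 10 ^ 5 * P ^ 2 * ((κ : ℝ) ^ 4 * (kappaU A S / kappaL A S) ^ 2 * dM N P r₁ r₂ r₃) ≤ T) :
    μ {ω | ¬Good A S κ T r₁ r₂ r₃ (fun k => y k ω) (errorPath T η ω) ∧
        sampleEnergy T (errorPath T η ω) ≤ 1 / (4 * P)}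
      ≤ ENNReal.ofReal (3 * Real.exp (-(2 * dM N P r₁ r₂ r₃))) := by
  have hP1 : (0 : ℝ) < P := by exact_mod_cast hM.P_pos
  have hi : IndepFun (errorPath T η) (fun ω k => y k ω) μ :=
    ((hM.stationaryVAR.indepFun_of_indepFun_error hM.P_pos hM.N_pos hM.stable hM.muMin_pos
      hind).comp measurable_id measurable_extendZero).symm
  have hG := (isClosed_good A S κ T r₁ r₂ r₃).measurableSet
  set B : Set ((ℤ → Fin N → ℝ) × (ℤ → Fin N → ℝ)) :=
    {q | ¬Good A S κ T r₁ r₂ r₃ q.2 q.1 ∧ sampleEnergy T q.1 ≤ 1 / (4 * P)} with hB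
  have hBm : MeasurableSet B :=
    (measurable_swap hG).compl.inter
      (measurableSet_le ((measurable_sampleEnergy T).comp measurable_fst) measurable_const)
  refine measure_le_of_indepFun hi hη.measurable_errorPath hM.measurable_path hBm fun h => ?_
  by_cases hs : sampleEnergy T h ≤ 1 / (4 * P)
  · have h3 : ∑ n ∈ Finset.Icc ((P : ℤ) + 1) T, predictor P h n ⬝ᵥ predictor P h n ≤ 1 := by
      refine (sum_predictor_sq_le T _).trans ?_
      calc (P : ℝ) * sampleEnergy T h ≤ P * (1 / (4 * P)) := by gcongr
        _ = 1 / 4 := by field_simp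
        _ ≤ 1 := by norm_num
    exact (measure_mono fun ω' hω' => hω'.1).trans (hM.measure_not_good_le h hNd hT h3)
  · have : {ω | (h, fun k => y k ω) ∈ B} = ∅ :=
      Set.eq_empty_of_forall_notMem fun ω hω => hs hω.2
    rw [this, measure_empty]
    exact zero_le

lemma muMax_le (hM : IsStableVARModel μ κ A S ξ y) {d : ℕ} (hd : 1 ≤ d) (hT : 0 < T) :
    muMax A ≤ T * noiseRate A S κ d T ^ 2 / kappaL A S := by
  have hU := hM.kappaU_pos
  have hl := hM.lamMax_pos
  have hL := hM.kappaL_pos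
  have hT' : (0 : ℝ) < T := by exact_mod_cast hT
  have hd' : (1 : ℝ) ≤ d := by exact_mod_cast hd
  have hκ1 : (1 : ℝ) ≤ κ := by exact_mod_cast hM.one_le_kappa
  have hmu : 0 < muMax A := zero_lt_one.trans_le (one_le_muMax A hM.N_pos)
  have h1 : kappaU A S * (d / T) ≤ noiseRate A S κ d T ^ 2 := by
    rw [noiseRate, mul_pow, Real.sq_sqrt (by positivity)]
    gcongr
    calc kappaU A S = (1 * Real.sqrt (kappaU A S)) ^ 2 := by rw [one_mul, Real.sq_sqrt hU.le]
      _ ≤ (κ * Real.sqrt (kappaU A S)) ^ 2 := by gcongr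
      _ ≤ _ := by gcongr; exact le_add_of_nonneg_left (by positivity)
  rw [le_div_iff₀ hL]
  have h2 : muMax A * kappaL A S = lamMin S := by rw [kappaL]; field_simp
  rw [h2]
  calc lamMin S ≤ kappaU A S :=
        (lamMin_le_lamMax hM.N_pos hM.posDef.1).trans hM.lamMax_le_kappaU
    _ ≤ kappaU A S * d := le_mul_of_one_le_right hU.le hd'
    _ = T * (kappaU A S * (d / T)) := by field_simp
    _ ≤ _ := by gcongr

end IsStableVARModel

lemma noiseRate_le_rate (A : Tensor N N P) (S : Matrix (Fin N) (Fin N) ℝ) (κ δ : ℝ) (d T m : ℕ) :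
    noiseRate A S κ d T ≤ rate A S κ δ d T m :=
  le_add_of_nonneg_right (by positivity)

lemma moment_bound_le_exp {K c₂ M t : ℝ} {N P T d : ℝ} (hK : 0 < K) (hc : 4 * K ≤ c₂ ^ 2)
    (hc0 : 0 < c₂) (hN : 1 ≤ N) (hP : 1 ≤ P) (hT : 0 < T) (hM : 0 < M) (ht : 0 < t)
    (h1 : c₂ * (N ^ 2 * P * Real.exp d) ≤ M * t) (h2 : c₂ * (T * t) ≤ M) :
    T * (N * (K * (M ^ 2)⁻¹)) / (1 / (4 * P)) ≤ Real.exp (-d) := by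
  have hP0 : 0 < P := by linarith
  have hN0 : 0 < N := by linarith
  have he := Real.exp_pos d
  have h3 : c₂ * (N ^ 2 * P * Real.exp d) * (c₂ * (T * t)) ≤ M * t * M := by gcongr
  have h4 : c₂ ^ 2 * N ^ 2 * P * Real.exp d * T ≤ M ^ 2 := by
    have : c₂ ^ 2 * N ^ 2 * P * Real.exp d * T * t ≤ M ^ 2 * t := by linarith
    exact le_of_mul_le_mul_right this ht
  rw [Real.exp_neg, ← one_div (Real.exp d), le_div_iff₀ he]
  have e : T * (N * (K * (M ^ 2)⁻¹)) / (1 / (4 * P)) * Real.exp d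
      = (4 * K * N * P * Real.exp d * T) / M ^ 2 := by field_simp
  rw [e, div_le_one (by positivity)]
  refine le_trans ?_ h4
  have : N ≤ N ^ 2 := by nlinarith
  gcongr

lemma exp_add_three_mul_exp_le {d : ℝ} (hd : 2 ≤ d) :
    Real.exp (-d) + 3 * Real.exp (-(2 * d)) ≤ Real.exp (-(1 / 2 * d)) := by
  set x := Real.exp (-(1 / 2 * d)) with hx
  have h1 : Real.exp (-d) = x ^ 2 := by rw [hx, ← Real.exp_nat_mul]; congr 1; push_cast; ring
  have h2 : Real.exp (-(2 * d)) = x ^ 4 := by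
    rw [hx, ← Real.exp_nat_mul]; congr 1; push_cast; ring
  have hx0 : 0 < x := Real.exp_pos _
  have hx1 : x ≤ 1 / 2 := by
    rw [hx, Real.exp_neg, ← one_div]
    refine one_div_le_one_div_of_le two_pos ?_
    linarith [Real.add_one_le_exp (1 / 2 * d)]
  rw [h1, h2]
  have h3 : x + 3 * x ^ 3 ≤ 1 := by
    have : x ^ 3 ≤ (1 / 2) ^ 3 := by gcongr
    norm_num at this
    linarith
  nlinarith

lemma tucker_eq_zero {r₁ r₂ r₃ : ℕ} (hr : r₁ = 0 ∨ r₂ = 0 ∨ r₃ = 0) (G : Tensor r₁ r₂ r₃)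
    (U₁ : Matrix (Fin N) (Fin r₁) ℝ) (U₂ : Matrix (Fin N) (Fin r₂) ℝ)
    (U₃ : Matrix (Fin P) (Fin r₃) ℝ) : tucker G U₁ U₂ U₃ = 0 := by
  ext i j k
  rcases hr with rfl | rfl | rfl <;> simp [tucker]

end assembly


section main

variable {Ω : Type*} {mΩ : MeasurableSpace Ω} {μ : Measure Ω} [IsProbabilityMeasure μ]
  {N P : ℕ} {κ : ℝ≥0} {A : Tensor N N P} {S : Matrix (Fin N) (Fin N) ℝ}
  {ξ y η : ℤ → Ω → Fin N → ℝ} {K δ c₂ : ℝ} {T m r₁ r₂ r₃ : ℕ}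

/-- On the good event the minimizer exists and every minimizer obeys the error bounds. -/
lemma IsStableVARModel.estimate_bounds (hM : IsStableVARModel μ κ A S ξ y) {p h u : ℤ → Fin N → ℝ}
    (hu : ∀ n ∈ Finset.Icc (1 : ℤ) T, u n = (p + h) n) (hT : 0 < T)
    (hA₁ : (unfold₁ A).rank ≤ r₁) (hA₂ : (unfold₂ A).rank ≤ r₂) (hA₃ : (unfold₃ A).rank ≤ r₃)
    (hd : 1 ≤ dM N P r₁ r₂ r₃) (hg : Good A S κ T r₁ r₂ r₃ p h)
    (hh : sampleEnergy T h ≤ 1 / (4 * P)) :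
    (∃ B : Tensor N N P, IsMLREstimate T r₁ r₂ r₃ u B) ∧
      ∀ B : Tensor N N P, IsMLREstimate T r₁ r₂ r₃ u B →
        frob (B - A) ≤ 3 * 10 ^ 9 / kappaL A S * rate A S κ δ (dM N P r₁ r₂ r₃) T m ∧
        predError T u A B
          ≤ 3 * 10 ^ 9 / kappaL A S * rate A S κ δ (dM N P r₁ r₂ r₃) T m ^ 2 := by
  have hL := hM.kappaL_pos
  have hP0 : (0 : ℝ) < P := by exact_mod_cast hM.P_pos
  have hq := hM.noiseRate_nonneg (T := T) (dM N P r₁ r₂ r₃)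
  have hqr := noiseRate_le_rate A S κ δ (dM N P r₁ r₂ r₃) T m
  have hmu : 0 < muMax A := zero_lt_one.trans_le (one_le_muMax A hM.N_pos)
  have hW : ∑ n ∈ Finset.Icc ((P : ℤ) + 1) T, residual A h n ⬝ᵥ residual A h n
      ≤ T * noiseRate A S κ (dM N P r₁ r₂ r₃) T ^ 2 / kappaL A S := by
    refine (sum_residual_sq_le A hM.P_pos hM.N_pos T h).trans (le_trans ?_ (hM.muMax_le hd hT))
    calc 4 * P * muMax A * sampleEnergy T h ≤ 4 * P * muMax A * (1 / (4 * P)) := by gcongr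
      _ = muMax A := by field_simp
  have hbound : ∀ B : Tensor N N P, (unfold₁ B).rank ≤ r₁ → (unfold₂ B).rank ≤ r₂ →
      (unfold₃ B).rank ≤ r₃ → loss T u B ≤ loss T u A →
      frob (B - A) ≤ 10 ^ 6 * (noiseRate A S κ (dM N P r₁ r₂ r₃) T / kappaL A S) ∧
      predError T u A B
        ≤ 3 * 10 ^ 9 * (noiseRate A S κ (dM N P r₁ r₂ r₃) T ^ 2 / kappaL A S) := by
    intro B hB₁ hB₂ hB₃ hloss
    rw [loss_congr hu, loss_congr hu] at hloss
    rw [predError_congr hu]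
    exact hg.error_bounds hT hL hA₁ hA₂ hA₃ hB₁ hB₂ hB₃ hq hW hloss
  refine ⟨exists_isMLREstimate hA₁ hA₂ hA₃ fun B h₁ h₂ h₃ hl => (hbound B h₁ h₂ h₃ hl).1, ?_⟩
  rintro B ⟨G, U₁, U₂, U₃, rfl, hmin⟩
  have hloss : loss T u (tucker G U₁ U₂ U₃) ≤ loss T u A := by
    obtain ⟨G', U₁', U₂', U₃', hA, -⟩ := exists_tucker_of_rank_le A hA₁ hA₂ hA₃
    rw [hA]
    exact hmin G' U₁' U₂' U₃'
  obtain ⟨h1, h2⟩ := hbound _ (rank_unfold₁_tucker_le _ _ _ _) (rank_unfold₂_tucker_le _ _ _ _)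
    (rank_unfold₃_tucker_le _ _ _ _) hloss
  refine ⟨h1.trans ?_, h2.trans ?_⟩
  · rw [div_mul_eq_mul_div, mul_div_assoc]
    gcongr
    norm_num
  · rw [div_mul_eq_mul_div, mul_div_assoc]
    gcongr

/-- Probability of the good event. -/
lemma IsStableVARModel.le_measure_good (hM : IsStableVARModel μ κ A S ξ y)
    (hη : HasMomentBound μ K T m η)
    (hind : IndepFun (fun ω (n : ℤ) => modelError S ξ n ω)
      (fun ω (n : Set.Icc (1 : ℤ) T) => η n ω) μ) (hNd : N ≤ dM N P r₁ r₂ r₃)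
    (hd : 2 ≤ dM N P r₁ r₂ r₃) (hK : 0 < K) (hc₂ : 0 < c₂) (hc : 4 * K ≤ c₂ ^ 2)
    (hT0 : 0 < T)
    (hT : 10 ^ 5 * P ^ 2 * ((κ : ℝ) ^ 4 * (kappaU A S / kappaL A S) ^ 2 * dM N P r₁ r₂ r₃) ≤ T)
    (h1 : c₂ * ((N : ℝ) ^ 2 * P * Real.exp (dM N P r₁ r₂ r₃))
      ≤ (m : ℝ) ^ (1 / 4 : ℝ) * (T : ℝ) ^ (2 * δ))
    (h2 : c₂ * (T : ℝ) ^ (1 + 2 * δ) ≤ (m : ℝ) ^ (1 / 4 : ℝ)) :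
    ∃ E : Set Ω, MeasurableSet E ∧
      1 - Real.exp (-(1 / 2 * dM N P r₁ r₂ r₃)) ≤ μ.real E ∧
      ∀ ω ∈ E, Good A S κ T r₁ r₂ r₃ (fun k => y k ω) (errorPath T η ω) ∧
        sampleEnergy T (errorPath T η ω) ≤ 1 / (4 * P) := by
  set d := dM N P r₁ r₂ r₃ with hdd
  have hT' : (0 : ℝ) < T := by exact_mod_cast hT0
  have hP1 : (1 : ℝ) ≤ P := by exact_mod_cast hM.P_pos
  have hP0 : (0 : ℝ) < P := by linarith
  have hN1 : (1 : ℝ) ≤ N := by exact_mod_cast hM.N_pos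
  have hm4 : 0 < (m : ℝ) ^ (1 / 4 : ℝ) := lt_of_lt_of_le (by positivity) h2
  rw [Real.rpow_add hT', Real.rpow_one] at h2
  have hm2 : (m : ℝ) ^ (-(1 / 2) : ℝ) = (((m : ℝ) ^ (1 / 4 : ℝ)) ^ 2)⁻¹ := by
    rw [Real.rpow_neg (Nat.cast_nonneg m), ← Real.rpow_natCast, ← Real.rpow_mul (Nat.cast_nonneg m)]
    norm_num
  have hmom := moment_bound_le_exp hK hc hc₂ hN1 hP1 hT' hm4
    (Real.rpow_pos_of_pos hT' (2 * δ)) h1 h2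
  rw [← hm2] at hmom
  have hmark := (hη.measure_le_sampleEnergy (ε := 1 / (4 * P)) (by positivity)).trans hmom
  have hgood := hM.measure_not_good_and_le hη hind hNd hT
  set E : Set Ω := {ω | Good A S κ T r₁ r₂ r₃ (fun k => y k ω) (errorPath T η ω) ∧
        sampleEnergy T (errorPath T η ω) ≤ 1 / (4 * P)} with hE
  have hem := hη.measurable_errorPath
  have hEm : MeasurableSet E :=
    ((hM.measurable_path.prodMk hem) (isClosed_good A S κ T r₁ r₂ r₃).measurableSet).inter
      (measurableSet_le ((measurable_sampleEnergy T).comp hem) measurable_const)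
  refine ⟨E, hEm, ?_, fun ω hω => hω⟩
  have hsub : Eᶜ ⊆ {ω | 1 / (4 * P) ≤ sampleEnergy T (errorPath T η ω)} ∪
      {ω | ¬Good A S κ T r₁ r₂ r₃ (fun k => y k ω) (errorPath T η ω) ∧
        sampleEnergy T (errorPath T η ω) ≤ 1 / (4 * P)} := by
    intro ω hω
    rcases le_total (1 / (4 * P) : ℝ) (sampleEnergy T (errorPath T η ω)) with h | h
    · exact Or.inl h
    · exact Or.inr ⟨fun hg => hω ⟨hg, h⟩, h⟩
  have hgood' : μ.real {ω | ¬Good A S κ T r₁ r₂ r₃ (fun k => y k ω) (errorPath T η ω) ∧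
        sampleEnergy T (errorPath T η ω) ≤ 1 / (4 * P)} ≤ 3 * Real.exp (-(2 * d)) :=
    ENNReal.toReal_le_of_le_ofReal (by positivity) hgood
  have hcompl : μ.real Eᶜ ≤ Real.exp (-(1 / 2 * d)) :=
    (measureReal_mono hsub).trans ((measureReal_union_le _ _).trans
      ((add_le_add hmark hgood').trans (exp_add_three_mul_exp_le (by exact_mod_cast hd))))
  rw [probReal_compl_eq_one_sub hEm] at hcompl
  linarith

end main

end MLRHAR

theorem theorem2 :
    ∃ C : ℝ, 0 < C ∧ ∀ P : ℕ, 0 < P → ∃ c c₁ : ℝ, 0 < c ∧ 0 < c₁ ∧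
    ∀ K : ℝ, 0 < K → ∃ c₂ : ℝ, 0 < c₂ ∧
    ∀ (N r₁ r₂ r₃ T m : ℕ) (κ : ℝ≥0) (δ : ℝ) (A : MLRHAR.Tensor N N P)
      (S : Matrix (Fin N) (Fin N) ℝ)
      (Ω : Type*) (_ : MeasurableSpace Ω) (μ : Measure Ω) (_ : IsProbabilityMeasure μ)
      (ξ y η : ℤ → Ω → Fin N → ℝ),
    0 < N → 0 < δ →
    -- multilinear low-rank coefficient tensor
    (MLRHAR.unfold₁ A).rank ≤ r₁ → (MLRHAR.unfold₂ A).rank ≤ r₂ → (MLRHAR.unfold₃ A).rank ≤ r₃ →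
    -- stability; the second condition makes `κ_U` well defined
    (∀ z : ℂ, ‖z‖ < 1 → (MLRHAR.matPoly A z).det ≠ 0) → 0 < MLRHAR.muMin A →
    -- sub-Gaussian model errors, integrated volatilities, and estimation errors
    S.PosDef → MLRHAR.IsSubGaussianNoise μ κ ξ →
    MLRHAR.IsStationaryVAR μ A (MLRHAR.modelError S ξ) y →
    MLRHAR.HasMomentBound μ K T m η →
    IndepFun (fun ω (n : ℤ) => MLRHAR.modelError S ξ n ω)
      (fun ω (n : Set.Icc (1 : ℤ) T) => η n ω) μ →
    -- sample-size conditions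
    c₁ * (max ((κ : ℝ) ^ 2) ((κ : ℝ) ^ 4) * (MLRHAR.kappaU A S / MLRHAR.kappaL A S) ^ 2
      * MLRHAR.dM N P r₁ r₂ r₃) ≤ T →
    c₂ * ((N : ℝ) ^ 2 * P * Real.exp (MLRHAR.dM N P r₁ r₂ r₃))
      ≤ (m : ℝ) ^ (1 / 4 : ℝ) * (T : ℝ) ^ (2 * δ) →
    c₂ * (T : ℝ) ^ (1 + 2 * δ) ≤ (m : ℝ) ^ (1 / 4 : ℝ) →
    ∃ E : Set Ω, MeasurableSet E ∧
      1 - Real.exp (-(c * MLRHAR.dM N P r₁ r₂ r₃))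
        - 2 * Real.exp (-(c * T * (MLRHAR.kappaL A S / MLRHAR.kappaU A S) ^ 2
            * min (((κ : ℝ) ^ 2)⁻¹) (((κ : ℝ) ^ 4)⁻¹))) ≤ μ.real E ∧
      ∀ ω ∈ E,
        (∃ B : MLRHAR.Tensor N N P,
          MLRHAR.IsMLREstimate T r₁ r₂ r₃ (fun n => y n ω + η n ω) B) ∧
        ∀ B : MLRHAR.Tensor N N P,
          MLRHAR.IsMLREstimate T r₁ r₂ r₃ (fun n => y n ω + η n ω) B →
          MLRHAR.frob (B - A) ≤ C / MLRHAR.kappaL A S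
              * MLRHAR.rate A S κ δ (MLRHAR.dM N P r₁ r₂ r₃) T m ∧
          MLRHAR.predError T (fun n => y n ω + η n ω) A B ≤ C / MLRHAR.kappaL A S
              * MLRHAR.rate A S κ δ (MLRHAR.dM N P r₁ r₂ r₃) T m ^ 2 := by
  refine ⟨3 * 10 ^ 9, by norm_num, fun P hP => ⟨1 / 2, 10 ^ 5 * P ^ 2, by norm_num,
    by positivity, fun K hK => ⟨1 + 4 * K, by positivity, ?_⟩⟩⟩
  intro N r₁ r₂ r₃ T m κ δ A S Ω mΩ μ hμ ξ y η hN _ hA₁ hA₂ hA₃ hst hA hS hξ hy hη hind hT h1 h2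
  have hM : MLRHAR.IsStableVARModel μ κ A S ξ y := ⟨hP, hN, hst, hA, hS, hξ, hy⟩
  have hL := hM.kappaL_pos
  have hU := hM.kappaU_pos
  have hrate : 0 ≤ MLRHAR.rate A S κ δ (MLRHAR.dM N P r₁ r₂ r₃) T m :=
    (hM.noiseRate_nonneg _).trans (MLRHAR.noiseRate_le_rate A S κ δ _ T m)
  by_cases hr : r₁ = 0 ∨ r₂ = 0 ∨ r₃ = 0
  · have hA0 : A = 0 := by
      obtain ⟨G, U₁, U₂, U₃, hAt, -⟩ := MLRHAR.exists_tucker_of_rank_le A hA₁ hA₂ hA₃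
      rw [hAt, MLRHAR.tucker_eq_zero hr]
    refine ⟨Set.univ, MeasurableSet.univ, ?_, fun ω _ => ⟨⟨0, 0, 0, 0, 0, ?_, ?_⟩, ?_⟩⟩
    · rw [probReal_univ]
      have := Real.exp_pos (-(1 / 2 * (MLRHAR.dM N P r₁ r₂ r₃ : ℝ)))
      have := Real.exp_pos (-(1 / 2 * T * (MLRHAR.kappaL A S / MLRHAR.kappaU A S) ^ 2
        * min (((κ : ℝ) ^ 2)⁻¹) (((κ : ℝ) ^ 4)⁻¹)))
      linarith
    · rw [MLRHAR.tucker_eq_zero hr]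
    · intro G' U₁' U₂' U₃'
      rw [MLRHAR.tucker_eq_zero hr, MLRHAR.tucker_eq_zero hr]
    · rintro B ⟨G, U₁, U₂, U₃, rfl, -⟩
      have hBA : MLRHAR.tucker G U₁ U₂ U₃ = A := by rw [hA0, MLRHAR.tucker_eq_zero hr]
      rw [hBA]
      constructor
      · have : MLRHAR.frob (A - A) = 0 := by simp [MLRHAR.frob]
        rw [this]
        positivity
      · have : ∀ u, MLRHAR.predError T u A A = 0 := fun u => by simp [MLRHAR.predError]
        rw [this]
        positivity
  · push Not at hr
    obtain ⟨hr₁, hr₂, -⟩ := hr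
    have hNd₁ : N ≤ N * r₁ := Nat.le_mul_of_pos_right _ (Nat.pos_of_ne_zero hr₁)
    have hNd₂ : N ≤ N * r₂ := Nat.le_mul_of_pos_right _ (Nat.pos_of_ne_zero hr₂)
    have hNd : 2 * N ≤ MLRHAR.dM N P r₁ r₂ r₃ := by
      rw [MLRHAR.dM]; omega
    have hκ : (0 : ℝ) < κ := by exact_mod_cast zero_lt_one.trans_le hM.one_le_kappa
    have hd0 : (0 : ℝ) < MLRHAR.dM N P r₁ r₂ r₃ := by
      have : 0 < MLRHAR.dM N P r₁ r₂ r₃ := by omega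
      exact_mod_cast this
    have hT4 : 10 ^ 5 * (P : ℝ) ^ 2 * ((κ : ℝ) ^ 4 * (MLRHAR.kappaU A S / MLRHAR.kappaL A S) ^ 2
        * MLRHAR.dM N P r₁ r₂ r₃) ≤ T := by
      refine le_trans ?_ hT
      gcongr
      exact le_max_right _ _
    have hT0 : 0 < T := by
      have hP' : (0 : ℝ) < P := by exact_mod_cast hP
      have : (0 : ℝ) < T := lt_of_lt_of_le (by positivity) hT4
      exact_mod_cast this
    obtain ⟨E, hEm, hEp, hE⟩ := hM.le_measure_good hη hind (r₁ := r₁) (r₂ := r₂) (r₃ := r₃)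
      (by omega) (by omega) hK (by positivity : (0 : ℝ) < 1 + 4 * K) (by nlinarith) hT0 hT4 h1 h2
    refine ⟨E, hEm, ?_, fun ω hω => ?_⟩
    · have := Real.exp_pos (-(1 / 2 * T * (MLRHAR.kappaL A S / MLRHAR.kappaU A S) ^ 2
        * min (((κ : ℝ) ^ 2)⁻¹) (((κ : ℝ) ^ 4)⁻¹)))
      linarith
    · obtain ⟨hg, hh⟩ := hE ω hω
      refine hM.estimate_bounds (fun n hn => ?_) hT0 hA₁ hA₂ hA₃ (by omega) hg hh
      rw [Pi.add_apply, MLRHAR.errorPath_of_mem hn]
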